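/- There is a function $\varepsilon:\mathbb{N}\to\mathbb{R}$ with $\varepsilon(n)\to 0$ as $n\to\infty$ such that the following two statements hold for every $n$, every directed graph $G=(V,E)$ with $|V|=n$, and every set $P\subseteq V\times V$ of demand pairs; that is, the flow-cut gap of $n$-node directed graphs is at most $n^{1/3+o(1)}$ in both the edge- and the vertex-capacitated settings. (Edge version.) Let $\mathrm{cost},w:E\to\mathbb{R}_{\ge 0}$ be edge costs and edge weights such that $w$ is a fractional multicut for $P$, i.e. for every $(s,t)\in P$ every directed path from $s$ to $t$ has total edge weight $\sum_{e\in\pi}w(e)\ge 1$. Then there is a set $X\subseteq E$ such that for every $(s,t)\in P$ every directed path from $s$ to $t$ contains at least one edge of $X$, and $$\sum_{e\in X}\mathrm{cost}(e)\;\le\;\Big(\sum_{e\in E}\mathrm{cost}(e)\,w(e)\Big)\cdot n^{1/3+\varepsilon(n)}.$$ (Vertex version.) Let $\mathrm{cost},w:V\to\mathbb{R}_{\ge 0}$ be vertex costs and vertex weights such that $w$ is a fractional multicut for $P$, i.e. for every $(s,t)\in P$ every directed path from $s$ to $t$ has total weight at least $1$ on its internal vertices (the vertices other than $s$ and $t$).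 Then there is a set $X\subseteq V$ such that for every $(s,t)\in P$ every directed path from $s$ to $t$ contains at least one internal vertex in $X$, and $$\sum_{v\in X}\mathrm{cost}(v)\;\le\;\Big(\sum_{v\in V}\mathrm{cost}(v)\,w(v)\Big)\cdot n^{1/3+\varepsilon(n)}.$$ -/

import Mathlib

open Filter Topology
open scoped NNReal ENNReal

universe u

noncomputable section

namespace DirectedCut

variable {V : Type*}

/-- `p` is the vertex sequence of a (simple) directed path from `s` to `t` in `G`.
The one-vertex sequence `[s]` is a path from `s` to `s`. -/
def IsPath (G : Digraph V) (s t : V) (p : List V) : Prop :=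
  p.IsChain G.Adj ∧ p.Nodup ∧ p.head? = some s ∧ p.getLast? = some t

/-- The list of edges traversed by the path with vertex sequence `p`. -/
def pathEdges (p : List V) : List (V × V) := p.zip p.tail

/-- The list of internal vertices of the path with vertex sequence `p`
(the first and the last vertex are removed). -/
def pathInterior (p : List V) : List V := p.tail.dropLast

open Classical in
/-- The set of edges of a finite directed graph. -/
def edges [Fintype V] (G : Digraph V) : Finset (V × V) :=
  Finset.univ.filter fun e => G.Adj e.1 e.2

/-- The distance from `s` to `t` under edge weights `w`: the minimum total weight of the edges of
a path from `s` to `t`, and `∞` if there is no such path. -/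
def edgeDist (G : Digraph V) (w : V × V → ℝ≥0) (s t : V) : ℝ≥0∞ :=
  ⨅ (p : List V) (_ : IsPath G s t p), (((pathEdges p).map w).sum : ℝ≥0)

/-- The vertex distance from `s` to `t` under vertex weights `w`: the minimum total weight of the
internal vertices of a path from `s` to `t`, and `∞` if there is no such path. -/
def vertexDist (G : Digraph V) (w : V → ℝ≥0) (s t : V) : ℝ≥0∞ :=
  ⨅ (p : List V) (_ : IsPath G s t p), (((pathInterior p).map w).sum : ℝ≥0)

/-- The edge weights `w` are a fractional multicut for the demand pairs `P`. -/
def IsFractionalEdgeMulticut (G : Digraph V) (P : Set (V × V)) (w : V × V → ℝ≥0) : Prop :=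
  ∀ s t, (s, t) ∈ P → 1 ≤ edgeDist G w s t

/-- The vertex weights `w` are a fractional multicut for the demand pairs `P`. -/
def IsFractionalVertexMulticut (G : Digraph V) (P : Set (V × V)) (w : V → ℝ≥0) : Prop :=
  ∀ s t, (s, t) ∈ P → 1 ≤ vertexDist G w s t

/-- The set `X` of edges of `G` is an integral multicut for the demand pairs `P`: every path
joining a demand pair contains an edge in `X`. -/
def IsIntegralEdgeMulticut [Fintype V] (G : Digraph V) (P : Set (V × V))
    (X : Finset (V × V)) : Prop :=
  X ⊆ edges G ∧ ∀ s t, (s, t) ∈ P → ∀ p, IsPath G s t p → ∃ e ∈ pathEdges p, e ∈ X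

/-- The set `X` of vertices is an integral multicut for the demand pairs `P`: every path
joining a demand pair contains an internal vertex in `X`. -/
def IsIntegralVertexMulticut (G : Digraph V) (P : Set (V × V)) (X : Finset V) : Prop :=
  ∀ s t, (s, t) ∈ P → ∀ p, IsPath G s t p → ∃ v ∈ pathInterior p, v ∈ X

/-- The number `γ` bounds the edge flow-cut gap of `n`-node directed graphs. -/
def EdgeFlowCutGapLE (n : ℕ) (γ : ℝ) : Prop :=
  ∀ (V : Type u) [Fintype V], Fintype.card V = n →
    ∀ (G : Digraph V) (cost w : V × V → ℝ≥0) (P : Set (V × V)),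
      IsFractionalEdgeMulticut G P w →
      ∃ X : Finset (V × V), IsIntegralEdgeMulticut G P X ∧
        ((∑ e ∈ X, cost e : ℝ≥0) : ℝ) ≤ ((∑ e ∈ edges G, cost e * w e : ℝ≥0) : ℝ) * γ

/-- The number `γ` bounds the vertex flow-cut gap of `n`-node directed graphs. -/
def VertexFlowCutGapLE (n : ℕ) (γ : ℝ) : Prop :=
  ∀ (V : Type u) [Fintype V], Fintype.card V = n →
    ∀ (G : Digraph V) (cost w : V → ℝ≥0) (P : Set (V × V)),
      IsFractionalVertexMulticut G P w →
      ∃ X : Finset V, IsIntegralVertexMulticut G P X ∧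
        ((∑ v ∈ X, cost v : ℝ≥0) : ℝ) ≤ ((∑ v, cost v * w v : ℝ≥0) : ℝ) * γ

end DirectedCut

end

set_option linter.unusedSectionVars false

/-! ### Threshold cuts, a minimax alternative, and separation of pairs by averaged levels -/

namespace DirectedCut

/-! Scale the costs so that the fractional cost `∑ c w` is `γ²`, where `γ³ = n`. A cut of cost `γ³`,
up to `n^{o(1)}`, then has ratio `γ = n^{1/3}`. This budget pays for deleting the edges cheaper than
`1/n`, edges of total cost 1 at each end of each vertex (those longer than the volume there), and
the edges longer than `w₀`, of order `1/γ`. It also pays for a low diameter decomposition at scale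
`w₀`, after which no `w`-Lipschitz function varies by more than `w₀` on a strongly connected
component.

For each demand keep a `w`-Lipschitz potential of height `L` whose positive increments cost `L * m`,
so that its random threshold cut costs `m` on average. At the start `L = 1/2`, and distances give
`m` of order at most `n`. Once `m` is below the smallest remaining edge cost, the demand has no path
left. It therefore suffices to divide `m` by about `n^η` for all demands at once, paying
`n^{1+O(η)}` and a factor 64 in `L`; this is `exists_cheaper_levels`, and `O(1/η)` rounds are
enough.

A round rests on two dualities. By `strategy_or_hasLevel`, a demand without a cheaper potential has
a strategy: a distribution on its paths that nearly respects the capacities `c / m`. Strategies then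
play against distributions `F` on the demands. The payoff samples an early vertex `a` and a late
vertex `b` on the random path (and symmetrically in the reversed graph), and records the `F`-average
climb of the old potentials from `a` to `b`, truncated at `m / γ³`. If some `F` does well against
all strategies, then cutting every pair of large average climb costs about `γ³` by
`exists_separating_edges` and leaves no strategy (`exists_hit`). Otherwise minimax produces a
mixture of strategies, and against the mixture's own distribution of demands many early-late pairs
climb less than `m / γ³` on average (`exists_gain`).

In that second case `Crossing.mass_le` yields progress. The early ends of such pairs contain a set
`Y` such that, after a further cut of cost about `γ * vol(Y)`, every surviving demand path collects
at `Y` only a share `vol(Y) / γ²` of its climb. The reason is a second moment bound: a path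
collecting more at `Y` would meet many mixture paths, which fan out to late vertices `b`. The `b`
have total volume at most `γ²`, so the fans of different vertices of the path overlap, and each
overlap forces a large average climb either between two vertices of the path (cut) or from a vertex
of the path to `b` (small by choice). Vertices of `Y` are marked as used and stop counting as early.
As the total volume is `γ²`, all these cuts together cost about `γ³`.

Vertex costs reduce to edge costs by splitting vertices, and a bound `C n^{1/3+δ}` for every `δ > 0`
gives `n^{1/3+o(1)}`. -/

theorem exists_threshold {ι : Type*} (s : Finset ι) (α l u : ι → ℝ)
    (h : 0 < ∑ i ∈ s, α i * max (u i - l i) 0) :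
    ∃ r, 0 < ∑ i ∈ s, α i * (if l i < r ∧ r ≤ u i then 1 else 0) := by
  -- The integral over `r` of the indicator of `(l i, u i]` is `max (u i - l i) 0`, so nonpositive
  -- sums at every threshold would integrate to a contradiction.
  by_contra! hr
  have hint : ∀ i, MeasureTheory.Integrable
      (fun r : ℝ => α i * (if l i < r ∧ r ≤ u i then (1 : ℝ) else 0)) := by
    intro i
    have : (fun r : ℝ => if l i < r ∧ r ≤ u i then (1 : ℝ) else 0)
        = (Set.Ioc (l i) (u i)).indicator (fun _ => 1) := by
      ext r; simp [Set.indicator_apply]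
    refine MeasureTheory.Integrable.const_mul ?_ _
    rw [this]
    exact (MeasureTheory.integrableOn_const (by simp)).integrable_indicator measurableSet_Ioc
  have hval : ∀ i, ∫ r : ℝ, α i * (if l i < r ∧ r ≤ u i then (1 : ℝ) else 0)
      = α i * max (u i - l i) 0 := by
    intro i
    have : (fun r : ℝ => if l i < r ∧ r ≤ u i then (1 : ℝ) else 0)
        = (Set.Ioc (l i) (u i)).indicator (fun _ => 1) := by
      ext r; simp [Set.indicator_apply]
    rw [MeasureTheory.integral_const_mul, this,
      MeasureTheory.integral_indicator measurableSet_Ioc]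
    simp [ENNReal.toReal_ofReal', MeasureTheory.Measure.real]
  have := MeasureTheory.integral_nonpos (μ := MeasureTheory.volume)
    (f := fun r => ∑ i ∈ s, α i * (if l i < r ∧ r ≤ u i then 1 else 0)) hr
  rw [MeasureTheory.integral_finsetSum _ (fun i _ => hint i)] at this
  simp only [hval] at this
  linarith

/-- Either one point beats all payoffs, or a finite mixture of payoffs beats all points. -/
theorem minimax_alternative {E S : Type*} [TopologicalSpace E] [AddCommGroup E] [Module ℝ E]
    [IsTopologicalAddGroup E] [ContinuousSMul ℝ E] {K : Set E} (hne : K.Nonempty)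
    (hK : IsCompact K) (hconv : Convex ℝ K) (φ : S → E → ℝ)
    (hφ : ∀ s, ConcaveOn ℝ K (φ s)) (hcont : ∀ s, Continuous (φ s)) (c : ℝ) :
    (∃ x ∈ K, ∀ s, c ≤ φ s x) ∨
    ∃ (T : Finset S) (σ : T → ℝ), (∀ s, 0 ≤ σ s) ∧ ∑ s, σ s = 1 ∧
      ∀ x ∈ K, ∑ s, σ s * φ s x < c := by
  classical
  by_cases h : ∃ x ∈ K, ∀ s, c ≤ φ s x
  · exact Or.inl h
  right
  push Not at h
  -- Compactness leaves finitely many payoffs that no single point of `K` satisfies together.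
  obtain ⟨T, hT⟩ := hK.elim_finite_subcover (fun s => {x | φ s x < c})
    (fun s => isOpen_lt (hcont s) continuous_const)
    (fun x hx => by
      obtain ⟨s, hs⟩ := h x hx
      exact Set.mem_iUnion.2 ⟨s, hs⟩)
  have hcc : ∀ y ∈ stdSimplex ℝ T, ConvexOn ℝ K fun x => -∑ s, y s * φ s x := by
    intro y hy
    have : (fun x => -∑ s, y s * φ s x) = -(∑ s, fun x => y s * φ s x) := by
      ext x; simp
    rw [this]
    refine ConcaveOn.neg ?_
    have hind : ∀ R : Finset T, ConcaveOn ℝ K (∑ s ∈ R, fun x => y s * φ s x) := by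
      intro R
      induction R using Finset.induction_on with
      | empty => exact concaveOn_const (0 : ℝ) hconv
      | insert a R ha ih =>
        rw [Finset.sum_insert ha]
        exact ((hφ a).smul (hy.1 a)).add ih
    exact hind _
  -- Sion's theorem for the negated payoffs: it is enough that every point is beaten by a vertex of
  -- the simplex, that is, by one pure payoff.
  have key := Sion.exists_lt_iInf_of_lt_iInf_of_finite (X := K) (Y := stdSimplex ℝ T)
    (f := fun x (σ : T → ℝ) => -∑ s, σ s * φ s x) hne hK
    (fun y _ => (Continuous.lowerSemicontinuous (by fun_prop)).lowerSemicontinuousOn _)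
    (fun y hy => (hcc y hy).quasiconvexOn) (convex_stdSimplex ℝ T)
    (fun x _ => (Continuous.upperSemicontinuous (by fun_prop)).upperSemicontinuousOn _)
    (fun x _ => ConcaveOn.quasiconcaveOn ?_)
    hconv (s := Set.range fun s : T => (Pi.single s 1 : T → ℝ))
    (Set.finite_range _) ?_ (t := -c) ?_
  · obtain ⟨σ, hσ, hlt⟩ := key
    exact ⟨T, σ, hσ.1, hσ.2, fun x hx => by simpa using hlt x hx⟩
  · refine ⟨convex_stdSimplex ℝ T, fun a _ b _ p q _ _ _ => le_of_eq ?_⟩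
    simp only [smul_eq_mul, Pi.add_apply, Pi.smul_apply, add_mul, Finset.sum_add_distrib,
      Finset.mul_sum, mul_neg, mul_assoc, neg_add]
  · rintro _ ⟨s, rfl⟩
    exact single_mem_stdSimplex ℝ s
  · intro x hx
    obtain ⟨s, hs, hlt⟩ := Set.mem_iUnion₂.1 (hT hx)
    refine ⟨_, ⟨⟨s, hs⟩, rfl⟩, ?_⟩
    simpa [Pi.single_apply] using hlt

theorem sum_ite_mem_mul_ite {ι : Type*} [Fintype ι] [DecidableEq ι] (A : Finset ι) (g : ι → ℝ)
    (p : ι → Prop) [DecidablePred p] :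
    ∑ e, (if e ∈ A then g e else 0) * (if p e then 1 else 0) = ∑ e ∈ A.filter p, g e := by
  rw [← Finset.sum_filter_add_sum_filter_not Finset.univ (· ∈ A.filter p)]
  simp only [Finset.filter_univ_mem]
  rw [add_eq_left.2]
  · refine Finset.sum_congr rfl fun e he => ?_
    obtain ⟨h1, h2⟩ := Finset.mem_filter.1 he
    simp [h1, h2]
  · refine Finset.sum_eq_zero fun e he => ?_
    have := (Finset.mem_filter.1 he).2
    rw [Finset.mem_filter, not_and_or] at this
    rcases this with h | h <;> simp [h]

/-- Weights `F` on levels whose average boundary is cheap: all pairs with a large average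
climb can be separated cheaply. -/
theorem exists_separating_edges {V J : Type*} [Fintype V] [DecidableEq V] [Fintype J]
    (c : V × V → ℝ) (hc : ∀ e, 0 ≤ c e) (lev : J → V → ℝ) (F : J → ℝ) (hF : ∀ j, 0 ≤ F j)
    {cb θ : ℝ} (hcb : 0 < cb) (hθ : 0 < θ) (E : Finset (V × V))
    (hE : ∑ e ∈ E, c e * ∑ j, F j * max (lev j e.2 - lev j e.1) 0 ≤ cb) :
    ∃ X ⊆ E, ∑ e ∈ X, c e ≤ 2 * cb / θ * (1 + 2 * Real.log (Fintype.card V)) ∧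
      ∀ a b, θ ≤ ∑ j, F j * max (lev j b - lev j a) 0 →
        ¬ Relation.ReflTransGen (fun a b => (a, b) ∈ E \ X) a b := by
  classical
  let Lf : V × V → ℝ := fun e => ∑ j, F j * max (lev j e.2 - lev j e.1) 0
  let R : Finset (V × V) → Finset (V × V) := fun E => Finset.univ.filter fun e =>
    θ ≤ Lf e ∧ Relation.ReflTransGen (fun a b => (a, b) ∈ E) e.1 e.2
  have main : ∀ k : ℕ, ∀ E : Finset (V × V), (R E).card = k →
      ∑ e ∈ E, c e * Lf e ≤ cb →
      ∃ X ⊆ E, ∑ e ∈ X, c e ≤ 2 * cb / θ * (harmonic k : ℝ) ∧ R (E \ X) = ∅ := by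
    intro k
    induction k using Nat.strong_induction_on with
    | _ k ih =>
    intro E hk hE
    rcases Nat.eq_zero_or_pos k with rfl | hkpos
    · exact ⟨∅, by simp, by simp, by simpa using hk⟩
    have hkr : (0 : ℝ) < k := by exact_mod_cast hkpos
    have hRsum : θ * k ≤ ∑ e ∈ R E, Lf e := by
      rw [← hk, mul_comm, ← nsmul_eq_mul]
      exact Finset.card_nsmul_le_sum _ _ _ fun e he => ((Finset.mem_filter.1 he).2).1
    -- The `k` pairs of `R E` have total averaged climb at least `θ * k`, while the edges pay at
    -- most `cb`. Averaging over levels and thresholds thus finds one cut whose price per straddled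
    -- pair is below `2 * cb / (θ * k)`; `α` compares the two sides.
    let α : V × V → ℝ := fun e =>
      cb * (if e ∈ R E then 1 else 0) - θ * k / 2 * (if e ∈ E then c e else 0)
    have hpos : 0 < ∑ j, F j * ∑ e, α e * max (lev j e.2 - lev j e.1) 0 := by
      have h1 : ∑ j, F j * ∑ e, α e * max (lev j e.2 - lev j e.1) 0 = ∑ e, α e * Lf e := by
        simp only [Lf, Finset.mul_sum]
        rw [Finset.sum_comm]
        exact Finset.sum_congr rfl fun e _ => Finset.sum_congr rfl fun j _ => by ring
      have h2 : ∑ e, α e * Lf e = cb * ∑ e ∈ R E, Lf e - θ * k / 2 * ∑ e ∈ E, c e * Lf e := by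
        simp only [α, sub_mul, Finset.sum_sub_distrib, mul_assoc, ← Finset.mul_sum, ite_mul,
          one_mul, zero_mul, Finset.sum_ite_mem, Finset.univ_inter]
      rw [h1, h2]
      have := mul_le_mul_of_nonneg_left hRsum hcb.le
      have h3 := mul_le_mul_of_nonneg_left hE (by positivity : 0 ≤ θ * k / 2)
      have h4 : 0 < θ * k * cb := by positivity
      nlinarith
    obtain ⟨j, -, hj⟩ := Finset.exists_lt_of_sum_lt (by simpa using hpos :
      ∑ j : J, (0 : ℝ) < ∑ j, F j * ∑ e, α e * max (lev j e.2 - lev j e.1) 0)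
    have hj' := pos_of_mul_pos_right hj (hF j)
    obtain ⟨r, hr⟩ := exists_threshold Finset.univ α (fun e => lev j e.1) (fun e => lev j e.2) hj'
    set X0 := E.filter fun e => lev j e.1 < r ∧ r ≤ lev j e.2 with hX0
    set R0 := (R E).filter fun e => lev j e.1 < r ∧ r ≤ lev j e.2 with hR0
    have hr2 : θ * k / 2 * ∑ e ∈ X0, c e < cb * R0.card := by
      have : ∑ e, α e * (if lev j e.1 < r ∧ r ≤ lev j e.2 then 1 else 0)
          = cb * R0.card - θ * k / 2 * ∑ e ∈ X0, c e := by
        have hcd : (R0.card : ℝ) = ∑ e ∈ R0, 1 := by simp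
        rw [hcd, hR0, hX0, ← sum_ite_mem_mul_ite, ← sum_ite_mem_mul_ite]
        simp only [α, sub_mul, Finset.sum_sub_distrib, mul_assoc, ← Finset.mul_sum]
      rw [this] at hr
      linarith
    -- Once `X0` is deleted no edge leads from below the threshold `r` to above it, so the straddled
    -- pairs are disconnected.
    have hkill : R (E \ X0) ⊆ R E \ R0 := by
      intro e he
      obtain ⟨-, he1, he2⟩ := Finset.mem_filter.1 he
      refine Finset.mem_sdiff.2 ⟨Finset.mem_filter.2 ⟨Finset.mem_univ _, he1,
        he2.lift id fun a b hab => (Finset.mem_sdiff.1 hab).1⟩, fun heR => ?_⟩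
      obtain ⟨-, hlt, hle⟩ := Finset.mem_filter.1 heR
      have : ∀ b, Relation.ReflTransGen (fun a b => (a, b) ∈ E \ X0) e.1 b → lev j b < r := by
        intro b hb
        induction hb with
        | refl => exact hlt
        | tail _ hbc ih2 =>
          by_contra hcon
          obtain ⟨hbE, hbX⟩ := Finset.mem_sdiff.1 hbc
          exact hbX (Finset.mem_filter.2 ⟨hbE, ih2, not_lt.1 hcon⟩)
      exact absurd (this _ he2) (not_lt.2 hle)
    have hR0pos : 0 < R0.card := by
      rcases Nat.eq_zero_or_pos R0.card with h0 | h0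
      · rw [h0] at hr2
        have : 0 ≤ θ * k / 2 * ∑ e ∈ X0, c e :=
          mul_nonneg (by positivity) (Finset.sum_nonneg fun e _ => hc e)
        simp at hr2
        linarith
      · exact h0
    have hR0k : R0.card ≤ k := hk ▸ Finset.card_filter_le _ _
    have hcard : (R (E \ X0)).card ≤ k - R0.card := by
      refine (Finset.card_le_card hkill).trans ?_
      rw [Finset.card_sdiff_of_subset (Finset.filter_subset _ _), hk]
    obtain ⟨X1, hX1, hcost1, hfin⟩ := ih (R (E \ X0)).card (by omega) (E \ X0) rfl
      ((Finset.sum_le_sum_of_subset_of_nonneg Finset.sdiff_subset fun e _ _ =>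
        mul_nonneg (hc e) (Finset.sum_nonneg fun j _ => mul_nonneg (hF j) (le_max_right _ _))).trans
        hE)
    refine ⟨X0 ∪ X1, Finset.union_subset (Finset.filter_subset _ _)
      (hX1.trans Finset.sdiff_subset), ?_, ?_⟩
    -- Destroying `d` of `k` pairs at price `1 / k` each is paid for by the last `d` terms of the
    -- harmonic sum.
    · have hh : ∀ d : ℕ, d ≤ k → (harmonic (k - d) : ℝ) + d / k ≤ harmonic k := by
        intro d
        induction d with
        | zero => simp
        | succ d ihd =>
          intro hd
          have h1 := ihd (by omega)
          have h2 : k - d = (k - (d + 1)) + 1 := by omega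
          rw [h2, harmonic_succ] at h1
          push_cast at h1 ⊢
          have h3 : (1 : ℝ) / k ≤ (((k - (d + 1) : ℕ) : ℝ) + 1)⁻¹ := by
            rw [one_div]
            apply inv_anti₀ (by positivity)
            have : k - (d + 1) + 1 ≤ k := by omega
            exact_mod_cast this
          rw [add_div]
          linarith
      have hmono : ∀ a b : ℕ, a ≤ b → (harmonic a : ℝ) ≤ harmonic b := by
        intro a b hab
        induction hab with
        | refl => exact le_rfl
        | step _ ih3 =>
          refine ih3.trans ?_
          rw [harmonic_succ]; push_cast
          exact le_add_of_nonneg_right (by positivity)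
      have hX0cost : ∑ e ∈ X0, c e ≤ 2 * cb / θ * (R0.card / k) := by
        have : 2 * cb / θ * (R0.card / k) = (cb * R0.card) / (θ * k / 2) := by
          field_simp
        rw [this, le_div_iff₀ (by positivity)]
        linarith
      have hun : ∑ e ∈ X0 ∪ X1, c e ≤ ∑ e ∈ X0, c e + ∑ e ∈ X1, c e := by
        rw [← Finset.sum_union_inter]
        exact le_add_of_nonneg_right (Finset.sum_nonneg fun e _ => hc e)
      have hfac : 0 < 2 * cb / θ := by positivity
      have h5 := mul_le_mul_of_nonneg_left ((add_le_add (hmono _ _ hcard) le_rfl).trans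
        (hh R0.card hR0k)) hfac.le
      rw [mul_add] at h5
      linarith
    · rw [← hfin, sdiff_sdiff_left]
      rfl
  obtain ⟨X, hXE, hcost, hR⟩ := main _ E rfl hE
  refine ⟨X, hXE, hcost.trans ?_, fun a b hab hreach => ?_⟩
  · refine mul_le_mul_of_nonneg_left ?_ (by positivity)
    rcases Nat.eq_zero_or_pos (R E).card with h0 | h0
    · rw [h0]; simp; positivity
    refine (harmonic_le_one_add_log _).trans ?_
    have hle : (R E).card ≤ Fintype.card V ^ 2 := by
      refine (Finset.card_le_univ _).trans ?_
      rw [Fintype.card_prod, sq]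
    have : Real.log (R E).card ≤ 2 * Real.log (Fintype.card V) := by
      have h2 : 2 * Real.log (Fintype.card V) = Real.log ((Fintype.card V : ℝ) ^ 2) := by
        rw [Real.log_pow]; norm_num
      rw [h2]
      exact Real.log_le_log (by exact_mod_cast h0) (by exact_mod_cast hle)
    linarith
  · have : (a, b) ∈ R (E \ X) := Finset.mem_filter.2 ⟨Finset.mem_univ _, hab, hreach⟩
    rw [hR] at this
    simp at this

end DirectedCut

/-! ### Region growing and the low diameter decomposition -/

namespace DirectedCut

/-- Region growing: some level set strictly between `lo` and `hi` has a boundary that is small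
compared to its volume. -/
theorem exists_cheap_level {V : Type*} [Fintype V] [DecidableEq V] (c w : V × V → ℝ)
    (hc : ∀ e, 0 ≤ c e) (hw : ∀ e, 0 ≤ w e) (μ : V → ℝ) {v₀ : ℝ} (hv₀ : 0 < v₀)
    (hμ : ∀ v, v₀ ≤ μ v) (hμc : ∀ a, ∑ b, c (a, b) * w (a, b) ≤ μ a) (S : Finset V) (l : V → ℝ)
    (hlip : ∀ a ∈ S, ∀ b ∈ S, c (a, b) = 0 ∨ l b - l a ≤ w (a, b)) {y : V} (hy : y ∈ S)
    {lo hi : ℝ} (hlo : l y < lo) (hhi : lo < hi) {K : ℕ} (hK : ∑ v ∈ S, μ v < 2 ^ K * v₀) :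
    ∃ r, lo < r ∧ r ≤ hi ∧
      ∑ e ∈ (S.filter fun v => l v < r) ×ˢ (S.filter fun v => ¬ l v < r), c e ≤
        3 * K / (hi - lo) * ∑ v ∈ S.filter (fun v => l v < r), μ v := by
  have hμ0 : ∀ v, 0 ≤ μ v := fun v => hv₀.le.trans (hμ v)
  have hKpos : 0 < K := by
    rcases Nat.eq_zero_or_pos K with rfl | h
    · have := (hμ y).trans (Finset.single_le_sum (fun v _ => hμ0 v) hy)
      simp at hK; linarith
    · exact h
  have hKr : (0 : ℝ) < K := by exact_mod_cast hKpos
  set d := (hi - lo) / K with hd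
  have hdpos : 0 < d := div_pos (by linarith) hKr
  let t : ℕ → ℝ := fun k => lo + k * d
  let M : ℕ → ℝ := fun k => ∑ v ∈ S.filter (fun v => l v < t k), μ v
  have hM0 : v₀ ≤ M 0 := (hμ y).trans (Finset.single_le_sum (fun v _ => hμ0 v)
    (Finset.mem_filter.2 ⟨hy, by simpa [t] using hlo⟩))
  have hMle : ∀ k, M k ≤ ∑ v ∈ S, μ v := fun k =>
    Finset.sum_le_sum_of_subset_of_nonneg (Finset.filter_subset _ _) fun v _ _ => hμ0 v
  have hMmono : Monotone M := by
    refine monotone_nat_of_le_succ fun k => Finset.sum_le_sum_of_subset_of_nonneg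
      (fun v hv => ?_) fun v _ _ => hμ0 v
    obtain ⟨h1, h2⟩ := Finset.mem_filter.1 hv
    refine Finset.mem_filter.2 ⟨h1, h2.trans_le ?_⟩
    simp only [t]; push_cast; nlinarith
  -- The volume starts at `v₀` or more and stays below `2 ^ K * v₀`, so it cannot more than double
  -- in each of the `K` bands of width `d`.
  obtain ⟨k, hk, hMk⟩ : ∃ k < K, M (k + 1) ≤ 2 * M k := by
    by_contra! hcon
    have : ∀ k ≤ K, 2 ^ k * v₀ ≤ M k := by
      intro k
      induction k with
      | zero => intro _; simpa using hM0
      | succ k ih =>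
        intro hk
        have h1 := ih (by omega)
        have h2 := hcon k (by omega)
        rw [pow_succ]; linarith
    linarith [this K le_rfl, hMle K]
  have hMkpos : 0 < M k := hv₀.trans_le (hM0.trans (hMmono (Nat.zero_le k)))
  have ht : t (k + 1) = t k + d := by simp only [t]; push_cast; ring
  let cl : ℝ → ℝ := fun x => max (t k) (min (t (k + 1)) x)
  -- The extra index `none` spans the whole band and contributes `3 * M k`. The edges, with levels
  -- clamped to the band by `cl`, contribute at most `M (k + 1) ≤ 2 * M k` in absolute value. The
  -- positive difference gives a threshold, necessarily inside the band, whose cut costs at most `3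
  -- * M k / d`.
  let α : Option (V × V) → ℝ := fun o => o.elim (3 * M k / d) fun e =>
    -(if e ∈ S ×ˢ S then c e else 0)
  let lw : Option (V × V) → ℝ := fun o => o.elim (t k) fun e => cl (l e.1)
  let up : Option (V × V) → ℝ := fun o => o.elim (t (k + 1)) fun e => cl (l e.2)
  have hflow : ∑ e : V × V, (if e ∈ S ×ˢ S then c e else 0) * max (cl (l e.2) - cl (l e.1)) 0
      ≤ M (k + 1) := by
    calc ∑ e : V × V, (if e ∈ S ×ˢ S then c e else 0) * max (cl (l e.2) - cl (l e.1)) 0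
        ≤ ∑ e : V × V, (if e.1 ∈ S.filter (fun v => l v < t (k + 1)) then c e * w e else 0) := by
          refine Finset.sum_le_sum fun e _ => ?_
          by_cases he : e ∈ S ×ˢ S
          · obtain ⟨h1, h2⟩ := Finset.mem_product.1 he
            rw [if_pos he]
            by_cases h3 : l e.1 < t (k + 1)
            · rw [if_pos (Finset.mem_filter.2 ⟨h1, h3⟩)]
              rcases hlip _ h1 _ h2 with h4 | h4
              · have h4' : c e = 0 := h4
                simp [h4']
              · refine mul_le_mul_of_nonneg_left (max_le ?_ (hw e)) (hc e)
                have h4' : l e.2 - l e.1 ≤ w e := h4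
                have h5 := hw e
                simp only [cl]
                rcases max_cases (t k) (min (t (k + 1)) (l e.2)) with ⟨h, h'⟩ | ⟨h, h'⟩ <;>
                rcases max_cases (t k) (min (t (k + 1)) (l e.1)) with ⟨g, g'⟩ | ⟨g, g'⟩ <;>
                rcases min_cases (t (k + 1)) (l e.2) with ⟨i, i'⟩ | ⟨i, i'⟩ <;>
                rcases min_cases (t (k + 1)) (l e.1) with ⟨j, j'⟩ | ⟨j, j'⟩ <;> linarith
            · rw [if_neg (show e.1 ∉ S.filter (fun v => l v < t (k + 1)) from
                fun h => h3 (Finset.mem_filter.1 h).2)]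
              have : cl (l e.2) - cl (l e.1) ≤ 0 := by
                simp only [cl]
                rw [min_eq_left (not_lt.1 h3)]
                have : max (t k) (min (t (k + 1)) (l e.2)) ≤ max (t k) (t (k + 1)) :=
                  max_le_max le_rfl (min_le_left _ _)
                linarith
              rw [max_eq_right this, mul_zero]
          · rw [if_neg he, zero_mul]
            split_ifs
            · exact mul_nonneg (hc e) (hw e)
            · exact le_rfl
      _ = ∑ a, (if a ∈ S.filter (fun v => l v < t (k + 1)) then ∑ b, c (a, b) * w (a, b) else 0) := by
          rw [Fintype.sum_prod_type]
          refine Finset.sum_congr rfl fun a _ => ?_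
          split_ifs <;> simp
      _ ≤ ∑ a, (if a ∈ S.filter (fun v => l v < t (k + 1)) then μ a else 0) := by
          refine Finset.sum_le_sum fun a _ => ?_
          split_ifs
          · exact hμc a
          · exact le_rfl
      _ = M (k + 1) := by rw [Finset.sum_ite_mem, Finset.univ_inter]
  have hpos : 0 < ∑ o, α o * max (up o - lw o) 0 := by
    rw [Fintype.sum_option]
    simp only [α, lw, up, Option.elim]
    rw [ht, add_sub_cancel_left, max_eq_left hdpos.le, div_mul_cancel₀ _ hdpos.ne']
    simp only [neg_mul, Finset.sum_neg_distrib]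
    linarith
  obtain ⟨r, hr⟩ := exists_threshold Finset.univ α lw up hpos
  rw [Fintype.sum_option] at hr
  replace hr : 0 < 3 * M k / d * (if t k < r ∧ r ≤ t (k + 1) then 1 else 0) +
      ∑ e : V × V, -(if e ∈ S ×ˢ S then c e else 0) *
        (if cl (l e.1) < r ∧ r ≤ cl (l e.2) then 1 else 0) := hr
  have hcl1 : ∀ x, t k ≤ cl x := fun x => le_max_left _ _
  have hcl2 : ∀ x, cl x ≤ t (k + 1) := fun x =>
    max_le (by rw [ht]; linarith) (min_le_left _ _)
  have hrange : t k < r ∧ r ≤ t (k + 1) := by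
    by_contra hcon
    rw [if_neg hcon, mul_zero, zero_add] at hr
    refine absurd hr (not_lt.2 (le_of_eq (Finset.sum_eq_zero fun e _ => ?_)))
    rw [if_neg (show ¬(cl (l e.1) < r ∧ r ≤ cl (l e.2)) from
      fun h => hcon ⟨(hcl1 _).trans_lt h.1, h.2.trans (hcl2 _)⟩), mul_zero]
  rw [if_pos hrange, mul_one] at hr
  have hlow : ∀ x, cl x < r ↔ x < r := by
    intro x
    simp only [cl, max_lt_iff, min_lt_iff, hrange.1, true_and]
    exact ⟨fun h => h.resolve_left (not_lt.2 hrange.2), Or.inr⟩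
  have hcut : ∑ e ∈ (S.filter fun v => l v < r) ×ˢ (S.filter fun v => ¬ l v < r), c e ≤
      3 * M k / d := by
    have : ∑ e ∈ (S.filter fun v => l v < r) ×ˢ (S.filter fun v => ¬ l v < r), c e
        = ∑ e : V × V, (if e ∈ S ×ˢ S then c e else 0) *
          (if cl (l e.1) < r ∧ r ≤ cl (l e.2) then 1 else 0) := by
      rw [sum_ite_mem_mul_ite]
      refine Finset.sum_congr ?_ fun _ _ => rfl
      ext e
      simp only [Finset.mem_product, Finset.mem_filter, hlow, ← not_lt]
      tauto
    rw [this]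
    simp only [neg_mul, Finset.sum_neg_distrib] at hr
    linarith
  refine ⟨r, ?_, ?_, hcut.trans ?_⟩
  · refine lt_of_le_of_lt ?_ hrange.1
    simp only [t]; have : 0 ≤ k * d := by positivity
    linarith
  · refine hrange.2.trans ?_
    have : ((k + 1 : ℕ) : ℝ) ≤ K := by exact_mod_cast hk
    have h2 : K * d = hi - lo := by rw [hd]; field_simp
    simp only [t]; nlinarith
  · have h1 : 3 * M k / d = 3 * K / (hi - lo) * M k := by
      have : hi - lo ≠ 0 := by linarith
      rw [hd]; field_simp
    rw [h1]
    refine mul_le_mul_of_nonneg_left (Finset.sum_le_sum_of_subset_of_nonneg (fun v hv => ?_)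
      fun v _ _ => hμ0 v) (div_nonneg (by positivity) (by linarith))
    obtain ⟨h1, h2⟩ := Finset.mem_filter.1 hv
    exact Finset.mem_filter.2 ⟨h1, h2.trans hrange.1⟩

/-- The logarithm of the smaller part `p` drops by at least `log 2`, and this drop pays the charge
`D * p`. It is the recursion inequality for a divide and conquer whose cuts are charged to the
smaller side. -/
theorem mul_log_split {p q v D : ℝ} (hv : 0 < v) (hp : v ≤ p) (hq : v ≤ q) (hD : 0 ≤ D)
    (hpq : p ≤ (p + q) / 2) :
    D * p + D / Real.log 2 * (p * Real.log (p / v)) + D / Real.log 2 * (q * Real.log (q / v)) ≤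
      D / Real.log 2 * ((p + q) * Real.log ((p + q) / v)) := by
  have hl2 : 0 < Real.log 2 := Real.log_pos (by norm_num)
  have hp0 : 0 < p := hv.trans_le hp
  have hq0 : 0 < q := hv.trans_le hq
  have h1 : Real.log (p / v) ≤ Real.log ((p + q) / v) - Real.log 2 := by
    rw [← Real.log_div (by positivity) (by norm_num)]
    refine Real.log_le_log (by positivity) ?_
    rw [div_div, mul_comm v, ← div_div]
    gcongr
  have h2 : Real.log (q / v) ≤ Real.log ((p + q) / v) :=
    Real.log_le_log (by positivity) (by gcongr; linarith)
  have h3 : D * p = D / Real.log 2 * (p * Real.log 2) := by field_simp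
  rw [h3, ← mul_add, ← mul_add]
  refine mul_le_mul_of_nonneg_left ?_ (by positivity)
  nlinarith

/-- A low diameter decomposition: after a cheap deletion every `w`-Lipschitz function
varies by at most `σ₀` on each strongly connected component. -/
theorem exists_lowDiameter_cut {V : Type*} [Fintype V] [DecidableEq V] (c w : V × V → ℝ)
    (hc : ∀ e, 0 ≤ c e) (hw : ∀ e, 0 ≤ w e) (μ : V → ℝ) {v₀ : ℝ} (hv₀ : 0 < v₀)
    (hμ : ∀ v, v₀ ≤ μ v) (hout : ∀ a, ∑ b, c (a, b) * w (a, b) ≤ μ a)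
    (hin : ∀ b, ∑ a, c (a, b) * w (a, b) ≤ μ b) (E : Finset (V × V)) {σ₀ : ℝ} (hσ : 0 < σ₀)
    {K : ℕ} (hK : ∑ v, μ v < 2 ^ K * v₀) :
    ∃ X ⊆ E, ∑ e ∈ X, c e ≤
        12 * K / σ₀ / Real.log 2 * ((∑ v, μ v) * Real.log ((∑ v, μ v) / v₀)) ∧
      ∀ l : V → ℝ, (∀ e ∈ E \ X, l e.2 - l e.1 ≤ w e) → ∀ y y',
        Relation.ReflTransGen (fun a b => (a, b) ∈ E \ X) y y' →
        Relation.ReflTransGen (fun a b => (a, b) ∈ E \ X) y' y → l y' - l y ≤ σ₀ := by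
  have hμ0 : ∀ v, 0 ≤ μ v := fun v => hv₀.le.trans (hμ v)
  have hvol : ∀ S : Finset V, S.Nonempty → v₀ ≤ ∑ v ∈ S, μ v := fun S ⟨y, hy⟩ =>
    (hμ y).trans (Finset.single_le_sum (fun v _ => hμ0 v) hy)
  have hl2 : 0 < Real.log 2 := Real.log_pos (by norm_num)
  have hD : 0 ≤ 12 * (K : ℝ) / σ₀ := by positivity
  have main : ∀ k : ℕ, ∀ S : Finset V, S.card = k → ∃ X ⊆ E.filter (fun e => e.1 ∈ S ∧ e.2 ∈ S),
      ∑ e ∈ X, c e ≤ 12 * K / σ₀ / Real.log 2 * ((∑ v ∈ S, μ v) * Real.log ((∑ v ∈ S, μ v) / v₀)) ∧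
      ∀ l : V → ℝ, (∀ e ∈ E.filter (fun e => e.1 ∈ S ∧ e.2 ∈ S) \ X, l e.2 - l e.1 ≤ w e) →
        ∀ y ∈ S, ∀ y' ∈ S,
        Relation.ReflTransGen (fun a b => (a, b) ∈ E.filter (fun e => e.1 ∈ S ∧ e.2 ∈ S) \ X) y y' →
        Relation.ReflTransGen (fun a b => (a, b) ∈ E.filter (fun e => e.1 ∈ S ∧ e.2 ∈ S) \ X) y' y →
        l y' - l y ≤ σ₀ := by
    intro k
    induction k using Nat.strong_induction_on with
    | _ k ih =>
    intro S hSk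
    by_cases hgood : ∀ l : V → ℝ,
        (∀ e ∈ E.filter (fun e => e.1 ∈ S ∧ e.2 ∈ S), l e.2 - l e.1 ≤ w e) →
        ∀ y ∈ S, ∀ y' ∈ S, l y' - l y ≤ σ₀
    · refine ⟨∅, by simp, ?_, fun l hl y hy y' hy' _ _ => hgood l (by simpa using hl) y hy y' hy'⟩
      rw [Finset.sum_empty]
      refine mul_nonneg (by positivity) ?_
      rcases S.eq_empty_or_nonempty with rfl | hS
      · simp
      · exact mul_nonneg (hv₀.le.trans (hvol S hS))
          (Real.log_nonneg ((one_le_div hv₀).2 (hvol S hS)))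
    push Not at hgood
    obtain ⟨l, hl, y, hy, y', hy', hgap⟩ := hgood
    have hKS : ∑ v ∈ S, μ v < 2 ^ K * v₀ := lt_of_le_of_lt
      (Finset.sum_le_univ_sum_of_nonneg hμ0) hK
    -- a balanced sparse cut `A → B`
    obtain ⟨A, B, hA, hB, hAB, hdisj, hcost⟩ : ∃ A B : Finset V, A.Nonempty ∧ B.Nonempty ∧
        A ∪ B = S ∧ Disjoint A B ∧ ((∑ v ∈ A, μ v ≤ (∑ v ∈ S, μ v) / 2 ∧
          ∑ e ∈ E.filter (fun e => e.1 ∈ A ∧ e.2 ∈ B), c e ≤ 12 * K / σ₀ * ∑ v ∈ A, μ v) ∨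
          (∑ v ∈ B, μ v ≤ (∑ v ∈ S, μ v) / 2 ∧
          ∑ e ∈ E.filter (fun e => e.1 ∈ A ∧ e.2 ∈ B), c e ≤ 12 * K / σ₀ * ∑ v ∈ B, μ v)) := by
      let c' : V × V → ℝ := fun e => if e ∈ E then c e else 0
      have hc' : ∀ e, 0 ≤ c' e := fun e => by
        simp only [c']; split_ifs
        exacts [hc e, le_rfl]
      have hc'c : ∀ e, c' e ≤ c e := fun e => by
        simp only [c']; split_ifs
        exacts [le_rfl, hc e]
      have hlip : ∀ a ∈ S, ∀ b ∈ S, c' (a, b) = 0 ∨ l b - l a ≤ w (a, b) := by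
        intro a ha b hb
        by_cases hE : (a, b) ∈ E
        · exact Or.inr (hl (a, b) (Finset.mem_filter.2 ⟨hE, ha, hb⟩))
        · exact Or.inl (by simp [c', hE])
      have hsum : ∀ A B : Finset V, ∑ e ∈ E.filter (fun e => e.1 ∈ A ∧ e.2 ∈ B), c e
          = ∑ e ∈ A ×ˢ B, c' e := by
        intro A B
        simp only [c']
        rw [← Finset.sum_filter]
        refine Finset.sum_congr ?_ fun _ _ => rfl
        ext e
        simp only [Finset.mem_filter, Finset.mem_product]
        tauto
      -- Grow from `y` if the vertices below the middle height `l y + σ₀ / 2` have at most half the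
      -- volume, otherwise grow backwards from `y'`. In both cases the band has width `σ₀ / 4`,
      -- whence `3 * K / (σ₀ / 4) = 12 * K / σ₀`, and it stays on the small side of the middle.
      by_cases hhalf : ∑ v ∈ S.filter (fun v => l v < l y + σ₀ / 2), μ v ≤ (∑ v ∈ S, μ v) / 2
      · obtain ⟨r, hr1, hr2, hr3⟩ := exists_cheap_level c' w hc' hw μ hv₀ hμ
          (fun a => (Finset.sum_le_sum fun b _ => mul_le_mul_of_nonneg_right (hc'c _) (hw _)).trans
            (hout a)) S l hlip hy (lo := l y + σ₀ / 4) (hi := l y + σ₀ / 2) (by linarith)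
          (by linarith) hKS
        refine ⟨S.filter (fun v => l v < r), S.filter (fun v => ¬ l v < r),
          ⟨y, Finset.mem_filter.2 ⟨hy, by linarith⟩⟩, ⟨y', Finset.mem_filter.2 ⟨hy', by linarith⟩⟩,
          Finset.filter_union_filter_not_eq _ _, Finset.disjoint_filter_filter_not _ _ _,
          Or.inl ⟨le_trans (Finset.sum_le_sum_of_subset_of_nonneg (fun v hv => ?_)
            fun v _ _ => hμ0 v) hhalf, ?_⟩⟩
        · obtain ⟨h1, h2⟩ := Finset.mem_filter.1 hv
          exact Finset.mem_filter.2 ⟨h1, by linarith⟩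
        · rw [hsum]
          refine hr3.trans (le_of_eq ?_)
          congr 1
          rw [show l y + σ₀ / 2 - (l y + σ₀ / 4) = σ₀ / 4 by ring]
          field_simp; ring
      · obtain ⟨r, hr1, hr2, hr3⟩ := exists_cheap_level (fun e => c' e.swap) (fun e => w e.swap)
          (fun e => hc' _) (fun e => hw _) μ hv₀ hμ
          (fun a => (Finset.sum_le_sum fun b _ => mul_le_mul_of_nonneg_right (hc'c _) (hw _)).trans
            (hin a)) S (fun v => - l v) (fun a ha b hb => by
              rcases hlip b hb a ha with h | h
              · exact Or.inl h
              · refine Or.inr ?_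
                simp only [Prod.swap_prod_mk]; linarith) hy' (lo := - l y - 3 * σ₀ / 4)
          (hi := - l y - σ₀ / 2) (by linarith) (by linarith) hKS
        refine ⟨S.filter (fun v => ¬ - l v < r), S.filter (fun v => - l v < r),
          ⟨y, Finset.mem_filter.2 ⟨hy, by linarith⟩⟩, ⟨y', Finset.mem_filter.2 ⟨hy', by linarith⟩⟩,
          by rw [Finset.union_comm, Finset.filter_union_filter_not_eq],
          (Finset.disjoint_filter_filter_not _ _ _).symm, Or.inr ⟨?_, ?_⟩⟩
        · have h1 : ∑ v ∈ S.filter (fun v => - l v < r), μ v ≤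
              ∑ v ∈ S.filter (fun v => ¬ l v < l y + σ₀ / 2), μ v := by
            refine Finset.sum_le_sum_of_subset_of_nonneg (fun v hv => ?_) fun v _ _ => hμ0 v
            obtain ⟨h1, h2⟩ := Finset.mem_filter.1 hv
            exact Finset.mem_filter.2 ⟨h1, by linarith⟩
          have h2 := Finset.sum_filter_add_sum_filter_not S (fun v => l v < l y + σ₀ / 2) μ
          linarith
        · rw [hsum]
          have hsw : ∀ A B : Finset V, ∑ e ∈ A ×ˢ B, c' e = ∑ e ∈ B ×ˢ A, c' e.swap := by
            intro A B
            rw [Finset.sum_product, Finset.sum_product_right]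
            rfl
          rw [hsw]
          refine hr3.trans (le_of_eq ?_)
          congr 1
          rw [show - l y - σ₀ / 2 - (- l y - 3 * σ₀ / 4) = σ₀ / 4 by ring]
          field_simp; ring
    have hsumAB : ∑ v ∈ S, μ v = ∑ v ∈ A, μ v + ∑ v ∈ B, μ v := by
      rw [← hAB, Finset.sum_union hdisj]
    have hcardAB : A.card + B.card = k := by rw [← hSk, ← hAB, Finset.card_union_of_disjoint hdisj]
    have hA1 := hA.card_pos
    have hB1 := hB.card_pos
    obtain ⟨XA, hXA, hcA, hgA⟩ := ih A.card (by omega) A rfl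
    obtain ⟨XB, hXB, hcB, hgB⟩ := ih B.card (by omega) B rfl
    set δ := E.filter (fun e => e.1 ∈ A ∧ e.2 ∈ B) with hδ
    have hmemS : ∀ v, v ∈ S ↔ v ∈ A ∨ v ∈ B := fun v => by rw [← hAB, Finset.mem_union]
    have hnot : ∀ v, v ∈ A → v ∉ B := fun v h1 h2 => Finset.disjoint_left.1 hdisj h1 h2
    refine ⟨δ ∪ (XA ∪ XB), ?_, ?_, ?_⟩
    · intro e he
      rw [Finset.mem_filter, hmemS, hmemS]
      rcases Finset.mem_union.1 he with he | he
      · have := Finset.mem_filter.1 he; tauto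
      rcases Finset.mem_union.1 he with he | he
      · have := Finset.mem_filter.1 (hXA he); tauto
      · have := Finset.mem_filter.1 (hXB he); tauto
    · have hun : ∀ P Q : Finset (V × V), ∑ e ∈ P ∪ Q, c e ≤ ∑ e ∈ P, c e + ∑ e ∈ Q, c e := by
        intro P Q
        rw [← Finset.sum_union_inter]
        exact le_add_of_nonneg_right (Finset.sum_nonneg fun e _ => hc e)
      refine (hun _ _).trans ((add_le_add le_rfl (hun _ _)).trans ?_)
      rcases hcost with ⟨hh, hcst⟩ | ⟨hh, hcst⟩
      · have := mul_log_split hv₀ (hvol A hA) (hvol B hB) hD (by rw [← hsumAB]; exact hh)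
        rw [hsumAB]
        linarith
      · have := mul_log_split hv₀ (hvol B hB) (hvol A hA) hD
          (by rw [add_comm (∑ v ∈ B, μ v), ← hsumAB]; exact hh)
        rw [hsumAB]
        rw [add_comm (∑ v ∈ B, μ v)] at this
        linarith
    · intro f hf z hz z' hz' hzz hzz'
      set rel := fun a b => (a, b) ∈ E.filter (fun e => e.1 ∈ S ∧ e.2 ∈ S) \ (δ ∪ (XA ∪ XB)) with hrel
      -- With the edges from `A` to `B` gone, nothing leaves `A`. A path that starts in `A` or ends
      -- in `B` stays on its side, so mutually reachable vertices are handled within one part.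
      have hstay : ∀ a b, Relation.ReflTransGen rel a b → a ∈ A → b ∈ A ∧
          Relation.ReflTransGen
            (fun a b => (a, b) ∈ E.filter (fun e => e.1 ∈ A ∧ e.2 ∈ A) \ XA) a b := by
        intro a b hab ha
        induction hab with
        | refl => exact ⟨ha, Relation.ReflTransGen.refl⟩
        | @tail b d _ hbd ih2 =>
          obtain ⟨hbA, hr⟩ := ih2
          obtain ⟨h1, h2⟩ := Finset.mem_sdiff.1 hbd
          obtain ⟨hE, -, hdS⟩ := Finset.mem_filter.1 h1
          have hdA : d ∈ A := by
            rcases (hmemS d).1 hdS with h | h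
            · exact h
            · exact absurd (Finset.mem_union_left _ (Finset.mem_filter.2 ⟨hE, hbA, h⟩)) h2
          refine ⟨hdA, hr.tail (Finset.mem_sdiff.2 ⟨Finset.mem_filter.2 ⟨hE, hbA, hdA⟩,
            fun h => h2 (Finset.mem_union_right _ (Finset.mem_union_left _ h))⟩)⟩
      have hstayB : ∀ a b, Relation.ReflTransGen rel a b → b ∈ B → a ∈ S → a ∈ B ∧
          Relation.ReflTransGen
            (fun a b => (a, b) ∈ E.filter (fun e => e.1 ∈ B ∧ e.2 ∈ B) \ XB) a b := by
        intro a b hab hb ha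
        induction hab using Relation.ReflTransGen.head_induction_on with
        | refl => exact ⟨hb, Relation.ReflTransGen.refl⟩
        | @head a d had _ ih2 =>
          obtain ⟨h1, h2⟩ := Finset.mem_sdiff.1 had
          obtain ⟨hE, haS, hdS⟩ := Finset.mem_filter.1 h1
          obtain ⟨hdB, hr⟩ := ih2 hdS
          have haB : a ∈ B := by
            rcases (hmemS a).1 haS with h | h
            · exact absurd (Finset.mem_union_left _ (Finset.mem_filter.2 ⟨hE, h, hdB⟩)) h2
            · exact h
          refine ⟨haB, hr.head (Finset.mem_sdiff.2 ⟨Finset.mem_filter.2 ⟨hE, haB, hdB⟩,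
            fun h => h2 (Finset.mem_union_right _ (Finset.mem_union_right _ h))⟩)⟩
      have hfA : ∀ e ∈ E.filter (fun e => e.1 ∈ A ∧ e.2 ∈ A) \ XA, f e.2 - f e.1 ≤ w e := by
        intro e he
        obtain ⟨h1, h2⟩ := Finset.mem_sdiff.1 he
        obtain ⟨hE, hA1, hA2⟩ := Finset.mem_filter.1 h1
        refine hf e (Finset.mem_sdiff.2 ⟨Finset.mem_filter.2
          ⟨hE, (hmemS _).2 (Or.inl hA1), (hmemS _).2 (Or.inl hA2)⟩, fun h => ?_⟩)
        rcases Finset.mem_union.1 h with h | h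
        · exact hnot _ hA2 (Finset.mem_filter.1 h).2.2
        rcases Finset.mem_union.1 h with h | h
        · exact h2 h
        · exact hnot _ hA1 (Finset.mem_filter.1 (hXB h)).2.1
      have hfB : ∀ e ∈ E.filter (fun e => e.1 ∈ B ∧ e.2 ∈ B) \ XB, f e.2 - f e.1 ≤ w e := by
        intro e he
        obtain ⟨h1, h2⟩ := Finset.mem_sdiff.1 he
        obtain ⟨hE, hB1, hB2⟩ := Finset.mem_filter.1 h1
        refine hf e (Finset.mem_sdiff.2 ⟨Finset.mem_filter.2
          ⟨hE, (hmemS _).2 (Or.inr hB1), (hmemS _).2 (Or.inr hB2)⟩, fun h => ?_⟩)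
        rcases Finset.mem_union.1 h with h | h
        · exact hnot _ (Finset.mem_filter.1 h).2.1 hB1
        rcases Finset.mem_union.1 h with h | h
        · exact hnot _ (Finset.mem_filter.1 (hXA h)).2.1 hB1
        · exact h2 h
      rcases (hmemS z).1 hz with hzA | hzB
      · obtain ⟨hz'A, h1⟩ := hstay _ _ hzz hzA
        exact hgA f hfA z hzA z' hz'A h1 (hstay _ _ hzz' hz'A).2
      · obtain ⟨hz'B, h1⟩ := hstayB _ _ hzz' hzB hz'
        exact hgB f hfB z hzB z' hz'B (hstayB _ _ hzz hz'B hz).2 h1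
  obtain ⟨X, hX, hcX, hgX⟩ := main _ Finset.univ rfl
  simp only [Finset.mem_univ, and_self, Finset.filter_true] at hX hgX
  exact ⟨X, hX, hcX, fun l hl y y' h1 h2 => hgX l hl y trivial y' trivial h1 h2⟩

end DirectedCut

/-! ### Record heights along a path -/

namespace DirectedCut

/-- The increments of the running maximum, capped at height `H`, of `h - κ W`. -/
noncomputable def record (H κ : ℝ) (h W : ℕ → ℝ) (i : ℕ) : ℝ :=
  min (partialSups (fun k => h k - κ * W k) (i + 1)) H -
    min (partialSups (fun k => h k - κ * W k) i) H

section Record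

variable {H κ : ℝ} {h W : ℕ → ℝ}

theorem record_nonneg (i : ℕ) : 0 ≤ record H κ h W i :=
  sub_nonneg.2 (min_le_min ((partialSups _).monotone (Nat.le_succ i)) le_rfl)

theorem record_le {i : ℕ} {w : ℝ} (hw : 0 ≤ w) (hκ : 0 ≤ κ) (hW : W i ≤ W (i + 1))
    (hh : h (i + 1) - h i ≤ w) : record H κ h W i ≤ w := by
  have h1 : h i - κ * W i ≤ partialSups (fun k => h k - κ * W k) i :=
    le_partialSups (fun k => h k - κ * W k) i
  have h2 : partialSups (fun k => h k - κ * W k) (i + 1) ≤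
      partialSups (fun k => h k - κ * W k) i + w := by
    rw [partialSups_add_one]
    refine sup_le (by linarith) ?_
    nlinarith
  unfold record
  rcases min_cases (partialSups (fun k => h k - κ * W k) (i + 1)) H with ⟨a, b⟩ | ⟨a, b⟩ <;>
  rcases min_cases (partialSups (fun k => h k - κ * W k) i) H with ⟨c, d⟩ | ⟨c, d⟩ <;> linarith

theorem sum_record (n : ℕ) : ∑ i ∈ Finset.range n, record H κ h W i =
    min (partialSups (fun k => h k - κ * W k) n) H - min (h 0 - κ * W 0) H := by
  have := Finset.sum_range_sub (fun i => min (partialSups (fun k => h k - κ * W k) i) H) n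
  simpa [record] using this

theorem record_pos_iff_aux {i : ℕ} (hi : 0 < record H κ h W i) :
    partialSups (fun k => h k - κ * W k) i < H ∧
    partialSups (fun k => h k - κ * W k) i < h (i + 1) - κ * W (i + 1) ∧
    partialSups (fun k => h k - κ * W k) (i + 1) = h (i + 1) - κ * W (i + 1) := by
  unfold record at hi
  have hs : partialSups (fun k => h k - κ * W k) (i + 1) =
      max (partialSups (fun k => h k - κ * W k) i) (h (i + 1) - κ * W (i + 1)) := by
    rw [partialSups_add_one]
  have h1 : partialSups (fun k => h k - κ * W k) i < H := by
    by_contra hc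
    have := min_le_right (partialSups (fun k => h k - κ * W k) (i + 1)) H
    rw [min_eq_right (not_lt.1 hc)] at hi
    linarith
  have h2 : partialSups (fun k => h k - κ * W k) i < h (i + 1) - κ * W (i + 1) := by
    by_contra hc
    rw [hs, max_eq_left (not_lt.1 hc)] at hi
    linarith
  exact ⟨h1, h2, by rw [hs, max_eq_right h2.le]⟩

/-- A positive increment means that `h - κ W` reaches a new maximum from below the cap. Compared
with any earlier index, `h` has therefore risen by more than `κ` times the increase of `W`. -/
theorem lt_of_record_pos {a i : ℕ} (hi : 0 < record H κ h W i) (ha : a ≤ i) :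
    h a - κ * W a < H ∧ h a - κ * W a < h (i + 1) - κ * W (i + 1) := by
  have h1 : h a - κ * W a ≤ partialSups (fun k => h k - κ * W k) i :=
    le_partialSups_of_le (fun k => h k - κ * W k) ha
  obtain ⟨h2, h3, -⟩ := record_pos_iff_aux hi
  exact ⟨h1.trans_lt h2, h1.trans_lt h3⟩

/-- At a record the running maximum equals `h - κ W` there, so the telescoped records are bounded by
the difference of `h - κ W`, and the `W` term has the favourable sign. -/
theorem sum_record_le {a i : ℕ} (hi : 0 < record H κ h W i) (ha : a ≤ i) (hκ : 0 ≤ κ)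
    (hW : W a ≤ W (i + 1)) :
    ∑ k ∈ Finset.Ico a (i + 1), record H κ h W k ≤ h (i + 1) - h a := by
  rw [Finset.sum_Ico_eq_sub _ (by omega : a ≤ i + 1), sum_record, sum_record]
  obtain ⟨-, -, h3⟩ := record_pos_iff_aux hi
  have h1 : h a - κ * W a ≤ partialSups (fun k => h k - κ * W k) a :=
    le_partialSups (fun k => h k - κ * W k) a
  have h4 : partialSups (fun k => h k - κ * W k) a ≤ partialSups (fun k => h k - κ * W k) (i + 1) :=
    (partialSups _).monotone (by omega)
  rw [h3] at h4 ⊢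
  have h5 : κ * W a ≤ κ * W (i + 1) := mul_le_mul_of_nonneg_left hW hκ
  rcases min_cases (h (i + 1) - κ * W (i + 1)) H with ⟨a', b'⟩ | ⟨a', b'⟩ <;>
  rcases min_cases (partialSups (fun k => h k - κ * W k) a) H with ⟨c, d⟩ | ⟨c, d⟩ <;> linarith

end Record

end DirectedCut

/-! ### A sequence of vertices against random tracks: overloaded tracks -/

namespace DirectedCut

/-- Clamping `A` to `[c - D - w₀, c + D]` preserves the increment of every step that ends within `D`
of `c`, and the clamped increments telescope. -/
theorem sum_near_le {A : ℕ → ℝ} {w₀ D : ℝ} (hA : Monotone A) (hw : ∀ i, A (i + 1) - A i ≤ w₀)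
    (hw₀ : 0 ≤ w₀) (hD : 0 ≤ D) (c : ℝ) (n : ℕ) :
    ∑ i ∈ Finset.range n, (if |A (i + 1) - c| ≤ D then A (i + 1) - A i else 0) ≤ 2 * D + w₀ := by
  let cl : ℝ → ℝ := fun x => max (c - D - w₀) (min (c + D) x)
  calc _ ≤ ∑ i ∈ Finset.range n, (cl (A (i + 1)) - cl (A i)) := by
        refine Finset.sum_le_sum fun i _ => ?_
        have h1 := hA (Nat.le_succ i)
        have h2 := hw i
        rw [Nat.succ_eq_add_one] at h1
        split_ifs with h
        · obtain ⟨h3, h4⟩ := abs_le.1 h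
          simp only [cl]
          rw [min_eq_right (by linarith), min_eq_right (by linarith), max_eq_right (by linarith),
            max_eq_right (by linarith)]
        · have : cl (A i) ≤ cl (A (i + 1)) := max_le_max le_rfl (min_le_min le_rfl h1)
          linarith
    _ = cl (A n) - cl (A 0) := Finset.sum_range_sub (fun i => cl (A i)) n
    _ ≤ 2 * D + w₀ := by
        have h1 : cl (A n) ≤ c + D := max_le (by linarith) (min_le_left _ _)
        have h2 : c - D - w₀ ≤ cl (A 0) := le_max_left _ _
        linarith

/-- For `x ≤ x'` both beyond `D`, `(x' - x) / x' ≤ log x' - log x`, which telescopes. The single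
step that crosses `D` accounts for the summand 1. -/
theorem sum_far_le {A : ℕ → ℝ} {D : ℝ} (hA : Monotone A) (hD : 0 < D) (hD1 : D ≤ 1) (k n : ℕ)
    (hn : A n - A k ≤ 1) :
    ∑ i ∈ Finset.Ico k n, (if D < A (i + 1) - A k then (A (i + 1) - A i) / (A (i + 1) - A k)
      else 0) ≤ 1 + Real.log (1 / D) := by
  have hlog : 0 ≤ Real.log (1 / D) := Real.log_nonneg ((one_le_div hD).2 hD1)
  rcases lt_or_ge n k with hkn | hkn
  · rw [Finset.Ico_eq_empty (by omega)]
    simp only [Finset.sum_empty]; linarith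
  let φ : ℝ → ℝ := fun x => if x ≤ D then 0 else 1 + Real.log (x / D)
  calc _ ≤ ∑ i ∈ Finset.Ico k n, (φ (A (i + 1) - A k) - φ (A i - A k)) := by
        refine Finset.sum_le_sum fun i hi => ?_
        have h0 := hA (Finset.mem_Ico.1 hi).1
        have h1 := hA (Nat.le_succ i)
        rw [Nat.succ_eq_add_one] at h1
        set x := A i - A k with hx
        set x' := A (i + 1) - A k with hx'
        have hxx : A (i + 1) - A i = x' - x := by rw [hx, hx']; ring
        have hx0 : 0 ≤ x := by linarith
        have hle : x ≤ x' := by linarith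
        rw [hxx]
        simp only [φ]
        by_cases h2 : D < x'
        · rw [if_pos h2, if_neg (not_le.2 h2)]
          by_cases h3 : x ≤ D
          · rw [if_pos h3]
            have : (x' - x) / x' ≤ 1 := (div_le_one (by linarith)).2 (by linarith)
            have : 0 ≤ Real.log (x' / D) := Real.log_nonneg ((one_le_div hD).2 h2.le)
            linarith
          · rw [if_neg h3]
            have hx1 : 0 < x := by linarith
            have hx2 : 0 < x' := by linarith
            have h5 := Real.log_le_sub_one_of_pos (div_pos hx1 hx2)
            rw [Real.log_div hx1.ne' hx2.ne'] at h5
            rw [Real.log_div hx1.ne' hD.ne', Real.log_div hx2.ne' hD.ne', sub_div, div_self hx2.ne']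
            linarith
        · rw [if_neg h2, if_pos (not_lt.1 h2), if_pos (hle.trans (not_lt.1 h2)), sub_zero]
    _ = φ (A n - A k) - φ (A k - A k) := Finset.sum_Ico_sub (fun i => φ (A i - A k)) hkn
    _ ≤ 1 + Real.log (1 / D) := by
        simp only [φ, sub_self, if_pos hD.le, sub_zero]
        split_ifs with h
        · linarith
        · have : Real.log ((A n - A k) / D) ≤ Real.log (1 / D) :=
            Real.log_le_log (div_pos (by linarith) hD) (by gcongr)
          linarith

/-- A family of finitely many weighted random tracks, together with the quantities that a further
sequence `v` of vertices, carrying masses `a`, is compared with. -/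
structure Crossing (S Q V : Type*) [Fintype S] [Fintype Q] [Fintype V] where
  σ : S → ℝ
  k : S → V → V → ℝ
  f : S → Q → ℝ
  y : S → Q → V → ℝ
  r : S → Q → V → ℝ
  Wt : S → Q → ℝ
  χ : V → V → ℝ
  Φy : V → ℝ
  Φb : V → ℝ
  v : ℕ → V
  a : ℕ → ℝ
  n : ℕ
  (m Φ cap₀ capN κ g₀ w₀ D L T : ℝ)
  σ_nonneg : ∀ s, 0 ≤ σ s
  k_nonneg : ∀ s a b, 0 ≤ k s a b
  k_self : ∀ s a, k s a a = 0
  k_tri : ∀ s a b c, k s a c ≤ k s a b + k s b c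
  f_nonneg : ∀ s q, 0 ≤ f s q
  y_nonneg : ∀ s q b, 0 ≤ y s q b
  r_nonneg : ∀ s q b, 0 ≤ r s q b
  Wt_one : ∀ s q, 0 < f s q → 1 ≤ Wt s q
  χ_nonneg : ∀ a b, 0 ≤ χ a b
  χ_le : ∀ a b, χ a b ≤ 1
  Φy_nonneg : ∀ b, 0 ≤ Φy b
  Φb_nonneg : ∀ b, 0 ≤ Φb b
  sum_Φb : ∑ b, Φb b ≤ Φ
  m_pos : 0 < m
  Φ_pos : 0 < Φ
  cap₀_pos : 0 < cap₀
  κ_pos : 0 < κ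
  g₀_pos : 0 < g₀
  D_pos : 0 < D
  D_le : D ≤ 1
  L_pos : 0 < L
  T_pos : 0 < T
  capN_nonneg : 0 ≤ capN
  sum_y : ∀ s b, m * ∑ q, f s q * y s q b ≤ Φy b
  sum_r : ∀ s b, m * ∑ q, f s q * r s q b ≤ Φb b
  sum_r' : ∀ s q, 0 < f s q → ∑ b, r s q b ≤ Wt s q
  r_le : ∀ s q b, 0 < f s q → r s q b ≤ Φb b
  y_le : ∀ s q b, 0 < f s q → y s q b ≤ Φy b
  -- `χ` selects unsaturated pairs: only those of small average climb count.
  cap : ∀ a b, χ a b ≠ 0 → ∑ s, σ s * k s a b ≤ cap₀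
  gap : ∀ s q a b, 0 < f s q → 0 < y s q a → 0 < r s q b → g₀ ≤ k s a b
  a_nonneg : ∀ i, 0 ≤ a i
  a_le : ∀ i, a i ≤ w₀
  sum_a : ∑ i ∈ Finset.range n, a i ≤ 1
  -- Every vertex that carries mass starts triples (track, early vertex, late vertex) in proportion
  -- `κ` to its volume.
  rich : ∀ i < n, 0 < a i → 0 < Φy (v i) ∧ κ * Φy (v i) ≤
    m * ∑ s, ∑ q, ∑ b, σ s * f s q * y s q (v i) * (r s q b / Wt s q) * χ (v i) b
  alive : ∀ i j, i < j → j < n → ∑ s, σ s * k s (v i) (v j) ≤ capN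
  -- A track that meets two distant members of the sequence must climb between them, by an amount
  -- proportional to the mass of the sequence in between.
  far : ∀ s q i j, i < j → j < n → 0 < a i → 0 < a j → 0 < f s q → 0 < y s q (v i) →
    0 < y s q (v j) → D < ∑ l ∈ Finset.Ico (i + 1) (j + 1), a l →
    L * ∑ l ∈ Finset.Ico (i + 1) (j + 1), a l ≤ 16 * Wt s q * k s (v i) (v j)
  T_near : 2 * (2 * D + w₀) ≤ T
  T_far : 256 * capN * (1 + Real.log (1 / D)) / (κ * L) ≤ T
  capN_le : capN ≤ κ ^ 2 * g₀ ^ 2 / (16 * Φ * cap₀)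

namespace Crossing

variable {S Q V : Type*} [Fintype S] [Fintype Q] [Fintype V] (C : Crossing S Q V)

/-- The share of the mass `a i` that falls on the track `q` of `s`. Dividing by the volume makes the
shares, averaged with weight `m`, add up to at most `a i`, which is `sum_z_le`. -/
noncomputable def z (s : S) (q : Q) (i : ℕ) : ℝ := C.a i * C.y s q (C.v i) / C.Φy (C.v i)

theorem z_nonneg (s : S) (q : Q) (i : ℕ) : 0 ≤ C.z s q i :=
  div_nonneg (mul_nonneg (C.a_nonneg i) (C.y_nonneg _ _ _)) (C.Φy_nonneg _)

theorem z_le (s : S) (q : Q) (i : ℕ) (h : 0 < C.f s q) : C.z s q i ≤ C.a i := by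
  unfold z
  rw [mul_div_assoc]
  exact mul_le_of_le_one_right (C.a_nonneg i) (div_le_one_of_le₀ (C.y_le _ _ _ h) (C.Φy_nonneg _))

theorem sum_z_le (g : S → ℝ) (hg : ∀ s, 0 ≤ g s) (i : ℕ) :
    C.m * ∑ s, ∑ q, C.σ s * C.f s q * C.z s q i * g s ≤ C.a i * ∑ s, C.σ s * g s := by
  rw [Finset.mul_sum, Finset.mul_sum]
  refine Finset.sum_le_sum fun s _ => ?_
  have h1 : C.m * ∑ q, C.σ s * C.f s q * C.z s q i * g s =
      C.σ s * g s * C.a i * ((C.m * ∑ q, C.f s q * C.y s q (C.v i)) / C.Φy (C.v i)) := by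
    simp only [Finset.mul_sum, Finset.sum_div, z]
    exact Finset.sum_congr rfl fun q _ => by ring
  rw [h1]
  have h2 : (C.m * ∑ q, C.f s q * C.y s q (C.v i)) / C.Φy (C.v i) ≤ 1 :=
    div_le_one_of_le₀ (C.sum_y _ _) (C.Φy_nonneg _)
  have h3 : 0 ≤ C.σ s * g s * C.a i :=
    mul_nonneg (mul_nonneg (C.σ_nonneg s) (hg s)) (C.a_nonneg i)
  nlinarith [mul_le_mul_of_nonneg_left h2 h3]

noncomputable def Θ : ℝ := ∑ i ∈ Finset.range C.n, C.a i

theorem Θ_nonneg : 0 ≤ C.Θ := Finset.sum_nonneg fun i _ => C.a_nonneg i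

noncomputable def A (i : ℕ) : ℝ := ∑ l ∈ Finset.range i, C.a l

theorem A_succ (i : ℕ) : C.A (i + 1) - C.A i = C.a i := by
  simp [A, Finset.sum_range_succ]

theorem A_mono : Monotone C.A := monotone_nat_of_le_succ fun i => by
  have := C.A_succ i
  have := C.a_nonneg i
  linarith

theorem sum_Ico_a {i j : ℕ} (h : i ≤ j) : ∑ l ∈ Finset.Ico i j, C.a l = C.A j - C.A i :=
  Finset.sum_Ico_eq_sub _ h

/-- A track is overloaded if it shares too much mass with the sequence. -/
def Bad (s : S) (q : Q) : Prop := C.T * C.Wt s q ≤ ∑ i ∈ Finset.range C.n, C.z s q i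

open Classical in
-- By `T_near`, at most half of the mass of an overloaded track lies near any given index, so its
-- mass is controlled by pairs of indices that are far apart. For these, `far` says that the factor
-- `16 * Wt * k / (L * distance)` is at least 1, which trades the product of two masses for a climb.
theorem sum_z_le_of_bad {s : S} {q : Q} (hf : 0 < C.f s q) (hbad : C.Bad s q) :
    ∑ i ∈ Finset.range C.n, C.z s q i ≤ 64 / (C.T * C.L) *
      ∑ i ∈ Finset.range C.n, ∑ j ∈ Finset.Ico (i + 1) C.n,
        C.z s q i * C.k s (C.v i) (C.v j) *
          (if C.D < C.A (j + 1) - C.A (i + 1) then C.a j / (C.A (j + 1) - C.A (i + 1)) else 0) := by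
  have hT := C.T_pos
  have hL := C.L_pos
  have hD := C.D_pos
  have hW1 := C.Wt_one s q hf
  have hW : 0 < C.Wt s q := by linarith
  set n := C.n
  let zz : ℕ → ℝ := C.z s q
  let P : ℕ → ℕ → Prop := fun i j => i < j ∧ C.D < C.A (j + 1) - C.A (i + 1)
  have hfar : ∀ i ∈ Finset.range n, C.T * C.Wt s q / 2 ≤
      ∑ j ∈ Finset.range n, ((if P i j then zz j else 0) + (if P j i then zz j else 0)) := by
    intro i _
    have hnear : ∑ j ∈ Finset.range n,
        (if |C.A (j + 1) - C.A (i + 1)| ≤ C.D then zz j else 0) ≤ C.T / 2 := by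
      refine le_trans (Finset.sum_le_sum fun j _ => ?_) ((sum_near_le C.A_mono
        (fun i => by rw [C.A_succ]; exact C.a_le i) ((C.a_nonneg 0).trans (C.a_le 0)) hD.le
        (C.A (i + 1)) n).trans (by linarith [C.T_near]))
      split_ifs
      · rw [C.A_succ]; exact C.z_le s q j hf
      · exact le_rfl
    have hsplit : ∑ j ∈ Finset.range n, zz j ≤ ∑ j ∈ Finset.range n,
        (if |C.A (j + 1) - C.A (i + 1)| ≤ C.D then zz j else 0) +
        ∑ j ∈ Finset.range n, ((if P i j then zz j else 0) + (if P j i then zz j else 0)) := by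
      rw [← Finset.sum_add_distrib]
      refine Finset.sum_le_sum fun j _ => ?_
      have hz := C.z_nonneg s q j
      have e1 : 0 ≤ (if P i j then zz j else 0) := by split_ifs <;> [exact hz; exact le_rfl]
      have e2 : 0 ≤ (if P j i then zz j else 0) := by split_ifs <;> [exact hz; exact le_rfl]
      by_cases hab : |C.A (j + 1) - C.A (i + 1)| ≤ C.D
      · rw [if_pos hab]; linarith
      · rw [if_neg hab]
        rcases lt_trichotomy i j with hij | hij | hij
        · have := C.A_mono (by omega : i + 1 ≤ j + 1)
          rw [abs_of_nonneg (by linarith), not_le] at hab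
          rw [if_pos (show P i j from ⟨hij, hab⟩)]
          linarith
        · subst hij; simp at hab; linarith
        · have := C.A_mono (by omega : j + 1 ≤ i + 1)
          rw [abs_sub_comm, abs_of_nonneg (by linarith), not_le] at hab
          rw [if_pos (show P j i from ⟨hij, hab⟩)]
          linarith
    have hb : C.T * C.Wt s q ≤ ∑ j ∈ Finset.range n, zz j := hbad
    nlinarith
  have hsum : C.T * C.Wt s q / 2 * ∑ i ∈ Finset.range n, zz i ≤
      2 * ∑ i ∈ Finset.range n, ∑ j ∈ Finset.range n, (if P i j then zz i * zz j else 0) := by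
    calc C.T * C.Wt s q / 2 * ∑ i ∈ Finset.range n, zz i
        = ∑ i ∈ Finset.range n, zz i * (C.T * C.Wt s q / 2) := by
          rw [Finset.mul_sum]; exact Finset.sum_congr rfl fun i _ => mul_comm _ _
      _ ≤ ∑ i ∈ Finset.range n, zz i * ∑ j ∈ Finset.range n,
          ((if P i j then zz j else 0) + (if P j i then zz j else 0)) :=
          Finset.sum_le_sum fun i hi => mul_le_mul_of_nonneg_left (hfar i hi) (C.z_nonneg s q i)
      _ = ∑ i ∈ Finset.range n, ∑ j ∈ Finset.range n, (if P i j then zz i * zz j else 0) +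
          ∑ i ∈ Finset.range n, ∑ j ∈ Finset.range n, (if P j i then zz j * zz i else 0) := by
          rw [← Finset.sum_add_distrib]
          refine Finset.sum_congr rfl fun i _ => ?_
          rw [← Finset.sum_add_distrib, Finset.mul_sum]
          refine Finset.sum_congr rfl fun j _ => ?_
          rw [mul_add, mul_ite, mul_ite, mul_zero, mul_comm (zz j)]
      _ = _ := by
          rw [Finset.sum_comm (f := fun i j => if P j i then zz j * zz i else 0), two_mul]
  have hterm : ∑ i ∈ Finset.range n, ∑ j ∈ Finset.range n, (if P i j then zz i * zz j else 0) ≤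
      16 * C.Wt s q / C.L * ∑ i ∈ Finset.range n, ∑ j ∈ Finset.Ico (i + 1) n,
        C.z s q i * C.k s (C.v i) (C.v j) *
          (if C.D < C.A (j + 1) - C.A (i + 1) then C.a j / (C.A (j + 1) - C.A (i + 1)) else 0) := by
    rw [Finset.mul_sum]
    refine Finset.sum_le_sum fun i hi => ?_
    have hsub : ∑ j ∈ Finset.range n, (if P i j then zz i * zz j else 0) =
        ∑ j ∈ Finset.Ico (i + 1) n, (if P i j then zz i * zz j else 0) := by
      symm
      refine Finset.sum_subset (fun j hj => Finset.mem_range.2 (Finset.mem_Ico.1 hj).2)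
        fun j hj hj' => if_neg fun hP => hj' (Finset.mem_Ico.2 ⟨hP.1, Finset.mem_range.1 hj⟩)
    rw [hsub, Finset.mul_sum]
    refine Finset.sum_le_sum fun j hj => ?_
    obtain ⟨hij, hjn⟩ := Finset.mem_Ico.1 hj
    by_cases hd : C.D < C.A (j + 1) - C.A (i + 1)
    · rw [if_pos hd, if_pos (show P i j from ⟨hij, hd⟩)]
      have hdpos : 0 < C.A (j + 1) - C.A (i + 1) := hD.trans hd
      have hk := C.k_nonneg s (C.v i) (C.v j)
      have hzi := C.z_nonneg s q i
      have hzj := C.z_nonneg s q j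
      have hnn : 0 ≤ 16 * C.Wt s q / C.L * (zz i * C.k s (C.v i) (C.v j) *
          (C.a j / (C.A (j + 1) - C.A (i + 1)))) := by
        have := C.a_nonneg j
        exact mul_nonneg (by positivity) (mul_nonneg (mul_nonneg hzi hk) (by positivity))
      by_cases h0 : zz i * zz j = 0
      · rw [h0]; exact hnn
      obtain ⟨hi0, hj0⟩ := mul_ne_zero_iff.1 h0
      have pos_of : ∀ l, zz l ≠ 0 → 0 < C.a l ∧ 0 < C.y s q (C.v l) := by
        intro l hl
        refine ⟨lt_of_le_of_ne (C.a_nonneg l) fun h => hl ?_,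
          lt_of_le_of_ne (C.y_nonneg _ _ _) fun h => hl ?_⟩ <;> simp [zz, z, ← h]
      have hmain := C.far s q i j hij hjn (pos_of i hi0).1 (pos_of j hj0).1 hf (pos_of i hi0).2
        (pos_of j hj0).2 (by rw [C.sum_Ico_a (by omega)]; exact hd)
      rw [C.sum_Ico_a (by omega)] at hmain
      have hone : 1 ≤ 16 * C.Wt s q / C.L * (C.k s (C.v i) (C.v j) /
          (C.A (j + 1) - C.A (i + 1))) := by
        rw [div_mul_div_comm, one_le_div (by positivity)]
        exact hmain
      calc zz i * zz j ≤ zz i * C.a j := mul_le_mul_of_nonneg_left (C.z_le s q j hf) hzi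
        _ ≤ zz i * C.a j * (16 * C.Wt s q / C.L * (C.k s (C.v i) (C.v j) /
          (C.A (j + 1) - C.A (i + 1)))) :=
            le_mul_of_one_le_right (mul_nonneg hzi (C.a_nonneg j)) hone
        _ = _ := by ring
    · rw [if_neg hd, if_neg (fun h : P i j => hd h.2)]
      simp
  have hfin : ∑ i ∈ Finset.range n, zz i ≤ 2 / (C.T * C.Wt s q / 2) *
      ∑ i ∈ Finset.range n, ∑ j ∈ Finset.range n, (if P i j then zz i * zz j else 0) := by
    rw [div_mul_eq_mul_div, le_div_iff₀ (by positivity)]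
    linarith
  refine hfin.trans ((mul_le_mul_of_nonneg_left hterm (by positivity)).trans (le_of_eq ?_))
  rw [← mul_assoc]
  congr 1
  field_simp
  ring

open Classical in
-- Averaged over all tracks, the climb from `v i` to `v j` is at most `capN` by `alive`, and the sum
-- of `a j / distance` is logarithmic. `T_far` is exactly the condition that brings the product down
-- to a quarter of `κ * Θ`.
theorem bad_mass_le :
    C.m * ∑ s, ∑ q, C.σ s * C.f s q *
      (if C.Bad s q then ∑ i ∈ Finset.range C.n, C.z s q i else 0) ≤ C.κ * C.Θ / 4 := by
  have hT := C.T_pos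
  have hL := C.L_pos
  have hm := C.m_pos
  have hκ := C.κ_pos
  let c : ℕ → ℕ → ℝ := fun i j => if C.D < C.A (j + 1) - C.A (i + 1) then
    C.a j / (C.A (j + 1) - C.A (i + 1)) else 0
  have hc0 : ∀ i j, 0 ≤ c i j := by
    intro i j
    simp only [c]
    split_ifs with h
    · exact div_nonneg (C.a_nonneg j) (C.D_pos.trans h).le
    · exact le_rfl
  have h1 : C.m * ∑ s, ∑ q, C.σ s * C.f s q *
      (if C.Bad s q then ∑ i ∈ Finset.range C.n, C.z s q i else 0) ≤
      C.m * ∑ s, ∑ q, C.σ s * C.f s q * (64 / (C.T * C.L) *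
      ∑ i ∈ Finset.range C.n, ∑ j ∈ Finset.Ico (i + 1) C.n,
        C.z s q i * C.k s (C.v i) (C.v j) * c i j) := by
    refine mul_le_mul_of_nonneg_left (Finset.sum_le_sum fun s _ => Finset.sum_le_sum fun q _ => ?_)
      hm.le
    rcases (C.f_nonneg s q).eq_or_lt with h0 | h0
    · simp [← h0]
    refine mul_le_mul_of_nonneg_left ?_ (mul_nonneg (C.σ_nonneg s) h0.le)
    split_ifs with hb
    · exact C.sum_z_le_of_bad h0 hb
    · exact mul_nonneg (by positivity) (Finset.sum_nonneg fun i _ => Finset.sum_nonneg fun j _ =>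
        mul_nonneg (mul_nonneg (C.z_nonneg _ _ _) (C.k_nonneg _ _ _)) (hc0 i j))
  refine h1.trans ?_
  have h2 : C.m * ∑ s, ∑ q, C.σ s * C.f s q * (64 / (C.T * C.L) *
      ∑ i ∈ Finset.range C.n, ∑ j ∈ Finset.Ico (i + 1) C.n,
        C.z s q i * C.k s (C.v i) (C.v j) * c i j) =
      64 / (C.T * C.L) * ∑ i ∈ Finset.range C.n, ∑ j ∈ Finset.Ico (i + 1) C.n, c i j *
        (C.m * ∑ s, ∑ q, C.σ s * C.f s q * C.z s q i * C.k s (C.v i) (C.v j)) := by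
    have e1 : ∀ s q, C.σ s * C.f s q * (64 / (C.T * C.L) *
      ∑ i ∈ Finset.range C.n, ∑ j ∈ Finset.Ico (i + 1) C.n,
        C.z s q i * C.k s (C.v i) (C.v j) * c i j) =
      ∑ i ∈ Finset.range C.n, ∑ j ∈ Finset.Ico (i + 1) C.n, 64 / (C.T * C.L) * c i j *
        (C.σ s * C.f s q * C.z s q i * C.k s (C.v i) (C.v j)) := by
      intro s q
      simp only [Finset.mul_sum]
      exact Finset.sum_congr rfl fun i _ => Finset.sum_congr rfl fun j _ => by ring
    simp only [e1]
    have e2 : ∀ s, ∑ q, ∑ i ∈ Finset.range C.n, ∑ j ∈ Finset.Ico (i + 1) C.n,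
        64 / (C.T * C.L) * c i j * (C.σ s * C.f s q * C.z s q i * C.k s (C.v i) (C.v j)) =
        ∑ i ∈ Finset.range C.n, ∑ j ∈ Finset.Ico (i + 1) C.n, ∑ q,
        64 / (C.T * C.L) * c i j * (C.σ s * C.f s q * C.z s q i * C.k s (C.v i) (C.v j)) := by
      intro s
      rw [Finset.sum_comm]
      exact Finset.sum_congr rfl fun i _ => Finset.sum_comm
    simp only [e2]
    rw [Finset.sum_comm, Finset.mul_sum, Finset.mul_sum]
    refine Finset.sum_congr rfl fun i _ => ?_
    rw [Finset.sum_comm, Finset.mul_sum, Finset.mul_sum]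
    refine Finset.sum_congr rfl fun j _ => ?_
    simp only [← Finset.mul_sum]
    ring
  rw [h2]
  have hfarsum : ∀ i ∈ Finset.range C.n, ∑ j ∈ Finset.Ico (i + 1) C.n, c i j ≤
      1 + Real.log (1 / C.D) := by
    intro i hi
    have := sum_far_le C.A_mono C.D_pos C.D_le (i + 1) C.n (by
      have h0 : 0 ≤ C.A (i + 1) := Finset.sum_nonneg fun l _ => C.a_nonneg l
      have h1 : C.A C.n ≤ 1 := C.sum_a
      linarith)
    simpa only [C.A_succ] using this
  have h3 : ∑ i ∈ Finset.range C.n, ∑ j ∈ Finset.Ico (i + 1) C.n, c i j *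
        (C.m * ∑ s, ∑ q, C.σ s * C.f s q * C.z s q i * C.k s (C.v i) (C.v j)) ≤
      C.capN * (1 + Real.log (1 / C.D)) * C.Θ := by
    rw [Θ, Finset.mul_sum]
    refine Finset.sum_le_sum fun i hi => ?_
    calc _ ≤ ∑ j ∈ Finset.Ico (i + 1) C.n, c i j * (C.a i * C.capN) := by
          refine Finset.sum_le_sum fun j hj => mul_le_mul_of_nonneg_left ?_ (hc0 i j)
          obtain ⟨h4, h5⟩ := Finset.mem_Ico.1 hj
          exact (C.sum_z_le (fun s => C.k s (C.v i) (C.v j)) (fun s => C.k_nonneg _ _ _) i).trans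
            (mul_le_mul_of_nonneg_left (C.alive i j h4 h5) (C.a_nonneg i))
      _ = (∑ j ∈ Finset.Ico (i + 1) C.n, c i j) * (C.a i * C.capN) := by rw [Finset.sum_mul]
      _ ≤ (1 + Real.log (1 / C.D)) * (C.a i * C.capN) :=
          mul_le_mul_of_nonneg_right (hfarsum i hi) (mul_nonneg (C.a_nonneg i) C.capN_nonneg)
      _ = _ := by ring
  refine (mul_le_mul_of_nonneg_left h3 (by positivity)).trans ?_
  have h6 := C.T_far
  rw [div_le_iff₀ (by positivity)] at h6
  rw [div_mul_eq_mul_div, div_le_iff₀ (by positivity)]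
  nlinarith [mul_le_mul_of_nonneg_right h6 C.Θ_nonneg]

end Crossing

end DirectedCut

/-! ### The second moment bound for the mass of the sequence -/

namespace DirectedCut

namespace Crossing

variable {S Q V : Type*} [Fintype S] [Fintype Q] [Fintype V] (C : Crossing S Q V)

/-- The mass of triples leaving from `a`. -/
noncomputable def t (a : V) : ℝ :=
  ∑ s, ∑ q, ∑ b, C.σ s * C.f s q * C.y s q a * (C.r s q b / C.Wt s q) * C.χ a b

theorem triple_nonneg (s : S) (q : Q) (a b : V) :
    0 ≤ C.σ s * C.f s q * C.y s q a * (C.r s q b / C.Wt s q) * C.χ a b := by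
  rcases (C.f_nonneg s q).eq_or_lt with h | h
  · simp [← h]
  have := C.Wt_one s q h
  exact mul_nonneg (mul_nonneg (mul_nonneg (mul_nonneg (C.σ_nonneg s) h.le) (C.y_nonneg _ _ _))
    (div_nonneg (C.r_nonneg _ _ _) (by linarith))) (C.χ_nonneg _ _)

open Classical in
/-- The normalised mass of triples of tracks that are not overloaded. -/
noncomputable def B (i : ℕ) (s : S) (q : Q) (b : V) : ℝ :=
  if C.Bad s q then 0 else
    C.a i * (C.σ s * C.f s q * C.y s q (C.v i) * (C.r s q b / C.Wt s q) * C.χ (C.v i) b) /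
      C.t (C.v i)

theorem t_nonneg (a : V) : 0 ≤ C.t a :=
  Finset.sum_nonneg fun _ _ => Finset.sum_nonneg fun _ _ => Finset.sum_nonneg fun _ _ =>
    C.triple_nonneg _ _ _ _

theorem B_nonneg (i : ℕ) (s : S) (q : Q) (b : V) : 0 ≤ C.B i s q b := by
  unfold B
  split_ifs
  · exact le_rfl
  · exact div_nonneg (mul_nonneg (C.a_nonneg i) (C.triple_nonneg _ _ _ _)) (C.t_nonneg _)

/-- Richness bounds the normaliser `t` below by `κ * Φy / m`, so dividing by `t` costs a factor `m /
κ` compared with the division by `Φy` in `z`. -/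
theorem normalised_le {i : ℕ} (hi : i < C.n) (s : S) (q : Q) (b : V) :
    C.a i * (C.σ s * C.f s q * C.y s q (C.v i) * (C.r s q b / C.Wt s q) * C.χ (C.v i) b) /
      C.t (C.v i) ≤ C.m / C.κ * (C.σ s * C.f s q * C.z s q i * (C.r s q b / C.Wt s q) *
        C.χ (C.v i) b) := by
  have hm := C.m_pos
  have hκ := C.κ_pos
  rcases (C.a_nonneg i).eq_or_lt with h | h
  · simp [z, ← h]
  obtain ⟨h1, h2⟩ := C.rich i hi h
  change _ ≤ C.m * C.t (C.v i) at h2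
  have ht : 0 < C.t (C.v i) := by
    have : 0 < C.m * C.t (C.v i) := lt_of_lt_of_le (by positivity) h2
    exact pos_of_mul_pos_right this hm.le
  have h3 := C.triple_nonneg s q (C.v i) b
  have e : C.m / C.κ * (C.σ s * C.f s q * C.z s q i * (C.r s q b / C.Wt s q) *
        C.χ (C.v i) b) = C.a i * (C.σ s * C.f s q * C.y s q (C.v i) * (C.r s q b / C.Wt s q) *
        C.χ (C.v i) b) * (C.m / (C.κ * C.Φy (C.v i))) := by
    unfold z
    field_simp
  rw [e, div_eq_mul_inv]
  refine mul_le_mul_of_nonneg_left ?_ (mul_nonneg h.le h3)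
  rw [inv_eq_one_div, div_le_div_iff₀ ht (by positivity)]
  linarith

theorem B_le {i : ℕ} (hi : i < C.n) (s : S) (q : Q) (b : V) :
    C.B i s q b ≤ C.m / C.κ * (C.σ s * C.f s q * C.z s q i * (C.r s q b / C.Wt s q) *
        C.χ (C.v i) b) := by
  refine le_trans ?_ (C.normalised_le hi s q b)
  unfold B
  split_ifs
  · exact div_nonneg (mul_nonneg (C.a_nonneg i) (C.triple_nonneg _ _ _ _)) (C.t_nonneg _)
  · exact le_rfl

theorem pos_of_B_pos {i : ℕ} {s : S} {q : Q} {b : V} (h : 0 < C.B i s q b) :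
    0 < C.f s q ∧ 0 < C.y s q (C.v i) ∧ 0 < C.r s q b ∧ C.χ (C.v i) b ≠ 0 ∧ ¬ C.Bad s q := by
  unfold B at h
  split_ifs at h with hb
  · exact absurd h (lt_irrefl _)
  refine ⟨lt_of_le_of_ne (C.f_nonneg _ _) fun h0 => ?_, lt_of_le_of_ne (C.y_nonneg _ _ _)
    fun h0 => ?_, lt_of_le_of_ne (C.r_nonneg _ _ _) fun h0 => ?_, fun h0 => ?_, hb⟩
  · simp [← h0] at h
  · simp [← h0] at h
  · simp [← h0] at h
  · simp [h0] at h

noncomputable def G (i : ℕ) (b : V) : ℝ := ∑ s, ∑ q, C.B i s q b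

theorem G_nonneg (i : ℕ) (b : V) : 0 ≤ C.G i b :=
  Finset.sum_nonneg fun _ _ => Finset.sum_nonneg fun _ _ => C.B_nonneg _ _ _ _

theorem exists_of_G_pos {i : ℕ} {b : V} (h : 0 < C.G i b) : ∃ s q, 0 < C.B i s q b := by
  by_contra! hc
  exact absurd h (not_lt.2 (Finset.sum_nonpos fun s _ => Finset.sum_nonpos fun q _ => hc s q))

theorem sum_G_le (i : ℕ) : ∑ b, C.G i b ≤ C.a i := by
  have h1 : ∑ b, C.G i b ≤ C.a i * (C.t (C.v i) / C.t (C.v i)) := by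
    have h2 : C.a i * (C.t (C.v i) / C.t (C.v i)) = ∑ b, ∑ s, ∑ q,
        C.a i * (C.σ s * C.f s q * C.y s q (C.v i) * (C.r s q b / C.Wt s q) * C.χ (C.v i) b) /
          C.t (C.v i) := by
      simp only [← Finset.sum_div, ← Finset.mul_sum]
      rw [mul_div_assoc]
      congr 2
      rw [t, Finset.sum_comm (s := Finset.univ (α := V))]
      exact Finset.sum_congr rfl fun s _ => Finset.sum_comm
    rw [h2]
    refine Finset.sum_le_sum fun b _ => Finset.sum_le_sum fun s _ => Finset.sum_le_sum fun q _ => ?_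
    unfold B
    split_ifs
    · exact div_nonneg (mul_nonneg (C.a_nonneg i) (C.triple_nonneg _ _ _ _)) (C.t_nonneg _)
    · exact le_rfl
  exact h1.trans (mul_le_of_le_one_right (C.a_nonneg i) (div_self_le_one _))

open Classical in
-- Normalisation gives the triples of each `i` total mass `a i`. Only those on overloaded tracks are
-- dropped, and by `bad_mass_le` they amount to at most a quarter.
theorem Θ_le_sum_G : 3 * C.Θ / 4 ≤ ∑ i ∈ Finset.range C.n, ∑ b, C.G i b := by
  have hm := C.m_pos
  have hκ := C.κ_pos
  have hi : ∀ i ∈ Finset.range C.n, C.a i ≤ ∑ b, C.G i b +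
      C.m / C.κ * ∑ s, ∑ q, C.σ s * C.f s q * (if C.Bad s q then C.z s q i else 0) := by
    intro i hi
    have hin := Finset.mem_range.1 hi
    rcases (C.a_nonneg i).eq_or_lt with h | h
    · rw [← h]
      refine add_nonneg (Finset.sum_nonneg fun b _ => C.G_nonneg _ _) (mul_nonneg (by positivity)
        (Finset.sum_nonneg fun s _ => Finset.sum_nonneg fun q _ =>
        mul_nonneg (mul_nonneg (C.σ_nonneg _) (C.f_nonneg _ _)) ?_))
      split_ifs
      exacts [C.z_nonneg _ _ _, le_rfl]
    obtain ⟨h1, h2⟩ := C.rich i hin h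
    change _ ≤ C.m * C.t (C.v i) at h2
    have ht : 0 < C.t (C.v i) := by
      have : 0 < C.m * C.t (C.v i) := lt_of_lt_of_le (by positivity) h2
      exact pos_of_mul_pos_right this hm.le
    have h3 : C.a i = ∑ s, ∑ q, ∑ b,
        C.a i * (C.σ s * C.f s q * C.y s q (C.v i) * (C.r s q b / C.Wt s q) * C.χ (C.v i) b) /
          C.t (C.v i) := by
      simp only [← Finset.sum_div, ← Finset.mul_sum]
      rw [mul_div_assoc]
      change _ = C.a i * (C.t (C.v i) / C.t (C.v i))
      rw [div_self ht.ne', mul_one]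
    have h4 : ∑ b, C.G i b = ∑ s, ∑ q, ∑ b, C.B i s q b := by
      unfold G
      rw [Finset.sum_comm]
      exact Finset.sum_congr rfl fun s _ => Finset.sum_comm
    rw [h4, Finset.mul_sum, ← Finset.sum_add_distrib]
    refine h3.le.trans (Finset.sum_le_sum fun s _ => ?_)
    rw [Finset.mul_sum, ← Finset.sum_add_distrib]
    refine Finset.sum_le_sum fun q _ => ?_
    by_cases hb : C.Bad s q
    · rw [if_pos hb]
      have h5 : ∑ b, C.B i s q b = 0 := Finset.sum_eq_zero fun b _ => by simp [B, hb]
      rw [h5, zero_add]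
      rcases (C.f_nonneg s q).eq_or_lt with h0 | h0
      · simp [← h0]
      have hW := C.Wt_one s q h0
      refine (Finset.sum_le_sum fun b _ => C.normalised_le hin s q b).trans ?_
      rw [← Finset.mul_sum]
      refine mul_le_mul_of_nonneg_left ?_ (by positivity)
      have h6 : ∑ b, C.r s q b / C.Wt s q ≤ 1 := by
        rw [← Finset.sum_div]
        exact div_le_one_of_le₀ (C.sum_r' s q h0) (by linarith)
      have h7 : 0 ≤ C.σ s * C.f s q * C.z s q i :=
        mul_nonneg (mul_nonneg (C.σ_nonneg _) (C.f_nonneg _ _)) (C.z_nonneg _ _ _)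
      calc _ ≤ ∑ b, C.σ s * C.f s q * C.z s q i * (C.r s q b / C.Wt s q) := by
            refine Finset.sum_le_sum fun b _ => mul_le_of_le_one_right ?_ (C.χ_le _ _)
            exact mul_nonneg h7 (div_nonneg (C.r_nonneg _ _ _) (by linarith))
        _ ≤ _ := by
            rw [← Finset.mul_sum]
            exact mul_le_of_le_one_right h7 h6
    · rw [if_neg hb, mul_zero, mul_zero, add_zero]
      refine Finset.sum_le_sum fun b _ => ?_
      simp [B, hb]
  have hsum := Finset.sum_le_sum hi
  rw [Finset.sum_add_distrib] at hsum
  have hbad := C.bad_mass_le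
  have hsw : ∑ i ∈ Finset.range C.n, C.m / C.κ * ∑ s, ∑ q,
      C.σ s * C.f s q * (if C.Bad s q then C.z s q i else 0) = 1 / C.κ * (C.m * ∑ s, ∑ q,
      C.σ s * C.f s q * (if C.Bad s q then ∑ i ∈ Finset.range C.n, C.z s q i else 0)) := by
    rw [← Finset.mul_sum, Finset.sum_comm, ← mul_assoc, one_div_mul_eq_div]
    congr 1
    refine Finset.sum_congr rfl fun s _ => ?_
    rw [Finset.sum_comm]
    refine Finset.sum_congr rfl fun q _ => ?_
    rw [← Finset.mul_sum]
    congr 1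
    split_ifs <;> simp
  rw [hsw] at hsum
  have h8 : 1 / C.κ * (C.m * ∑ s, ∑ q, C.σ s * C.f s q *
      (if C.Bad s q then ∑ i ∈ Finset.range C.n, C.z s q i else 0)) ≤ C.Θ / 4 := by
    refine (mul_le_mul_of_nonneg_left hbad (by positivity)).trans (le_of_eq ?_)
    field_simp
  change C.Θ ≤ _ at hsum
  linarith

/-- A Markov bound: each contributing track climbs at least `g₀` from `v i` to `b`, whereas the
average climb over all strategies is at most `cap₀` as soon as one triple has `χ ≠ 0`. -/
theorem G_le {i : ℕ} (hi : i < C.n) (b : V) :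
    C.G i b ≤ C.Φb b * (C.a i / C.κ * (C.cap₀ / C.g₀)) := by
  have hm := C.m_pos
  have hκ := C.κ_pos
  have hg := C.g₀_pos
  have hcap := C.cap₀_pos
  rcases (C.G_nonneg i b).eq_or_lt with h | h
  · rw [← h]
    have := C.Φb_nonneg b
    have := C.a_nonneg i
    positivity
  obtain ⟨s', q', hB⟩ := C.exists_of_G_pos h
  have hc := C.cap _ _ (C.pos_of_B_pos hB).2.2.2.1
  have h1 : C.G i b ≤ C.Φb b / (C.κ * C.g₀) * (C.m * ∑ s, ∑ q,
      C.σ s * C.f s q * C.z s q i * C.k s (C.v i) b) := by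
    rw [Finset.mul_sum, Finset.mul_sum]
    refine Finset.sum_le_sum fun s _ => ?_
    rw [Finset.mul_sum, Finset.mul_sum]
    refine Finset.sum_le_sum fun q _ => ?_
    have hnn : 0 ≤ C.Φb b / (C.κ * C.g₀) * (C.m * (C.σ s * C.f s q * C.z s q i *
        C.k s (C.v i) b)) :=
      mul_nonneg (div_nonneg (C.Φb_nonneg b) (by positivity)) (mul_nonneg hm.le
        (mul_nonneg (mul_nonneg (mul_nonneg (C.σ_nonneg _) (C.f_nonneg _ _)) (C.z_nonneg _ _ _))
          (C.k_nonneg _ _ _)))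
    rcases (C.B_nonneg i s q b).eq_or_lt with h0 | h0
    · rw [← h0]; exact hnn
    obtain ⟨hf, hy, hr, hχ, -⟩ := C.pos_of_B_pos h0
    have hgap := C.gap s q _ _ hf hy hr
    have hW := C.Wt_one s q hf
    refine (C.B_le hi s q b).trans ?_
    have hz : 0 ≤ C.σ s * C.f s q * C.z s q i :=
      mul_nonneg (mul_nonneg (C.σ_nonneg _) (C.f_nonneg _ _)) (C.z_nonneg _ _ _)
    have h2 : C.r s q b / C.Wt s q * C.χ (C.v i) b ≤ C.Φb b * (C.k s (C.v i) b / C.g₀) := by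
      have e1 : C.r s q b / C.Wt s q ≤ C.Φb b := (div_le_self hr.le hW).trans (C.r_le _ _ _ hf)
      have e2 : C.r s q b / C.Wt s q * C.χ (C.v i) b ≤ C.r s q b / C.Wt s q :=
        mul_le_of_le_one_right (div_nonneg hr.le (by linarith)) (C.χ_le _ _)
      refine (e2.trans e1).trans (le_mul_of_one_le_right (C.Φb_nonneg b) ?_)
      rwa [one_le_div hg]
    calc _ = C.m / C.κ * (C.σ s * C.f s q * C.z s q i) * (C.r s q b / C.Wt s q *
          C.χ (C.v i) b) := by ring
      _ ≤ C.m / C.κ * (C.σ s * C.f s q * C.z s q i) * (C.Φb b * (C.k s (C.v i) b / C.g₀)) :=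
          mul_le_mul_of_nonneg_left h2 (mul_nonneg (by positivity) hz)
      _ = _ := by field_simp
  refine h1.trans ?_
  have h3 := C.sum_z_le (fun s => C.k s (C.v i) b) (fun s => C.k_nonneg _ _ _) i
  calc _ ≤ C.Φb b / (C.κ * C.g₀) * (C.a i * C.cap₀) :=
        mul_le_mul_of_nonneg_left (h3.trans (mul_le_mul_of_nonneg_left hc (C.a_nonneg i)))
          (div_nonneg (C.Φb_nonneg b) (by positivity))
    _ = _ := by field_simp

/-- The part of the product of the masses at `i` and `j` that is charged to the climb from `j`. -/
noncomputable def U (i j : ℕ) (b : V) : ℝ :=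
  (∑ s, ∑ q, C.B i s q b * C.k s (C.v j) b) * C.G j b / C.g₀

/-- The remaining part, charged to the climb from `v i` to `v j`; it vanishes on the diagonal, where
there is no climb. -/
noncomputable def U' (i j : ℕ) (b : V) : ℝ :=
  if i < j then (∑ s, ∑ q, C.B i s q b * C.k s (C.v i) (C.v j)) * C.G j b / C.g₀ else 0

theorem U_nonneg (i j : ℕ) (b : V) : 0 ≤ C.U i j b :=
  div_nonneg (mul_nonneg (Finset.sum_nonneg fun _ _ => Finset.sum_nonneg fun _ _ =>
    mul_nonneg (C.B_nonneg _ _ _ _) (C.k_nonneg _ _ _)) (C.G_nonneg _ _)) C.g₀_pos.le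

theorem U'_nonneg (i j : ℕ) (b : V) : 0 ≤ C.U' i j b := by
  unfold U'
  split_ifs
  · exact div_nonneg (mul_nonneg (Finset.sum_nonneg fun s _ => Finset.sum_nonneg fun q _ =>
      mul_nonneg (C.B_nonneg _ _ _ _) (C.k_nonneg _ _ _)) (C.G_nonneg _ _)) C.g₀_pos.le
  · exact le_rfl

/-- A track counted at `i` climbs at least `g₀` from `v i` to `b`, and by the triangle inequality
this climb is shared between `v i → v j` and `v j → b`. -/
theorem G_mul_G_le_of_le {i j : ℕ} (hij : i ≤ j) (b : V) :
    C.G i b * C.G j b ≤ C.U i j b + C.U' i j b := by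
  have hg := C.g₀_pos
  have h1 : C.G i b ≤ (∑ s, ∑ q, C.B i s q b * C.k s (C.v j) b) / C.g₀ +
      (∑ s, ∑ q, C.B i s q b * C.k s (C.v i) (C.v j)) / C.g₀ := by
    rw [← add_div, le_div_iff₀ hg, G, Finset.sum_mul, ← Finset.sum_add_distrib]
    refine Finset.sum_le_sum fun s _ => ?_
    rw [Finset.sum_mul, ← Finset.sum_add_distrib]
    refine Finset.sum_le_sum fun q _ => ?_
    rcases (C.B_nonneg i s q b).eq_or_lt with h0 | h0
    · simp [← h0]
    obtain ⟨hf, hy, hr, -, -⟩ := C.pos_of_B_pos h0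
    rw [← mul_add]
    refine mul_le_mul_of_nonneg_left ?_ h0.le
    have := C.k_tri s (C.v i) (C.v j) b
    have := C.gap s q _ _ hf hy hr
    linarith
  have h2 := mul_le_mul_of_nonneg_right h1 (C.G_nonneg j b)
  refine h2.trans ?_
  rw [add_mul, U, U', div_mul_eq_mul_div, div_mul_eq_mul_div]
  refine add_le_add le_rfl ?_
  split_ifs with h
  · exact le_rfl
  · have : i = j := by omega
    subst this
    simp [C.k_self]

theorem G_mul_G_le (i j : ℕ) (b : V) :
    C.G i b * C.G j b ≤ (C.U i j b + C.U' i j b) + (C.U j i b + C.U' j i b) := by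
  have h1 := C.U_nonneg i j b
  have h2 := C.U_nonneg j i b
  have h3 := C.U'_nonneg i j b
  have h4 := C.U'_nonneg j i b
  rcases le_total i j with h | h
  · linarith [C.G_mul_G_le_of_le h b]
  · linarith [C.G_mul_G_le_of_le h b, mul_comm (C.G i b) (C.G j b)]

theorem G_eq_zero {i : ℕ} {b : V} (h : C.Φb b = 0) : C.G i b = 0 := by
  by_contra hne
  obtain ⟨s, q, hB⟩ := C.exists_of_G_pos (lt_of_le_of_ne (C.G_nonneg i b) (Ne.symm hne))
  obtain ⟨hf, -, hr, -, -⟩ := C.pos_of_B_pos hB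
  have := C.r_le s q b hf
  linarith

/-- Only tracks that are not overloaded contribute; their total share is at most `T * Wt`, which
cancels the division of `r` by `Wt`. -/
theorem sum_B_le (s : S) (q : Q) (b : V) :
    ∑ i ∈ Finset.range C.n, C.B i s q b ≤ C.m / C.κ * C.T * (C.σ s * C.f s q * C.r s q b) := by
  have hm := C.m_pos
  have hκ := C.κ_pos
  have hT := C.T_pos
  have hnn : 0 ≤ C.m / C.κ * C.T * (C.σ s * C.f s q * C.r s q b) :=
    mul_nonneg (by positivity) (mul_nonneg (mul_nonneg (C.σ_nonneg _) (C.f_nonneg _ _))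
      (C.r_nonneg _ _ _))
  by_cases hb : C.Bad s q
  · rwa [Finset.sum_eq_zero fun i _ => by simp [B, hb]]
  rcases (C.f_nonneg s q).eq_or_lt with h0 | h0
  · have : ∀ i, C.B i s q b = 0 := fun i => by simp [B, ← h0]
    rwa [Finset.sum_eq_zero fun i _ => this i]
  have hW := C.Wt_one s q h0
  have hW0 : 0 < C.Wt s q := by linarith
  have hz : ∑ i ∈ Finset.range C.n, C.z s q i ≤ C.T * C.Wt s q := le_of_lt (not_le.1 hb)
  have hr := C.r_nonneg s q b
  have hσ := C.σ_nonneg s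
  calc ∑ i ∈ Finset.range C.n, C.B i s q b
      ≤ ∑ i ∈ Finset.range C.n, C.m / C.κ * (C.σ s * C.f s q * (C.r s q b / C.Wt s q)) *
          C.z s q i := by
        refine Finset.sum_le_sum fun i hi => (C.B_le (Finset.mem_range.1 hi) s q b).trans ?_
        have h1 : 0 ≤ C.m / C.κ * (C.σ s * C.f s q * (C.r s q b / C.Wt s q)) * C.z s q i :=
          mul_nonneg (by positivity) (C.z_nonneg _ _ _)
        calc _ = C.m / C.κ * (C.σ s * C.f s q * (C.r s q b / C.Wt s q)) * C.z s q i *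
              C.χ (C.v i) b := by ring
          _ ≤ _ := mul_le_of_le_one_right h1 (C.χ_le _ _)
    _ = C.m / C.κ * (C.σ s * C.f s q * (C.r s q b / C.Wt s q)) *
          ∑ i ∈ Finset.range C.n, C.z s q i := by rw [Finset.mul_sum]
    _ ≤ C.m / C.κ * (C.σ s * C.f s q * (C.r s q b / C.Wt s q)) * (C.T * C.Wt s q) :=
        mul_le_mul_of_nonneg_left hz (by positivity)
    _ = _ := by field_simp

/-- After summing over `i`, each strategy contributes its flow through `b`, at most `Φb b` by
`sum_r`, times its climb from `v j` to `b`. A positive `G j b` certifies that this climb averages to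
at most `cap₀`. -/
theorem sum_U_le (j : ℕ) (b : V) :
    (∑ i ∈ Finset.range C.n, C.U i j b) / C.Φb b ≤ C.G j b * (C.T * C.cap₀ / (C.κ * C.g₀)) := by
  have hm := C.m_pos
  have hκ := C.κ_pos
  have hT := C.T_pos
  have hg := C.g₀_pos
  have hcap := C.cap₀_pos
  rcases (C.Φb_nonneg b).eq_or_lt with h0 | h0
  · rw [← h0, div_zero, C.G_eq_zero h0.symm, zero_mul]
  rw [div_le_iff₀ h0]
  rcases (C.G_nonneg j b).eq_or_lt with h | h
  · simp [U, ← h]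
  obtain ⟨s', q', hB⟩ := C.exists_of_G_pos h
  have hc := C.cap _ _ (C.pos_of_B_pos hB).2.2.2.1
  have e : ∑ i ∈ Finset.range C.n, C.U i j b = (∑ s, ∑ q,
      (∑ i ∈ Finset.range C.n, C.B i s q b) * C.k s (C.v j) b) * C.G j b / C.g₀ := by
    simp only [U]
    rw [← Finset.sum_div, ← Finset.sum_mul, Finset.sum_comm]
    congr 2
    refine Finset.sum_congr rfl fun s _ => ?_
    rw [Finset.sum_comm]
    exact Finset.sum_congr rfl fun q _ => by rw [Finset.sum_mul]
  have h2 : ∑ s, ∑ q, (∑ i ∈ Finset.range C.n, C.B i s q b) * C.k s (C.v j) b ≤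
      C.T / C.κ * C.Φb b * C.cap₀ := by
    calc _ ≤ ∑ s, ∑ q, C.m / C.κ * C.T * (C.σ s * C.f s q * C.r s q b) * C.k s (C.v j) b :=
          Finset.sum_le_sum fun s _ => Finset.sum_le_sum fun q _ =>
            mul_le_mul_of_nonneg_right (C.sum_B_le s q b) (C.k_nonneg _ _ _)
      _ = ∑ s, C.T / C.κ * (C.σ s * C.k s (C.v j) b) * (C.m * ∑ q, C.f s q * C.r s q b) := by
          simp only [Finset.mul_sum]
          refine Finset.sum_congr rfl fun s _ => Finset.sum_congr rfl fun q _ => ?_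
          field_simp
      _ ≤ ∑ s, C.T / C.κ * (C.σ s * C.k s (C.v j) b) * C.Φb b :=
          Finset.sum_le_sum fun s _ => mul_le_mul_of_nonneg_left (C.sum_r s b)
            (mul_nonneg (by positivity) (mul_nonneg (C.σ_nonneg _) (C.k_nonneg _ _ _)))
      _ = C.T / C.κ * C.Φb b * ∑ s, C.σ s * C.k s (C.v j) b := by
          rw [Finset.mul_sum]
          exact Finset.sum_congr rfl fun s _ => by ring
      _ ≤ _ := mul_le_mul_of_nonneg_left hc (by positivity)
  rw [e, div_le_iff₀ hg]
  calc _ ≤ C.T / C.κ * C.Φb b * C.cap₀ * C.G j b := mul_le_mul_of_nonneg_right h2 h.le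
    _ = _ := by field_simp

/-- Here `G j b / Φb b` is bounded pointwise by `G_le`, and what is left is the average climb from
`v i` to `v j`, which is at most `capN`. -/
theorem sum_U'_le {i j : ℕ} (hi : i < C.n) (hj : j < C.n) :
    ∑ b, C.U' i j b / C.Φb b ≤
      C.a i * C.a j * (C.cap₀ * C.capN / (C.κ * C.g₀) ^ 2) := by
  have hm := C.m_pos
  have hκ := C.κ_pos
  have hg := C.g₀_pos
  have hcap := C.cap₀_pos
  have hai := C.a_nonneg i
  have haj := C.a_nonneg j
  have hN := C.capN_nonneg
  unfold U'
  split_ifs with hij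
  swap
  · simp only [zero_div, Finset.sum_const_zero]; positivity
  have h1 : ∀ b, (∑ s, ∑ q, C.B i s q b * C.k s (C.v i) (C.v j)) * C.G j b / C.g₀ / C.Φb b ≤
      (∑ s, ∑ q, C.B i s q b * C.k s (C.v i) (C.v j)) *
        (C.a j / C.κ * (C.cap₀ / C.g₀) / C.g₀) := by
    intro b
    have h2 : C.G j b / C.Φb b ≤ C.a j / C.κ * (C.cap₀ / C.g₀) := by
      rcases (C.Φb_nonneg b).eq_or_lt with h0 | h0
      · rw [← h0, div_zero]; positivity
      · rw [div_le_iff₀ h0, mul_comm]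
        exact C.G_le hj b
    have h3 : 0 ≤ ∑ s, ∑ q, C.B i s q b * C.k s (C.v i) (C.v j) :=
      Finset.sum_nonneg fun s _ => Finset.sum_nonneg fun q _ =>
        mul_nonneg (C.B_nonneg _ _ _ _) (C.k_nonneg _ _ _)
    calc _ = (∑ s, ∑ q, C.B i s q b * C.k s (C.v i) (C.v j)) * (C.G j b / C.Φb b / C.g₀) := by
          field_simp
      _ ≤ _ := mul_le_mul_of_nonneg_left (by gcongr) h3
  refine (Finset.sum_le_sum fun b _ => h1 b).trans ?_
  rw [← Finset.sum_mul]
  have h4 : ∑ b, ∑ s, ∑ q, C.B i s q b * C.k s (C.v i) (C.v j) ≤ C.a i / C.κ * C.capN := by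
    calc _ = ∑ s, ∑ q, (∑ b, C.B i s q b) * C.k s (C.v i) (C.v j) := by
          rw [Finset.sum_comm]
          refine Finset.sum_congr rfl fun s _ => ?_
          rw [Finset.sum_comm]
          exact Finset.sum_congr rfl fun q _ => by rw [Finset.sum_mul]
      _ ≤ ∑ s, ∑ q, C.m / C.κ * (C.σ s * C.f s q * C.z s q i) * C.k s (C.v i) (C.v j) := by
          refine Finset.sum_le_sum fun s _ => Finset.sum_le_sum fun q _ =>
            mul_le_mul_of_nonneg_right ?_ (C.k_nonneg _ _ _)
          rcases (C.f_nonneg s q).eq_or_lt with h0 | h0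
          · have : ∀ b, C.B i s q b = 0 := fun b => by simp [B, ← h0]
            simp [this, ← h0]
          have hW := C.Wt_one s q h0
          have h7 : 0 ≤ C.m / C.κ * (C.σ s * C.f s q * C.z s q i) := mul_nonneg (by positivity)
            (mul_nonneg (mul_nonneg (C.σ_nonneg _) (C.f_nonneg _ _)) (C.z_nonneg _ _ _))
          calc _ ≤ ∑ b, C.m / C.κ * (C.σ s * C.f s q * C.z s q i) * (C.r s q b / C.Wt s q) := by
                refine Finset.sum_le_sum fun b _ => (C.B_le hi s q b).trans ?_
                rw [← mul_assoc, ← mul_assoc]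
                exact mul_le_of_le_one_right (mul_nonneg h7
                  (div_nonneg (C.r_nonneg _ _ _) (by linarith))) (C.χ_le _ _)
            _ ≤ _ := by
                rw [← Finset.mul_sum, ← Finset.sum_div]
                exact mul_le_of_le_one_right h7
                  (div_le_one_of_le₀ (C.sum_r' s q h0) (by linarith))
      _ = 1 / C.κ * (C.m * ∑ s, ∑ q, C.σ s * C.f s q * C.z s q i * C.k s (C.v i) (C.v j)) := by
          simp only [Finset.mul_sum]
          exact Finset.sum_congr rfl fun s _ => Finset.sum_congr rfl fun q _ => by ring
      _ ≤ 1 / C.κ * (C.a i * C.capN) := mul_le_mul_of_nonneg_left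
          ((C.sum_z_le (fun s => C.k s (C.v i) (C.v j)) (fun s => C.k_nonneg _ _ _) i).trans
            (mul_le_mul_of_nonneg_left (C.alive i j hij hj) hai)) (by positivity)
      _ = _ := by ring
  calc _ ≤ C.a i / C.κ * C.capN * (C.a j / C.κ * (C.cap₀ / C.g₀) / C.g₀) :=
        mul_le_mul_of_nonneg_right h4 (by positivity)
    _ = _ := by field_simp

/-- The functions `G i` live on vertices `b` of total volume `Φ`, so by Cauchy-Schwarz `(∑ g)²` is
at most `Φ * ∑ g² / Φb`. Expanding `g²` into pairs `(i, j)`, the climbs to `b` give a term linear in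
`Θ` and the climbs along the sequence a quadratic one. `capN_le` makes the latter at most `Θ² / 8`,
so the left side `9 Θ² / 16` absorbs it. -/
theorem mass_le : C.Θ ≤ 5 * C.Φ * C.T * C.cap₀ / (C.κ * C.g₀) := by
  have hκ := C.κ_pos
  have hT := C.T_pos
  have hg := C.g₀_pos
  have hcap := C.cap₀_pos
  have hΦ := C.Φ_pos
  let g : V → ℝ := fun b => ∑ i ∈ Finset.range C.n, C.G i b
  have hsumg : 3 * C.Θ / 4 ≤ ∑ b, g b := by
    refine C.Θ_le_sum_G.trans (le_of_eq ?_)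
    exact Finset.sum_comm
  have hCS : (∑ b, g b) ^ 2 ≤ (∑ b, g b ^ 2 / C.Φb b) * ∑ b, C.Φb b := by
    refine Finset.sum_sq_le_sum_mul_sum_of_sq_le_mul _ (fun b _ => ?_) (fun b _ => C.Φb_nonneg b)
      (fun b _ => ?_)
    · exact div_nonneg (sq_nonneg _) (C.Φb_nonneg b)
    · rcases (C.Φb_nonneg b).eq_or_lt with h0 | h0
      · have : g b = 0 := Finset.sum_eq_zero fun i _ => C.G_eq_zero h0.symm
        rw [this]; simp
      · rw [div_mul_cancel₀ _ h0.ne']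
  have hup : ∑ b, g b ^ 2 / C.Φb b ≤ 2 * (C.Θ * (C.T * C.cap₀ / (C.κ * C.g₀)) +
      C.Θ ^ 2 * (C.cap₀ * C.capN / (C.κ * C.g₀) ^ 2)) := by
    have h1 : ∀ b, g b ^ 2 / C.Φb b ≤ 2 * (∑ j ∈ Finset.range C.n,
        (∑ i ∈ Finset.range C.n, C.U i j b) / C.Φb b + ∑ i ∈ Finset.range C.n,
          ∑ j ∈ Finset.range C.n, C.U' i j b / C.Φb b) := by
      intro b
      have h2 : g b ^ 2 ≤ 2 * (∑ j ∈ Finset.range C.n, ∑ i ∈ Finset.range C.n, C.U i j b +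
          ∑ i ∈ Finset.range C.n, ∑ j ∈ Finset.range C.n, C.U' i j b) := by
        have h3 : g b ^ 2 = ∑ i ∈ Finset.range C.n, ∑ j ∈ Finset.range C.n,
            C.G i b * C.G j b := by
          rw [sq, Finset.sum_mul_sum]
        rw [h3]
        refine (Finset.sum_le_sum fun i _ => Finset.sum_le_sum fun j _ =>
          C.G_mul_G_le i j b).trans (le_of_eq ?_)
        simp only [Finset.sum_add_distrib]
        rw [Finset.sum_comm (f := fun i j => C.U i j b),
          Finset.sum_comm (f := fun i j => C.U' j i b)]
        ring
      refine (div_le_div_of_nonneg_right h2 (C.Φb_nonneg b)).trans (le_of_eq ?_)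
      simp only [← Finset.sum_div]
      rw [← add_div, mul_div_assoc]
    refine (Finset.sum_le_sum fun b _ => h1 b).trans ?_
    rw [← Finset.mul_sum, Finset.sum_add_distrib]
    refine mul_le_mul_of_nonneg_left (add_le_add ?_ ?_) (by norm_num)
    · rw [Finset.sum_comm, Θ, Finset.sum_mul]
      refine Finset.sum_le_sum fun j _ => ?_
      refine (Finset.sum_le_sum fun b _ => C.sum_U_le j b).trans ?_
      rw [← Finset.sum_mul]
      exact mul_le_mul_of_nonneg_right (C.sum_G_le j) (by positivity)
    · rw [Finset.sum_comm, sq, Θ, Finset.sum_mul_sum, Finset.sum_mul]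
      refine Finset.sum_le_sum fun i hi => ?_
      rw [Finset.sum_comm, Finset.sum_mul]
      exact Finset.sum_le_sum fun j hj =>
        C.sum_U'_le (Finset.mem_range.1 hi) (Finset.mem_range.1 hj)
  have hΘ := C.Θ_nonneg
  have hup0 : 0 ≤ ∑ b, g b ^ 2 / C.Φb b :=
    Finset.sum_nonneg fun b _ => div_nonneg (sq_nonneg _) (C.Φb_nonneg b)
  have hN : C.cap₀ * C.capN / (C.κ * C.g₀) ^ 2 ≤ 1 / (16 * C.Φ) := by
    have := C.capN_le
    rw [le_div_iff₀ (by positivity)] at this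
    rw [div_le_div_iff₀ (by positivity) (by positivity)]
    nlinarith
  set M := C.T * C.cap₀ / (C.κ * C.g₀) with hM
  have hkey : (3 * C.Θ / 4) ^ 2 ≤ 2 * (C.Θ * M + C.Θ ^ 2 * (1 / (16 * C.Φ))) * C.Φ := by
    have h0 : 0 ≤ 3 * C.Θ / 4 := by positivity
    calc (3 * C.Θ / 4) ^ 2 ≤ (∑ b, g b) ^ 2 := pow_le_pow_left₀ h0 hsumg 2
      _ ≤ (∑ b, g b ^ 2 / C.Φb b) * ∑ b, C.Φb b := hCS
      _ ≤ (∑ b, g b ^ 2 / C.Φb b) * C.Φ := mul_le_mul_of_nonneg_left C.sum_Φb hup0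
      _ ≤ _ := mul_le_mul_of_nonneg_right (hup.trans (mul_le_mul_of_nonneg_left
          (add_le_add le_rfl (mul_le_mul_of_nonneg_left hN (sq_nonneg _))) (by norm_num))) hΦ.le
  have e1 : 2 * (C.Θ * M + C.Θ ^ 2 * (1 / (16 * C.Φ))) * C.Φ =
      2 * C.Θ * M * C.Φ + C.Θ ^ 2 / 8 := by field_simp; ring
  have e2 : 5 * C.Φ * C.T * C.cap₀ / (C.κ * C.g₀) = 5 * C.Φ * M := by rw [hM]; ring
  rw [e1] at hkey
  rw [e2]
  have hM0 : 0 ≤ M := by positivity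
  rcases hΘ.eq_or_lt with h | h
  · rw [← h]; positivity
  have : 7 / 16 * C.Θ ≤ 2 * M * C.Φ := by
    refine le_of_mul_le_mul_right ?_ h
    nlinarith
  nlinarith [mul_nonneg hM0 hΦ.le]

end Crossing

end DirectedCut

/-! ### Track systems: records, early and late vertices -/

namespace DirectedCut

/-- A catalogue `Q` of vertex sequences in a weighted graph, with levels indexed by `J`. -/
structure TrackSystem (V Q J : Type*) where
  N : Q → ℕ
  vt : Q → ℕ → V
  w : V → V → ℝ
  lev : J → V → ℝ
  L : ℝ

namespace TrackSystem

variable {V Q J : Type*} (A : TrackSystem V Q J)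

/-- All edges reversed, and the levels turned upside down. -/
def rev : TrackSystem V Q J where
  N := A.N
  vt q i := A.vt q (A.N q - i)
  w a b := A.w b a
  lev j v := A.L - A.lev j v
  L := A.L

def ew (q : Q) (i : ℕ) : ℝ := A.w (A.vt q i) (A.vt q (i + 1))

def len (q : Q) (i : ℕ) : ℝ := ∑ k ∈ Finset.range i, A.ew q k

/-- The cap `L / 4` keeps the records in the lower part of the track. The slope is chosen so that
the correction over the whole length is `L / 16`, small enough for a demand track still to reach the
cap. -/
noncomputable def xi (j : J) (q : Q) (i : ℕ) : ℝ :=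
  record (A.L / 4) (A.L / (16 * A.len q (A.N q))) (fun i => A.lev j (A.vt q i)) (A.len q) i

section

variable [DecidableEq V]

noncomputable def mass (j : J) (q : Q) (U : Finset V) : ℝ :=
  ∑ i ∈ Finset.range (A.N q), if A.vt q (i + 1) ∈ U then A.xi j q i else 0

/-- Record mass is placed at the head of a step, and `x` is the fraction of the flow kept on that
step. -/
noncomputable def early (x : V → V → ℝ) (j : J) (q : Q) (a : V) : ℝ :=
  ∑ i ∈ Finset.range (A.N q), if A.vt q (i + 1) = a then
    A.xi j q i * x (A.vt q i) (A.vt q (i + 1)) else 0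

open Classical in
-- Weight is placed at the tail of a step. On demand tracks records lie at height at most `6 L /
-- 16`, so the threshold `7 L / 16` leaves a gap `L / 16`. Since it is below `L / 2`, late vertices
-- of the track and of its reversal together cover every step.
noncomputable def late (x : V → V → ℝ) (j : J) (q : Q) (b : V) : ℝ :=
  ∑ i ∈ Finset.range (A.N q), if A.vt q i = b ∧ 7 * A.L / 16 ≤ A.lev j (A.vt q i) then
    A.ew q i * x (A.vt q i) (A.vt q (i + 1)) else 0

end

/-- The properties of a track system after the low diameter decomposition. -/
structure Good (T : Q → Prop) (D : J → Q → Prop) (w₀ Φ : ℝ) (Φin Φout : V → ℝ) [Fintype V] :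
    Prop where
  L_pos : 0 < A.L
  L_le : A.L ≤ 1
  w₀_pos : 0 < w₀
  w₀_le : 16 * w₀ ≤ A.L
  D_T : ∀ j q, D j q → T q
  D_start : ∀ j q, D j q → A.lev j (A.vt q 0) = 0
  D_end : ∀ j q, D j q → A.lev j (A.vt q (A.N q)) = A.L
  D_len : ∀ j q, D j q → 1 ≤ A.len q (A.N q)
  inj : ∀ q, T q → ∀ i i', i ≤ A.N q → i' ≤ A.N q → A.vt q i = A.vt q i' → i = i'
  w_nonneg : ∀ a b, 0 ≤ A.w a b
  lip : ∀ q, T q → ∀ j i, i < A.N q → A.lev j (A.vt q (i + 1)) - A.lev j (A.vt q i) ≤ A.ew q i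
  w_le : ∀ q, T q → ∀ i < A.N q, A.ew q i ≤ w₀
  w_le_in : ∀ q, T q → ∀ i < A.N q, A.ew q i ≤ Φin (A.vt q (i + 1))
  w_le_out : ∀ q, T q → ∀ i < A.N q, A.ew q i ≤ Φout (A.vt q i)
  -- Vertices met in opposite orders by two tracks lie on a common closed walk, so the low diameter
  -- decomposition makes their levels nearly equal.
  order : ∀ p q, T p → T q → ∀ i i' k k', i < i' → i' ≤ A.N p → k < k' → k' ≤ A.N q →
    A.vt p i = A.vt q k' → A.vt p i' = A.vt q k →
    ∀ j, A.lev j (A.vt p i') - A.lev j (A.vt p i) ≤ w₀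
  in_nonneg : ∀ v, 0 ≤ Φin v
  out_nonneg : ∀ v, 0 ≤ Φout v
  sum_in : ∑ v, Φin v ≤ Φ
  sum_out : ∑ v, Φout v ≤ Φ

theorem ew_rev {q : Q} {i : ℕ} (hi : i < A.N q) : A.rev.ew q i = A.ew q (A.N q - 1 - i) := by
  simp only [ew, rev]
  rw [show A.N q - 1 - i + 1 = A.N q - i by omega, show A.N q - (i + 1) = A.N q - 1 - i by omega]

theorem len_rev (q : Q) : A.rev.len q (A.N q) = A.len q (A.N q) := by
  unfold len
  rw [← Finset.sum_range_reflect (A.ew q)]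
  exact Finset.sum_congr rfl fun i hi => A.ew_rev (Finset.mem_range.1 hi)

namespace Good

variable {A} [Fintype V] {T : Q → Prop} {D : J → Q → Prop} {w₀ Φ : ℝ} {Φin Φout : V → ℝ}

/-- The hypotheses are symmetric under reversal, with the in- and out-volumes exchanged, so every
estimate below is available in both directions. -/
theorem reverse (h : A.Good T D w₀ Φ Φin Φout) : A.rev.Good T D w₀ Φ Φout Φin where
  L_pos := h.L_pos
  L_le := h.L_le
  w₀_pos := h.w₀_pos
  w₀_le := h.w₀_le
  D_T := h.D_T
  D_start j q hq := by
    simp only [rev, Nat.sub_zero, h.D_end j q hq, sub_self]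
  D_end j q hq := by
    simp only [rev, Nat.sub_self, h.D_start j q hq, sub_zero]
  D_len j q hq := (h.D_len j q hq).trans (A.len_rev q).ge
  inj q hq i i' hi hi' hv := by
    have hi1 : i ≤ A.N q := hi
    have hi2 : i' ≤ A.N q := hi'
    have := h.inj q hq _ _ (Nat.sub_le _ _) (Nat.sub_le _ _) hv
    omega
  w_nonneg a b := h.w_nonneg b a
  lip q hq j i hi := by
    have hi' : i < A.N q := hi
    rw [A.ew_rev hi']
    have := h.lip q hq j (A.N q - 1 - i) (by omega)
    rw [show A.N q - 1 - i + 1 = A.N q - i by omega] at this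
    simp only [rev]
    rw [show A.N q - (i + 1) = A.N q - 1 - i by omega]
    linarith
  w_le q hq i hi := by
    have hi' : i < A.N q := hi
    rw [A.ew_rev hi']
    exact h.w_le q hq _ (by omega)
  w_le_in q hq i hi := by
    have hi' : i < A.N q := hi
    rw [A.ew_rev hi']
    simp only [rev]
    rw [show A.N q - (i + 1) = A.N q - 1 - i by omega]
    exact h.w_le_out q hq _ (by omega)
  w_le_out q hq i hi := by
    have hi' : i < A.N q := hi
    rw [A.ew_rev hi']
    have := h.w_le_in q hq (A.N q - 1 - i) (by omega)
    rwa [show A.N q - 1 - i + 1 = A.N q - i by omega] at this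
  order p q hp hq i i' k k' hi hi' hk hk' h1 h2 j := by
    have hi1 : i' ≤ A.N p := hi'
    have hk1 : k' ≤ A.N q := hk'
    have := h.order p q hp hq (A.N p - i') (A.N p - i) (A.N q - k') (A.N q - k) (by omega)
      (by omega) (by omega) (by omega) h2 h1 j
    simp only [rev]
    linarith
  in_nonneg := h.out_nonneg
  out_nonneg := h.in_nonneg
  sum_in := h.sum_out
  sum_out := h.sum_in

theorem ew_nonneg (h : A.Good T D w₀ Φ Φin Φout) (q : Q) (i : ℕ) : 0 ≤ A.ew q i := h.w_nonneg _ _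

theorem len_mono (h : A.Good T D w₀ Φ Φin Φout) (q : Q) : Monotone (A.len q) :=
  monotone_nat_of_le_succ fun i => by
    rw [len, len, Finset.sum_range_succ]
    linarith [h.ew_nonneg q i]

theorem len_nonneg (h : A.Good T D w₀ Φ Φin Φout) (q : Q) (i : ℕ) : 0 ≤ A.len q i :=
  Finset.sum_nonneg fun i _ => h.ew_nonneg q i

theorem slope_nonneg (h : A.Good T D w₀ Φ Φin Φout) (q : Q) :
    0 ≤ A.L / (16 * A.len q (A.N q)) :=
  div_nonneg h.L_pos.le (mul_nonneg (by norm_num) (h.len_nonneg q _))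

theorem xi_nonneg (j : J) (q : Q) (i : ℕ) : 0 ≤ A.xi j q i := record_nonneg i

theorem xi_le (h : A.Good T D w₀ Φ Φin Φout) {q : Q} (hq : T q) (j : J) {i : ℕ} (hi : i < A.N q) :
    A.xi j q i ≤ A.ew q i :=
  record_le (h.ew_nonneg q i) (h.slope_nonneg q) (h.len_mono q (Nat.le_succ i)) (h.lip q hq j i hi)

/-- The corrected level starts at 0 and ends at `L - L / 16`, beyond the cap, so the capped running
maximum gains exactly `L / 4`. -/
theorem sum_xi (h : A.Good T D w₀ Φ Φin Φout) {j : J} {q : Q} (hq : D j q) :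
    ∑ i ∈ Finset.range (A.N q), A.xi j q i = A.L / 4 := by
  have hL := h.L_pos
  have hlen := h.D_len j q hq
  have hlen0 : 0 < A.len q (A.N q) := by linarith
  unfold xi
  rw [sum_record, h.D_start j q hq]
  have h1 : A.L / 4 ≤ partialSups (fun k => A.lev j (A.vt q k) -
      A.L / (16 * A.len q (A.N q)) * A.len q k) (A.N q) := by
    refine le_trans ?_ (le_partialSups _ _)
    rw [h.D_end j q hq]
    have : A.L / (16 * A.len q (A.N q)) * A.len q (A.N q) = A.L / 16 := by field_simp
    rw [this]; linarith
  rw [min_eq_right h1]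
  have h2 : A.len q 0 = 0 := by simp [len]
  rw [h2, mul_zero, sub_zero, min_eq_left (by linarith), sub_zero]

theorem slope_mul_le (h : A.Good T D w₀ Φ Φin Φout) {j : J} {q : Q} (hq : D j q) {i : ℕ}
    (hi : i ≤ A.N q) : A.L / (16 * A.len q (A.N q)) * A.len q i ≤ A.L / 16 := by
  have hlen := h.D_len j q hq
  have h1 := mul_le_mul_of_nonneg_left (h.len_mono q hi) (h.slope_nonneg q)
  refine h1.trans (le_of_eq ?_)
  have : A.len q (A.N q) ≠ 0 := by linarith
  field_simp

/-- Early record heights lie low. -/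
theorem lev_le_of_xi_pos (h : A.Good T D w₀ Φ Φin Φout) {j : J} {q : Q} (hq : D j q) {i : ℕ}
    (hi : i < A.N q) (hx : 0 < A.xi j q i) : A.lev j (A.vt q (i + 1)) ≤ 6 * A.L / 16 := by
  have h1 := (lt_of_record_pos hx (le_refl i)).1
  have h2 := h.slope_mul_le hq hi.le
  have h3 := h.lip q (h.D_T j q hq) j i hi
  have h4 := h.w_le q (h.D_T j q hq) i hi
  have h5 := h.w₀_le
  linarith

theorem lt_of_late (h : A.Good T D w₀ Φ Φin Φout) {j : J} {q : Q} (hq : D j q) {i k : ℕ}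
    (hk : k < A.N q) (hx : 0 < A.xi j q i) (hl : 7 * A.L / 16 ≤ A.lev j (A.vt q k)) :
    i < k := by
  by_contra hc
  have h1 := (lt_of_record_pos hx (not_lt.1 hc)).1
  have h2 := h.slope_mul_le hq hk.le
  have h3 := h.L_pos
  linarith

/-- Between two visited records the level climbs proportionally to any other level. -/
theorem climb (h : A.Good T D w₀ Φ Φin Φout) {j : J} {q : Q} (hq : D j q) {i k : ℕ}
    (hik : i ≤ k) (hk : k < A.N q) (hx : 0 < A.xi j q k) (j' : J) :
    A.L * (A.lev j' (A.vt q (k + 1)) - A.lev j' (A.vt q i)) ≤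
      16 * A.len q (A.N q) * (A.lev j (A.vt q (k + 1)) - A.lev j (A.vt q i)) := by
  have h1 := (lt_of_record_pos hx hik).2
  have hlen := h.D_len j q hq
  have hlen0 : 0 < A.len q (A.N q) := by linarith
  have h2 : ∀ n, i ≤ n → n ≤ A.N q →
      A.lev j' (A.vt q n) - A.lev j' (A.vt q i) ≤ A.len q n - A.len q i := by
    intro n hn
    induction hn with
    | refl => intro _; simp
    | @step n hn ih =>
      intro hN
      have h3 := ih (by omega)
      have h4 := h.lip q (h.D_T j q hq) j' n (by omega)
      have h5 : A.len q (n + 1) = A.len q n + A.ew q n := Finset.sum_range_succ _ _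
      rw [Nat.succ_eq_add_one]
      linarith
  have h3 := h2 (k + 1) (by omega) (by omega)
  have h4 : A.L / (16 * A.len q (A.N q)) * (A.len q (k + 1) - A.len q i) ≤
      A.lev j (A.vt q (k + 1)) - A.lev j (A.vt q i) := by linarith
  rw [div_mul_eq_mul_div, div_le_iff₀ (by positivity)] at h4
  have h5 := mul_le_mul_of_nonneg_left h3 h.L_pos.le
  linarith

variable [DecidableEq V]

theorem early_nonneg {x : V → V → ℝ} (hx : ∀ a b, 0 ≤ x a b) (j : J) (q : Q) (a : V) :
    0 ≤ A.early x j q a :=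
  Finset.sum_nonneg fun i _ => by
    split_ifs
    exacts [mul_nonneg (xi_nonneg _ _ _) (hx _ _), le_rfl]

theorem late_nonneg (h : A.Good T D w₀ Φ Φin Φout) {x : V → V → ℝ} (hx : ∀ a b, 0 ≤ x a b) (j : J)
    (q : Q) (b : V) : 0 ≤ A.late x j q b :=
  Finset.sum_nonneg fun i _ => by
    split_ifs
    exacts [mul_nonneg (h.ew_nonneg _ _) (hx _ _), le_rfl]

theorem exists_of_early_pos {x : V → V → ℝ} {j : J} {q : Q} {a : V} (h : 0 < A.early x j q a) :
    ∃ i < A.N q, A.vt q (i + 1) = a ∧ 0 < A.xi j q i := by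
  by_contra! hc
  refine absurd h (not_lt.2 (Finset.sum_nonpos fun i hi => ?_))
  split_ifs with ha
  · have h1 : A.xi j q i = 0 :=
      le_antisymm (hc i (Finset.mem_range.1 hi) ha) (xi_nonneg _ _ _)
    rw [h1, zero_mul]
  · exact le_rfl

theorem exists_of_late_pos {x : V → V → ℝ} {j : J} {q : Q} {b : V} (h : 0 < A.late x j q b) :
    ∃ i < A.N q, A.vt q i = b ∧ 7 * A.L / 16 ≤ A.lev j (A.vt q i) := by
  by_contra! hc
  refine absurd h (not_lt.2 (Finset.sum_nonpos fun i hi => ?_))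
  split_ifs with ha
  · exact absurd ha.2 (not_le.2 (hc i (Finset.mem_range.1 hi) ha.1))
  · exact le_rfl

theorem early_le_sum (h : A.Good T D w₀ Φ Φin Φout) {x : V → V → ℝ} (hx : ∀ a b, 0 ≤ x a b) {j : J}
    {q : Q} (hq : T q) (a : V) : A.early x j q a ≤ ∑ i ∈ Finset.range (A.N q),
      if A.vt q (i + 1) = a then A.ew q i * x (A.vt q i) (A.vt q (i + 1)) else 0 := by
  refine Finset.sum_le_sum fun i hi => ?_
  split_ifs
  · exact mul_le_mul_of_nonneg_right (h.xi_le hq j (Finset.mem_range.1 hi)) (hx _ _)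
  · exact le_rfl

theorem late_le_sum (h : A.Good T D w₀ Φ Φin Φout) {x : V → V → ℝ} (hx : ∀ a b, 0 ≤ x a b) (j : J)
    (q : Q) (b : V) : A.late x j q b ≤ ∑ i ∈ Finset.range (A.N q),
      if A.vt q i = b then A.ew q i * x (A.vt q i) (A.vt q (i + 1)) else 0 := by
  refine Finset.sum_le_sum fun i hi => ?_
  have := mul_nonneg (h.ew_nonneg q i) (hx (A.vt q i) (A.vt q (i + 1)))
  split_ifs with h1 h2 h2
  · exact le_rfl
  · exact absurd h1.1 h2
  · exact this
  · exact le_rfl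

theorem early_le (h : A.Good T D w₀ Φ Φin Φout) {x : V → V → ℝ} (hx : ∀ a b, 0 ≤ x a b)
    (hx1 : ∀ a b, x a b ≤ 1) {j : J} {q : Q} (hq : T q) (a : V) : A.early x j q a ≤ Φin a := by
  refine (h.early_le_sum hx hq a).trans ?_
  by_cases hex : ∃ i < A.N q, A.vt q (i + 1) = a
  · obtain ⟨i, hi, hia⟩ := hex
    rw [Finset.sum_eq_single_of_mem i (Finset.mem_range.2 hi), if_pos hia]
    · rw [← hia]
      exact (mul_le_of_le_one_right (h.ew_nonneg q i) (hx1 _ _)).trans (h.w_le_in q hq i hi)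
    · intro k hk hki
      refine if_neg fun hka => hki ?_
      have := h.inj q hq (k + 1) (i + 1) (by have := Finset.mem_range.1 hk; omega) (by omega)
        (hka.trans hia.symm)
      omega
  · push Not at hex
    rw [Finset.sum_eq_zero fun i hi => if_neg (hex i (Finset.mem_range.1 hi))]
    exact h.in_nonneg a

theorem late_le (h : A.Good T D w₀ Φ Φin Φout) {x : V → V → ℝ} (hx : ∀ a b, 0 ≤ x a b)
    (hx1 : ∀ a b, x a b ≤ 1) {j : J} {q : Q} (hq : T q) (b : V) : A.late x j q b ≤ Φout b := by
  refine (h.late_le_sum hx j q b).trans ?_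
  by_cases hex : ∃ i < A.N q, A.vt q i = b
  · obtain ⟨i, hi, hia⟩ := hex
    rw [Finset.sum_eq_single_of_mem i (Finset.mem_range.2 hi), if_pos hia]
    · rw [← hia]
      exact (mul_le_of_le_one_right (h.ew_nonneg q i) (hx1 _ _)).trans (h.w_le_out q hq i hi)
    · intro k hk hki
      refine if_neg fun hka => hki ?_
      exact h.inj q hq k i (by have := Finset.mem_range.1 hk; omega) (by omega)
        (hka.trans hia.symm)
  · push Not at hex
    rw [Finset.sum_eq_zero fun i hi => if_neg (hex i (Finset.mem_range.1 hi))]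
    exact h.out_nonneg b

theorem sum_late_le (h : A.Good T D w₀ Φ Φin Φout) {x : V → V → ℝ} (hx : ∀ a b, 0 ≤ x a b)
    (hx1 : ∀ a b, x a b ≤ 1) (j : J) (q : Q) : ∑ b, A.late x j q b ≤ A.len q (A.N q) := by
  refine (Finset.sum_le_sum fun b _ => h.late_le_sum hx j q b).trans ?_
  rw [Finset.sum_comm]
  refine Finset.sum_le_sum fun i _ => ?_
  rw [Finset.sum_ite_eq]
  simp only [Finset.mem_univ, if_true]
  exact mul_le_of_le_one_right (h.ew_nonneg q i) (hx1 _ _)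

theorem gap (h : A.Good T D w₀ Φ Φin Φout) {x : V → V → ℝ} {j : J} {q : Q} (hq : D j q) {a b : V}
    (ha : 0 < A.early x j q a) (hb : 0 < A.late x j q b) :
    A.L / 16 ≤ A.lev j b - A.lev j a := by
  obtain ⟨i, hi, rfl, hxi⟩ := exists_of_early_pos ha
  obtain ⟨k, hk, rfl, hl⟩ := exists_of_late_pos hb
  have := h.lev_le_of_xi_pos hq hi hxi
  linarith

end Good

end TrackSystem

end DirectedCut

/-! ### From an unsaturated mixture of strategies to a set of used vertices -/

namespace DirectedCut

namespace TrackSystem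

variable {V Q J : Type*} (A : TrackSystem V Q J)

/-- The climb from `a` to `b`, averaged over weighted levels. -/
noncomputable def avg {S : Type*} [Fintype S] (js : S → J) (σ : S → ℝ) (a b : V) : ℝ :=
  ∑ s, σ s * max (A.lev (js s) b - A.lev (js s) a) 0

namespace Good

variable {A} [Fintype V] [DecidableEq V] [Fintype Q] {T : Q → Prop} {D : J → Q → Prop}
  {w₀ Φ : ℝ} {Φin Φout : V → ℝ}

open Classical in
/-- The hypotheses under which a mixture of strategies is turned into a set of used vertices. -/
structure Mixture (A : TrackSystem V Q J) (D : J → Q → Prop) (Φin Φout : V → ℝ) (m : ℝ)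
    {S : Type*} [Fintype S] (js : S → J) (σ : S → ℝ) (f : S → Q → ℝ) (x : S → V → V → ℝ) :
    Prop where
  σ_nonneg : ∀ s, 0 ≤ σ s
  sum_σ : ∑ s, σ s = 1
  f_nonneg : ∀ s q, 0 ≤ f s q
  supp : ∀ s q, 0 < f s q → D (js s) q
  x_nonneg : ∀ s a b, 0 ≤ x s a b
  x_le : ∀ s a b, x s a b ≤ 1
  flow_in : ∀ s a, m * ∑ q, f s q * ∑ i ∈ Finset.range (A.N q), (if A.vt q (i + 1) = a then
    A.ew q i * x s (A.vt q i) (A.vt q (i + 1)) else 0) ≤ Φin a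
  flow_out : ∀ s a, m * ∑ q, f s q * ∑ i ∈ Finset.range (A.N q), (if A.vt q i = a then
    A.ew q i * x s (A.vt q i) (A.vt q (i + 1)) else 0) ≤ Φout a

/-- The indicator of the pairs on which the payoff is not yet saturated. -/
noncomputable def unsat (Lf : V → V → ℝ) (cap : ℝ) (U : Finset V) (a b : V) : ℝ :=
  open Classical in if a ∉ U ∧ Lf a b < cap then 1 else 0

theorem unsat_nonneg (Lf : V → V → ℝ) (cap : ℝ) (U : Finset V) (a b : V) :
    0 ≤ unsat Lf cap U a b := by unfold unsat; split_ifs <;> norm_num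

theorem unsat_le_one (Lf : V → V → ℝ) (cap : ℝ) (U : Finset V) (a b : V) :
    unsat Lf cap U a b ≤ 1 := by unfold unsat; split_ifs <;> norm_num

/-- A dyadic pigeonhole. -/
theorem exists_dense_level {ι : Type*} [Fintype ι] (P t : ι → ℝ) {m Φ Z : ℝ}
    (hm : 0 < m) (hΦ : 0 < Φ) (hZ : 0 < Z) (hP : ∀ y, 0 ≤ P y) (hPsum : ∑ y, P y ≤ Φ)
    (ht : ∀ y, m * t y ≤ P y) (hsum : Z ≤ ∑ y, t y) {K : ℕ}
    (hK : (1 / 2 : ℝ) ^ K < Z * m / (2 * Φ)) :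
    ∃ κ, Z * m / (2 * Φ) ≤ κ ∧
      m * (Z / (2 * K)) ≤ 2 * κ * ∑ y with κ * P y ≤ m * t y ∧ 0 < t y, P y := by
  classical
  set κ₀ := Z * m / (2 * Φ) with hκ₀
  have hκ₀pos : 0 < κ₀ := by positivity
  -- The vertices are grouped by the dyadic size of `m * t y / P y`, truncated at `κ₀`. Ratios below
  -- `κ₀` account for at most half of `Z` because `κ₀ * Φ = Z * m / 2`, and ratios above it fall
  -- into `K` classes.
  let κ : ℕ → ℝ := fun h => max ((1 / 2) ^ (h + 1)) κ₀
  by_contra! hcon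
  have h1 : ∀ h, 2 * κ h * ∑ y with κ h * P y ≤ m * t y ∧ 0 < t y, P y < m * (Z / (2 * K)) :=
    fun h => hcon (κ h) (le_max_right _ _)
  have hcover : ∀ y, m * t y ≤ κ₀ * P y + ∑ h ∈ Finset.range K,
      (if κ h * P y ≤ m * t y ∧ 0 < t y then 2 * κ h * P y else 0) := by
    intro y
    have hnn : ∀ h ∈ Finset.range K,
        0 ≤ (if κ h * P y ≤ m * t y ∧ 0 < t y then 2 * κ h * P y else 0) := by
      intro h _
      have : 0 ≤ κ h := hκ₀pos.le.trans (le_max_right _ _)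
      have := hP y
      split_ifs <;> positivity
    rcases le_total (m * t y) (κ₀ * P y) with hle | hle
    · exact hle.trans (le_add_of_nonneg_right (Finset.sum_nonneg hnn))
    rcases (hP y).eq_or_lt with h0 | h0
    · have := ht y
      rw [← h0] at this ⊢
      simpa using this
    have hx1 : m * t y / P y ≤ 1 := div_le_one_of_le₀ (ht y) (hP y)
    have hx0 : κ₀ ≤ m * t y / P y := by rwa [le_div_iff₀ h0]
    have htpos : 0 < t y := by
      have : 0 < m * t y := lt_of_lt_of_le (by positivity) hle
      exact pos_of_mul_pos_right this hm.le
    obtain ⟨n, hn1, hn2⟩ := exists_nat_pow_near_of_lt_one (hκ₀pos.trans_le hx0) hx1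
      (by norm_num : (0 : ℝ) < 1 / 2) (by norm_num)
    have hnK : n < K := by
      by_contra hc
      have : (1 / 2 : ℝ) ^ n ≤ (1 / 2) ^ K :=
        pow_le_pow_of_le_one (by norm_num) (by norm_num) (not_lt.1 hc)
      linarith
    have hκn : κ n * P y ≤ m * t y := by
      rw [← le_div_iff₀ h0]
      exact max_le hn1.le hx0
    refine le_trans ?_ (le_add_of_nonneg_of_le (by positivity)
      (Finset.single_le_sum hnn (Finset.mem_range.2 hnK)))
    rw [if_pos ⟨hκn, htpos⟩]
    have h3 : m * t y ≤ (1 / 2) ^ n * P y := (div_le_iff₀ h0).1 hn2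
    have h4 : (1 / 2 : ℝ) ^ n ≤ 2 * κ n := by
      have : (1 / 2 : ℝ) ^ (n + 1) ≤ κ n := le_max_left _ _
      rw [pow_succ] at this
      linarith
    exact h3.trans (mul_le_mul_of_nonneg_right h4 (hP y))
  have hKpos : 0 < K := by
    rcases Nat.eq_zero_or_pos K with rfl | h
    · have h2 : m * ∑ y, t y ≤ κ₀ * ∑ y, P y := by
        rw [Finset.mul_sum, Finset.mul_sum]
        exact Finset.sum_le_sum fun y _ => by simpa using hcover y
      have h3 := mul_le_mul_of_nonneg_left hPsum hκ₀pos.le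
      have h4 := mul_le_mul_of_nonneg_left hsum hm.le
      have h5 : κ₀ * Φ = Z * m / 2 := by rw [hκ₀]; field_simp
      nlinarith
    · exact h
  have hKr : (0 : ℝ) < K := by exact_mod_cast hKpos
  have htot : m * ∑ y, t y ≤ κ₀ * ∑ y, P y + ∑ h ∈ Finset.range K,
      2 * κ h * ∑ y with κ h * P y ≤ m * t y ∧ 0 < t y, P y := by
    have : ∑ h ∈ Finset.range K, 2 * κ h * ∑ y with κ h * P y ≤ m * t y ∧ 0 < t y, P y =
        ∑ y, ∑ h ∈ Finset.range K,
          (if κ h * P y ≤ m * t y ∧ 0 < t y then 2 * κ h * P y else 0) := by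
      rw [Finset.sum_comm]
      refine Finset.sum_congr rfl fun h _ => ?_
      rw [Finset.sum_filter, Finset.mul_sum]
      exact Finset.sum_congr rfl fun y _ => by rw [mul_ite, mul_zero]
    rw [this, Finset.mul_sum, Finset.mul_sum, ← Finset.sum_add_distrib]
    exact Finset.sum_le_sum fun y _ => hcover y
  have hlt : ∑ h ∈ Finset.range K, 2 * κ h * ∑ y with κ h * P y ≤ m * t y ∧ 0 < t y, P y <
      ∑ h ∈ Finset.range K, m * (Z / (2 * K)) :=
    Finset.sum_lt_sum_of_nonempty ⟨0, Finset.mem_range.2 hKpos⟩ fun h _ => h1 h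
  rw [Finset.sum_const, Finset.card_range, nsmul_eq_mul] at hlt
  have h3 := mul_le_mul_of_nonneg_left hPsum hκ₀pos.le
  have h4 := mul_le_mul_of_nonneg_left hsum hm.le
  have h5 : κ₀ * Φ = Z * m / 2 := by rw [hκ₀]; field_simp
  have h6 : (K : ℝ) * (m * (Z / (2 * K))) = m * Z / 2 := by field_simp
  linarith

/-- If a mixture of strategies leaves much payoff unsaturated then there is a set `Y` of unused
vertices at which every surviving demand track has few records. -/
theorem exists_used_set (h : A.Good T D w₀ Φ Φin Φout) {S : Type*} [Fintype S] {js : S → J}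
    {σ : S → ℝ} {f : S → Q → ℝ} {x : S → V → V → ℝ} {m : ℝ} (hm : 0 < m)
    (hmix : Mixture A D Φin Φout m js σ f x) (U : Finset V) {γ Z Λ : ℝ} (hγ : 0 < γ)
    (hΦ : Φ = γ ^ 2) (hZ : 0 < Z) (hΛ : 1 ≤ Λ)
    (hbig : Z ≤ ∑ s, ∑ q, ∑ a, ∑ b, σ s * f s q * A.early (x s) (js s) q a *
      (A.late (x s) (js s) q b / A.len q (A.N q)) *
      unsat (A.avg js σ) (m / γ ^ 3) U a b)
    {K : ℕ} (hK : (1 / 2 : ℝ) ^ K < Z * m / (2 * Φ)) (hKΛ : K ≤ Λ)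
    (hlog : 1 + Real.log (1 / w₀) ≤ Λ)
    (hw₀ : w₀ ≤ (A.L / 16) ^ 2 * (Z / (2 * Λ)) / γ / 120) :
    ∃ κ > 0, ∃ Y : Finset V, Disjoint Y U ∧ m * (Z / (2 * Λ)) ≤ 2 * κ * ∑ y ∈ Y, Φin y ∧
      ∀ j q, D j q → (∀ i i', i < i' → i' ≤ A.N q → A.avg js σ (A.vt q i) (A.vt q i') ≤
        κ * A.L * ((A.L / 16) ^ 2 * (Z / (2 * Λ)) / γ) / (5120 * Λ)) →
        A.mass j q Y ≤ A.L / 16 * ((∑ y ∈ Y, Φin y) / Φ) := by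
  classical
  have hL := h.L_pos
  have hL1 := h.L_le
  have hw₀pos := h.w₀_pos
  have hΦ0 : 0 < Φ := by rw [hΦ]; positivity
  have hΛ0 : 0 < Λ := by linarith
  have hcap : 0 < m / γ ^ 3 := by positivity
  let χ := unsat (A.avg js σ) (m / γ ^ 3) U
  have hχ0 : ∀ a b, 0 ≤ χ a b := unsat_nonneg _ _ _
  have hχ1 : ∀ a b, χ a b ≤ 1 := unsat_le_one _ _ _
  let t : V → ℝ := fun a => ∑ s, ∑ q, ∑ b, σ s * f s q * A.early (x s) (js s) q a *
      (A.late (x s) (js s) q b / A.len q (A.N q)) * χ a b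
  have he0 : ∀ s q a, 0 ≤ A.early (x s) (js s) q a := fun s q a =>
    early_nonneg (hmix.x_nonneg s) _ _ _
  have hl0 : ∀ s q b, 0 ≤ A.late (x s) (js s) q b := fun s q b =>
    h.late_nonneg (hmix.x_nonneg s) _ _ _
  have hflow_in : ∀ s a, m * ∑ q, f s q * A.early (x s) (js s) q a ≤ Φin a := by
    intro s a
    refine le_trans (mul_le_mul_of_nonneg_left (Finset.sum_le_sum fun q _ => ?_) hm.le)
      (hmix.flow_in s a)
    rcases (hmix.f_nonneg s q).eq_or_lt with h0 | h0
    · rw [← h0, zero_mul, zero_mul]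
    · exact mul_le_mul_of_nonneg_left (h.early_le_sum (hmix.x_nonneg s)
        (h.D_T _ _ (hmix.supp s q h0)) a) h0.le
  have hflow_out : ∀ s a, m * ∑ q, f s q * A.late (x s) (js s) q a ≤ Φout a := by
    intro s a
    refine le_trans (mul_le_mul_of_nonneg_left (Finset.sum_le_sum fun q _ => ?_) hm.le)
      (hmix.flow_out s a)
    exact mul_le_mul_of_nonneg_left (h.late_le_sum (hmix.x_nonneg s) _ _ a) (hmix.f_nonneg s q)
  have htle : ∀ a, m * t a ≤ Φin a := by
    intro a
    have h1 : t a ≤ ∑ s, σ s * ∑ q, f s q * A.early (x s) (js s) q a := by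
      refine Finset.sum_le_sum fun s _ => ?_
      rw [Finset.mul_sum]
      refine Finset.sum_le_sum fun q _ => ?_
      rcases (hmix.f_nonneg s q).eq_or_lt with h0 | h0
      · simp [← h0]
      have hlen := h.D_len _ _ (hmix.supp s q h0)
      have hc : 0 ≤ σ s * f s q * A.early (x s) (js s) q a :=
        mul_nonneg (mul_nonneg (hmix.σ_nonneg s) h0.le) (he0 _ _ _)
      calc _ ≤ ∑ b, σ s * f s q * A.early (x s) (js s) q a *
            (A.late (x s) (js s) q b / A.len q (A.N q)) :=
            Finset.sum_le_sum fun b _ => mul_le_of_le_one_right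
              (mul_nonneg hc (div_nonneg (hl0 _ _ _) (by linarith))) (hχ1 _ _)
        _ ≤ σ s * f s q * A.early (x s) (js s) q a := by
            rw [← Finset.mul_sum, ← Finset.sum_div]
            exact mul_le_of_le_one_right hc (div_le_one_of_le₀
              (h.sum_late_le (hmix.x_nonneg s) (hmix.x_le s) _ _) (by linarith))
        _ = _ := by ring
    calc m * t a ≤ m * ∑ s, σ s * ∑ q, f s q * A.early (x s) (js s) q a :=
          mul_le_mul_of_nonneg_left h1 hm.le
      _ = ∑ s, σ s * (m * ∑ q, f s q * A.early (x s) (js s) q a) := by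
          rw [Finset.mul_sum]
          exact Finset.sum_congr rfl fun s _ => by ring
      _ ≤ ∑ s, σ s * Φin a := Finset.sum_le_sum fun s _ =>
          mul_le_mul_of_nonneg_left (hflow_in s a) (hmix.σ_nonneg s)
      _ = Φin a := by rw [← Finset.sum_mul, hmix.sum_σ, one_mul]
  have hZt : Z ≤ ∑ a, t a := by
    refine hbig.trans (le_of_eq ?_)
    simp only [t]
    rw [Finset.sum_comm (s := Finset.univ (α := V))]
    refine Finset.sum_congr rfl fun s _ => ?_
    rw [Finset.sum_comm]
  obtain ⟨κ, hκ, hκY⟩ := exists_dense_level Φin t hm hΦ0 hZ h.in_nonneg h.sum_in htle hZt hK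
  have hκ0 : 0 < κ := lt_of_lt_of_le (by positivity) hκ
  set Y : Finset V := Finset.univ.filter fun y => κ * Φin y ≤ m * t y ∧ 0 < t y with hY
  have hKpos : (0 : ℝ) < K := by
    rcases Nat.eq_zero_or_pos K with rfl | h0
    · exfalso
      have h1 : m * ∑ y, t y ≤ ∑ y, Φin y := by
        rw [Finset.mul_sum]; exact Finset.sum_le_sum fun y _ => htle y
      have h2 := mul_le_mul_of_nonneg_left hZt hm.le
      have h3 := h.sum_in
      rw [pow_zero, lt_div_iff₀ (by positivity)] at hK
      nlinarith
    · exact_mod_cast h0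
  have hκY' : m * (Z / (2 * Λ)) ≤ 2 * κ * ∑ y ∈ Y, Φin y :=
    le_trans (by gcongr) hκY
  refine ⟨κ, hκ0, Y, ?_, hκY', ?_⟩
  · refine Finset.disjoint_left.2 fun y hy hyU => ?_
    have : t y = 0 := by
      refine Finset.sum_eq_zero fun s _ => Finset.sum_eq_zero fun q _ => Finset.sum_eq_zero
        fun b _ => ?_
      have : χ y b = 0 := if_neg fun hc => hc.1 hyU
      rw [this, mul_zero]
    have := (Finset.mem_filter.1 hy).2.2
    linarith
  intro j p hp halive
  set Gm := (A.L / 16) ^ 2 * (Z / (2 * Λ)) / γ with hGm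
  have hGmpos : 0 < Gm := by positivity
  have hpT := h.D_T j p hp
  have hlenp := h.D_len j p hp
  let a : ℕ → ℝ := fun i => if i < A.N p ∧ A.vt p (i + 1) ∈ Y then A.xi j p i else 0
  have ha0 : ∀ i, 0 ≤ a i := fun i => by
    simp only [a]; split_ifs
    exacts [xi_nonneg _ _ _, le_rfl]
  have hale : ∀ i, a i ≤ A.xi j p i := fun i => by
    simp only [a]; split_ifs
    exacts [le_rfl, xi_nonneg _ _ _]
  have hapos : ∀ i, 0 < a i → (i < A.N p ∧ A.vt p (i + 1) ∈ Y) ∧ 0 < A.xi j p i := by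
    intro i hi
    refine ⟨?_, hi.trans_le (hale i)⟩
    by_contra hc
    simp only [a, if_neg hc, lt_irrefl] at hi
  have hw1 : w₀ ≤ 1 := by have := h.w₀_le; linarith
  -- The sequence is a surviving demand track `p` with its records at `Y` as masses; records sit at
  -- heads of steps, hence the shift `i + 1`. With `T = Gm / 10` and `cap₀ = m / γ ^ 3`, the bound
  -- of `mass_le` is exactly `L / 16` times `m * (Z / (2 * Λ)) / (2 * κ * Φ)`.
  let C : Crossing S Q V :=
    { σ := σ
      k := fun s a b => max (A.lev (js s) b - A.lev (js s) a) 0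
      f := f
      y := fun s q => A.early (x s) (js s) q
      r := fun s q => A.late (x s) (js s) q
      Wt := fun s q => A.len q (A.N q)
      χ := χ
      Φy := Φin
      Φb := Φout
      v := fun i => A.vt p (i + 1)
      a := a
      n := A.N p
      m := m
      Φ := Φ
      cap₀ := m / γ ^ 3
      capN := κ * A.L * Gm / (5120 * Λ)
      κ := κ
      g₀ := A.L / 16
      w₀ := w₀
      D := w₀
      L := A.L
      T := Gm / 10
      σ_nonneg := hmix.σ_nonneg
      k_nonneg := fun s a b => le_max_right _ _
      k_self := fun s a => by simp
      k_tri := fun s a b c => by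
        rcases max_cases (A.lev (js s) c - A.lev (js s) a) 0 with ⟨h1, -⟩ | ⟨h1, -⟩ <;> rw [h1]
        · have := le_max_left (A.lev (js s) b - A.lev (js s) a) 0
          have := le_max_left (A.lev (js s) c - A.lev (js s) b) 0
          linarith
        · positivity
      f_nonneg := hmix.f_nonneg
      y_nonneg := he0
      r_nonneg := hl0
      Wt_one := fun s q hf => h.D_len _ _ (hmix.supp s q hf)
      χ_nonneg := hχ0
      χ_le := hχ1
      Φy_nonneg := h.in_nonneg
      Φb_nonneg := h.out_nonneg
      sum_Φb := h.sum_out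
      m_pos := hm
      Φ_pos := hΦ0
      cap₀_pos := hcap
      κ_pos := hκ0
      g₀_pos := by positivity
      D_pos := hw₀pos
      D_le := hw1
      L_pos := hL
      T_pos := by positivity
      capN_nonneg := by positivity
      sum_y := hflow_in
      sum_r := hflow_out
      sum_r' := fun s q _ => h.sum_late_le (hmix.x_nonneg s) (hmix.x_le s) _ _
      r_le := fun s q b hf => h.late_le (hmix.x_nonneg s) (hmix.x_le s)
        (h.D_T _ _ (hmix.supp s q hf)) b
      y_le := fun s q b hf => h.early_le (hmix.x_nonneg s) (hmix.x_le s)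
        (h.D_T _ _ (hmix.supp s q hf)) b
      cap := fun a b hab => by
        by_contra hc
        exact hab (if_neg fun h2 => hc h2.2.le)
      gap := fun s q a b hf hya hrb =>
        (h.gap (hmix.supp s q hf) hya hrb).trans (le_max_left _ _)
      a_nonneg := ha0
      a_le := fun i => by
        rcases (ha0 i).eq_or_lt with h0 | h0
        · rw [← h0]; exact hw₀pos.le
        · have := (hapos i h0).1.1
          exact (hale i).trans ((h.xi_le hpT j this).trans (h.w_le p hpT i this))
      sum_a := by
        refine (Finset.sum_le_sum fun i _ => hale i).trans ?_
        rw [h.sum_xi hp]; linarith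
      rich := fun i hi h0 => by
        obtain ⟨-, h1, h2⟩ := Finset.mem_filter.1 (hapos i h0).1.2
        exact ⟨lt_of_lt_of_le (by positivity) (htle _), h1⟩
      alive := fun i i' hii hi' => halive (i + 1) (i' + 1) (by omega) (by omega)
      -- Records bound the mass in between by the level difference along `p`. If `q` visited the two
      -- vertices in the opposite order, `order` would make that difference at most `w₀ = D`. So `q`
      -- visits them in the same order and `climb` applies.
      far := fun s q i i' hii hi' hai hai' hf hy hy' hD => by
        have hq := hmix.supp s q hf
        have hqT := h.D_T _ _ hq
        have hlenq := h.D_len _ _ hq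
        obtain ⟨k, hk, hkv, hkx⟩ := exists_of_early_pos hy
        obtain ⟨k', hk', hkv', hkx'⟩ := exists_of_early_pos hy'
        have hS : ∑ l ∈ Finset.Ico (i + 1) (i' + 1), a l ≤
            A.lev j (A.vt p (i' + 1)) - A.lev j (A.vt p (i + 1)) :=
          (Finset.sum_le_sum fun l _ => hale l).trans
            (sum_record_le (hapos i' hai').2 (by omega) (h.slope_nonneg p)
              (h.len_mono p (by omega)))
        have hkk : k < k' := by
          by_contra hc
          rcases (not_lt.1 hc).eq_or_lt with h1 | h1
          · rw [h1, hkv] at hkv'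
            rw [hkv'] at hS
            linarith
          · have := h.order p q hpT hqT (i + 1) (i' + 1) (k' + 1) (k + 1) (by omega) (by omega)
              (by omega) (by omega) hkv.symm hkv'.symm j
            linarith
        have hcl := h.climb hq (by omega : k + 1 ≤ k') hk' hkx' j
        rw [hkv, hkv'] at hcl
        calc _ ≤ A.L * (A.lev j (A.vt p (i' + 1)) - A.lev j (A.vt p (i + 1))) :=
              mul_le_mul_of_nonneg_left hS hL.le
          _ ≤ _ := hcl
          _ ≤ _ := mul_le_mul_of_nonneg_left (le_max_left _ _) (by linarith)
      T_near := by linarith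
      T_far := by
        rw [div_le_iff₀ (by positivity)]
        have e : 256 * (κ * A.L * Gm / (5120 * Λ)) * Λ = Gm / 20 * (κ * A.L) := by
          field_simp; norm_num
        have h1 : 256 * (κ * A.L * Gm / (5120 * Λ)) * (1 + Real.log (1 / w₀)) ≤
            256 * (κ * A.L * Gm / (5120 * Λ)) * Λ :=
          mul_le_mul_of_nonneg_left hlog (by positivity)
        have h2 : 0 < Gm * (κ * A.L) := by positivity
        linarith
      capN_le := by
        have h1 : κ * A.L * Gm / (5120 * Λ) ≤ κ * Gm := by
          rw [div_le_iff₀ (by positivity)]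
          have : κ * A.L * Gm ≤ κ * Gm * 1 := by nlinarith [mul_pos hκ0 hGmpos]
          have h3 : 0 < κ * Gm := by positivity
          nlinarith
        refine le_trans (b := κ * ((A.L / 16) ^ 2 * Z / (5120 * Λ * 2 * Λ * γ))) (le_of_eq_of_le
          (by rw [hGm]; field_simp : κ * A.L * Gm / (5120 * Λ) =
            A.L * (κ * ((A.L / 16) ^ 2 * Z / (5120 * Λ * 2 * Λ * γ))))
          (mul_le_of_le_one_left (by positivity) hL1)) ?_
        have h4 : κ ^ 2 * (A.L / 16) ^ 2 / (16 * Φ * (m / γ ^ 3)) =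
            κ * ((A.L / 16) ^ 2 * (κ * γ / (16 * m))) := by
          rw [hΦ]; field_simp
        rw [h4]
        refine mul_le_mul_of_nonneg_left ?_ hκ0.le
        rw [mul_div_assoc]
        refine mul_le_mul_of_nonneg_left ?_ (by positivity)
        -- This is where the lower bound on `κ` from the pigeonhole is needed: very sparse classes
        -- would violate `capN_le`.
        have h5 : Z / (32 * γ) ≤ κ * γ / (16 * m) := by
          rw [hΦ] at hκ
          rw [div_le_iff₀ (by positivity)] at hκ
          rw [div_le_div_iff₀ (by positivity) (by positivity)]
          nlinarith
        refine le_trans ?_ h5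
        refine div_le_div_of_nonneg_left hZ.le (by positivity) ?_
        have : 1 ≤ Λ * Λ := one_le_mul_of_one_le_of_one_le hΛ hΛ
        nlinarith }
  have hC := C.mass_le
  have hΘ : C.Θ = A.mass j p Y := by
    refine Finset.sum_congr rfl fun i hi => ?_
    have := Finset.mem_range.1 hi
    have hi' : i < A.N p := this
    simp only [C, a, hi', true_and]
  rw [← hΘ]
  refine hC.trans ?_
  have e : 5 * C.Φ * C.T * C.cap₀ / (C.κ * C.g₀) = A.L / 16 * (m * (Z / (2 * Λ)) / (2 * κ) / Φ) := by
    simp only [C]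
    rw [hGm, hΦ]
    field_simp
    norm_num
  rw [e]
  refine mul_le_mul_of_nonneg_left ?_ (by positivity)
  refine div_le_div_of_nonneg_right ?_ hΦ0.le
  rw [div_le_iff₀ (by positivity)]
  linarith

end Good

end TrackSystem

end DirectedCut

/-! ### The untruncated payoff of a strategy -/

namespace DirectedCut

namespace TrackSystem

variable {V Q J : Type*} (A : TrackSystem V Q J)

theorem avg_rev {S : Type*} [Fintype S] (js : S → J) (σ : S → ℝ) (a b : V) :
    A.rev.avg js σ a b = A.avg js σ b a := by
  simp only [avg, rev]
  refine Finset.sum_congr rfl fun s _ => ?_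
  congr 2
  ring

/-- All steps of the track lie in `E`. -/
def On (E : Finset (V × V)) (q : Q) : Prop :=
  ∀ i < A.N q, (A.vt q i, A.vt q (i + 1)) ∈ E

theorem On.mono {A : TrackSystem V Q J} {E E' : Finset (V × V)} (h : E ⊆ E') {q : Q}
    (hq : A.On E q) : A.On E' q := fun i hi => h (hq i hi)

theorem On.reach {A : TrackSystem V Q J} {E : Finset (V × V)} {q : Q} (hq : A.On E q) {i k : ℕ}
    (hik : i ≤ k) (hk : k ≤ A.N q) :
    Relation.ReflTransGen (fun a b => (a, b) ∈ E) (A.vt q i) (A.vt q k) := by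
  induction hik with
  | refl => exact Relation.ReflTransGen.refl
  | step _ ih => exact (ih (by omega)).tail (hq _ (by omega))

section

variable [DecidableEq V] [Fintype V] [Fintype Q]

/-- The contribution of the pair `(a, b)` to the payoff of a random track. -/
noncomputable def coef (x : V → V → ℝ) (j : J) (f : Q → ℝ) (U : Finset V) (a b : V) : ℝ :=
  if a ∈ U then 0 else ∑ q, f q * (A.early x j q a * (A.late x j q b / A.len q (A.N q)))

/-- The weight lost to `x`. -/
def loss (x : V → V → ℝ) (q : Q) : ℝ :=
  ∑ i ∈ Finset.range (A.N q), A.ew q i * (1 - x (A.vt q i) (A.vt q (i + 1)))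

end

namespace Good

variable {A} [Fintype V] [DecidableEq V] {T : Q → Prop} {D : J → Q → Prop}
  {w₀ Φ : ℝ} {Φin Φout : V → ℝ}

theorem sum_unused_early (x : V → V → ℝ) (j : J) (q : Q) (U : Finset V) :
    ∑ a ∈ Uᶜ, A.early x j q a = ∑ i ∈ Finset.range (A.N q),
      (if A.vt q (i + 1) ∈ U then 0 else A.xi j q i * x (A.vt q i) (A.vt q (i + 1))) := by
  simp only [early]
  rw [Finset.sum_comm]
  refine Finset.sum_congr rfl fun i _ => ?_
  rw [Finset.sum_ite_eq]
  simp only [Finset.mem_compl, ite_not]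

theorem le_sum_unused_early (h : A.Good T D w₀ Φ Φin Φout) {x : V → V → ℝ}
    (hx : ∀ a b, x a b ≤ 1) {j : J} {q : Q} (hq : D j q) (U : Finset V) :
    A.L / 4 - A.mass j q U - A.loss x q ≤ ∑ a ∈ Uᶜ, A.early x j q a := by
  rw [sum_unused_early, ← h.sum_xi hq, mass, loss, ← Finset.sum_sub_distrib,
    ← Finset.sum_sub_distrib]
  refine Finset.sum_le_sum fun i hi => ?_
  have h1 := h.xi_le (h.D_T j q hq) j (Finset.mem_range.1 hi)
  have h2 : 0 ≤ A.xi j q i := xi_nonneg _ _ _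
  have h3 := hx (A.vt q i) (A.vt q (i + 1))
  split_ifs
  · nlinarith
  · nlinarith

theorem sum_unused_early_le (h : A.Good T D w₀ Φ Φin Φout) {x : V → V → ℝ}
    (hx : ∀ a b, x a b ≤ 1) {j : J} {q : Q} (hq : D j q) (U : Finset V) :
    ∑ a ∈ Uᶜ, A.early x j q a ≤ A.L / 4 := by
  rw [sum_unused_early, ← h.sum_xi hq]
  refine Finset.sum_le_sum fun i _ => ?_
  split_ifs
  · exact xi_nonneg _ _ _
  · exact mul_le_of_le_one_right (xi_nonneg _ _ _) (hx _ _)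

open Classical in
theorem sum_late (x : V → V → ℝ) (j : J) (q : Q) :
    ∑ b, A.late x j q b = ∑ i ∈ Finset.range (A.N q),
      (if 7 * A.L / 16 ≤ A.lev j (A.vt q i) then
        A.ew q i * x (A.vt q i) (A.vt q (i + 1)) else 0) := by
  simp only [late]
  rw [Finset.sum_comm]
  refine Finset.sum_congr rfl fun i _ => ?_
  simp only [ite_and]
  rw [Finset.sum_ite_eq]
  simp

theorem loss_rev (x : V → V → ℝ) (q : Q) :
    A.rev.loss (fun a b => x b a) q = A.loss x q := by
  unfold loss
  rw [← Finset.sum_range_reflect (fun i => A.ew q i * (1 - x (A.vt q i) (A.vt q (i + 1))))]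
  refine Finset.sum_congr rfl fun i hi => ?_
  have hi' : i < A.N q := Finset.mem_range.1 hi
  rw [A.ew_rev hi']
  simp only [rev]
  rw [show A.N q - (i + 1) = A.N q - 1 - i by omega,
    show A.N q - 1 - i + 1 = A.N q - i by omega]

/-- A step whose tail lies below `7 L / 16` is at most `w₀ ≤ L / 16` long, so its head lies below `8
L / 16` and is late after reversal. Hence every step is counted in at least one direction. -/
theorem len_sub_loss_le (h : A.Good T D w₀ Φ Φin Φout) {x : V → V → ℝ} (hx0 : ∀ a b, 0 ≤ x a b)
    {j : J} {q : Q} (hq : D j q) : A.len q (A.N q) - A.loss x q ≤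
      ∑ b, A.late x j q b + ∑ b, A.rev.late (fun a b => x b a) j q b := by
  classical
  rw [sum_late, sum_late]
  have hN : A.rev.N q = A.N q := rfl
  rw [hN, ← Finset.sum_range_reflect (fun i => if 7 * A.rev.L / 16 ≤ A.rev.lev j (A.rev.vt q i) then
        A.rev.ew q i * x (A.rev.vt q (i + 1)) (A.rev.vt q i) else 0), ← Finset.sum_add_distrib,
    len, loss, ← Finset.sum_sub_distrib]
  refine Finset.sum_le_sum fun i hi => ?_
  have hi' : i < A.N q := Finset.mem_range.1 hi
  rw [A.ew_rev (by omega), show A.N q - 1 - (A.N q - 1 - i) = i by omega]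
  have hv1 : A.rev.vt q (A.N q - 1 - i) = A.vt q (i + 1) :=
    congrArg (A.vt q) (by omega : A.N q - (A.N q - 1 - i) = i + 1)
  have hv2 : A.rev.vt q (A.N q - 1 - i + 1) = A.vt q i :=
    congrArg (A.vt q) (by omega : A.N q - (A.N q - 1 - i + 1) = i)
  rw [hv1, hv2]
  have h1 := h.lip q (h.D_T j q hq) j i hi'
  have h2 := h.w_le q (h.D_T j q hq) i hi'
  have h3 := h.w₀_le
  have h4 := mul_nonneg (h.ew_nonneg q i) (hx0 (A.vt q i) (A.vt q (i + 1)))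
  by_cases h5 : 7 * A.L / 16 ≤ A.lev j (A.vt q i)
  · rw [if_pos h5]
    split_ifs <;> linarith
  · have h7 := h.L_pos
    have h6 : 7 * A.rev.L / 16 ≤ A.rev.lev j (A.vt q (i + 1)) := by
      change 7 * A.L / 16 ≤ A.L - A.lev j (A.vt q (i + 1))
      linarith
    rw [if_neg h5, if_pos h6]
    linarith

/-- If the loss is at most `L / 16`, the unused early mass in either direction is at least `L / 4 -
L / 16 - L / 16 = L / 8`, and the two late fractions add up to at least `15 / 16`. A larger loss
makes the claim trivial. -/
theorem payoff_ge (h : A.Good T D w₀ Φ Φin Φout) {x : V → V → ℝ} (hx0 : ∀ a b, 0 ≤ x a b)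
    (hx : ∀ a b, x a b ≤ 1) {j : J} {q : Q} (hq : D j q) {U U' : Finset V}
    (hU : A.mass j q U ≤ A.L / 16) (hU' : A.rev.mass j q U' ≤ A.L / 16) :
    A.L / 16 - A.loss x q ≤
      (∑ a ∈ Uᶜ, A.early x j q a) * ((∑ b, A.late x j q b) / A.len q (A.N q)) +
      (∑ a ∈ U'ᶜ, A.rev.early (fun a b => x b a) j q a) *
        ((∑ b, A.rev.late (fun a b => x b a) j q b) / A.rev.len q (A.rev.N q)) := by
  have hL := h.L_pos
  have hlen := h.D_len j q hq
  have hlen0 : 0 < A.len q (A.N q) := by linarith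
  have hrl : A.rev.len q (A.rev.N q) = A.len q (A.N q) := A.len_rev q
  rw [hrl]
  have hr := h.reverse
  have e1 := h.le_sum_unused_early hx hq U
  have e2 := hr.le_sum_unused_early (x := fun a b => x b a) (fun a b => hx b a) hq U'
  rw [loss_rev] at e2
  change A.L / 4 - _ - _ ≤ _ at e2
  have e3 := h.len_sub_loss_le hx0 hq
  have p1 : 0 ≤ ∑ a ∈ Uᶜ, A.early x j q a := Finset.sum_nonneg fun a _ => early_nonneg hx0 _ _ _
  have p2 : 0 ≤ ∑ a ∈ U'ᶜ, A.rev.early (fun a b => x b a) j q a :=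
    Finset.sum_nonneg fun a _ => early_nonneg (fun a b => hx0 b a) _ _ _
  have p3 : 0 ≤ ∑ b, A.late x j q b := Finset.sum_nonneg fun a _ => h.late_nonneg hx0 _ _ _
  have p4 : 0 ≤ ∑ b, A.rev.late (fun a b => x b a) j q b :=
    Finset.sum_nonneg fun a _ => hr.late_nonneg (fun a b => hx0 b a) _ _ _
  have q3 := div_nonneg p3 hlen0.le
  have q4 := div_nonneg p4 hlen0.le
  have hl0 : 0 ≤ A.loss x q := Finset.sum_nonneg fun i _ =>
    mul_nonneg (h.ew_nonneg q i) (sub_nonneg.2 (hx _ _))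
  rcases le_total (A.L / 16) (A.loss x q) with hc | hc
  · have := mul_nonneg p1 q3
    have := mul_nonneg p2 q4
    linarith
  have e4 : 15 / 16 ≤ (∑ b, A.late x j q b) / A.len q (A.N q) +
      (∑ b, A.rev.late (fun a b => x b a) j q b) / A.len q (A.N q) := by
    rw [← add_div, le_div_iff₀ hlen0]
    have := h.L_le
    nlinarith
  have f1 := mul_le_mul_of_nonneg_right (by linarith : A.L / 8 ≤ ∑ a ∈ Uᶜ, A.early x j q a) q3
  have f2 := mul_le_mul_of_nonneg_right
    (by linarith : A.L / 8 ≤ ∑ a ∈ U'ᶜ, A.rev.early (fun a b => x b a) j q a) q4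
  nlinarith

variable [Fintype Q]

theorem coef_nonneg (h : A.Good T D w₀ Φ Φin Φout) {x : V → V → ℝ} (hx0 : ∀ a b, 0 ≤ x a b)
    (j : J) {f : Q → ℝ} (hf : ∀ q, 0 ≤ f q) (U : Finset V) (a b : V) : 0 ≤ A.coef x j f U a b := by
  unfold coef
  split_ifs
  · exact le_rfl
  · exact Finset.sum_nonneg fun q _ => mul_nonneg (hf q) (mul_nonneg (early_nonneg hx0 _ _ _)
      (div_nonneg (h.late_nonneg hx0 _ _ _) (h.len_nonneg _ _)))

theorem sum_coef (x : V → V → ℝ) (j : J) (f : Q → ℝ) (U : Finset V) :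
    ∑ a, ∑ b, A.coef x j f U a b =
      ∑ q, f q * ((∑ a ∈ Uᶜ, A.early x j q a) * ((∑ b, A.late x j q b) / A.len q (A.N q))) := by
  have h1 : ∀ a, ∑ b, A.coef x j f U a b = if a ∈ Uᶜ then
      ∑ q, f q * (A.early x j q a * ((∑ b, A.late x j q b) / A.len q (A.N q))) else 0 := by
    intro a
    unfold coef
    by_cases ha : a ∈ U
    · simp [ha]
    · rw [if_pos (Finset.mem_compl.2 ha)]
      simp only [if_neg ha]
      rw [Finset.sum_comm]
      refine Finset.sum_congr rfl fun q _ => ?_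
      rw [← Finset.mul_sum, ← Finset.mul_sum, Finset.sum_div]
  simp only [h1]
  rw [Finset.sum_ite_mem, Finset.univ_inter, Finset.sum_comm]
  refine Finset.sum_congr rfl fun q _ => ?_
  rw [← Finset.mul_sum, ← Finset.sum_mul]

theorem sum_coef_le (h : A.Good T D w₀ Φ Φin Φout) {x : V → V → ℝ} (hx0 : ∀ a b, 0 ≤ x a b)
    (hx : ∀ a b, x a b ≤ 1) {j : J} {f : Q → ℝ} (hf : ∀ q, 0 ≤ f q) (hf1 : ∑ q, f q = 1)
    (hD : ∀ q, 0 < f q → D j q) (U : Finset V) :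
    ∑ a, ∑ b, A.coef x j f U a b ≤ A.L / 4 := by
  rw [sum_coef, ← one_mul (A.L / 4), ← hf1, Finset.sum_mul]
  refine Finset.sum_le_sum fun q _ => ?_
  rcases (hf q).eq_or_lt with h0 | h0
  · rw [← h0, zero_mul, zero_mul]
  refine mul_le_mul_of_nonneg_left ?_ h0.le
  have hlen := h.D_len j q (hD q h0)
  refine (mul_le_of_le_one_right (Finset.sum_nonneg fun a _ => early_nonneg hx0 _ _ _)
    (div_le_one_of_le₀ (h.sum_late_le hx0 hx j q) (by linarith))).trans
    (h.sum_unused_early_le hx (hD q h0) U)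

theorem exists_of_coef_ne_zero (h : A.Good T D w₀ Φ Φin Φout) {x : V → V → ℝ}
    (hx0 : ∀ a b, 0 ≤ x a b) {j : J} {f : Q → ℝ} (hf : ∀ q, 0 ≤ f q)
    (hD : ∀ q, 0 < f q → D j q) {U : Finset V} {a b : V} (hab : A.coef x j f U a b ≠ 0) :
    ∃ q, 0 < f q ∧ ∃ i k, i ≤ k ∧ k ≤ A.N q ∧ A.vt q i = a ∧ A.vt q k = b := by
  unfold coef at hab
  split_ifs at hab with hU
  · exact absurd rfl hab
  obtain ⟨q, -, hq⟩ := Finset.exists_ne_zero_of_sum_ne_zero hab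
  have hf0 : 0 < f q := lt_of_le_of_ne (hf q) fun h0 => hq (by rw [← h0, zero_mul])
  have he : 0 < A.early x j q a := lt_of_le_of_ne (early_nonneg hx0 _ _ _) fun h0 =>
    hq (by rw [← h0, zero_mul, mul_zero])
  have hl : 0 < A.late x j q b := lt_of_le_of_ne (h.late_nonneg hx0 _ _ _) fun h0 =>
    hq (by rw [← h0, zero_div, mul_zero, mul_zero])
  obtain ⟨i, hi, hia, hix⟩ := exists_of_early_pos he
  obtain ⟨k, hk, hkb, hkl⟩ := exists_of_late_pos hl
  exact ⟨q, hf0, i + 1, k, h.lt_of_late (hD q hf0) hk hix hkl, hk.le, hia, hkb⟩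

/-- Averaging `payoff_ge` over the random track leaves `L / 16 - L / 64`. -/
theorem payoff_total_ge (h : A.Good T D w₀ Φ Φin Φout) {x : V → V → ℝ} (hx0 : ∀ a b, 0 ≤ x a b)
    (hx : ∀ a b, x a b ≤ 1) {j : J} {f : Q → ℝ} (hf : ∀ q, 0 ≤ f q) (hf1 : ∑ q, f q = 1)
    (hD : ∀ q, 0 < f q → D j q) {U U' : Finset V}
    (hU : ∀ q, 0 < f q → A.mass j q U ≤ A.L / 16)
    (hU' : ∀ q, 0 < f q → A.rev.mass j q U' ≤ A.L / 16)
    (hloss : ∑ q, f q * A.loss x q ≤ A.L / 64) :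
    A.L / 32 ≤ ∑ a, ∑ b, A.coef x j f U a b +
      ∑ a, ∑ b, A.rev.coef (fun a b => x b a) j f U' a b := by
  rw [sum_coef, sum_coef, ← Finset.sum_add_distrib]
  have h1 : A.L / 16 - ∑ q, f q * A.loss x q = ∑ q, f q * (A.L / 16 - A.loss x q) := by
    simp only [mul_sub, Finset.sum_sub_distrib]
    rw [← Finset.sum_mul, hf1, one_mul]
  have h2 : ∑ q, f q * (A.L / 16 - A.loss x q) ≤ _ := Finset.sum_le_sum fun q _ =>
    (show f q * (A.L / 16 - A.loss x q) ≤ f q * ((∑ a ∈ Uᶜ, A.early x j q a) *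
      ((∑ b, A.late x j q b) / A.len q (A.N q))) +
      f q * ((∑ a ∈ U'ᶜ, A.rev.early (fun a b => x b a) j q a) *
        ((∑ b, A.rev.late (fun a b => x b a) j q b) / A.rev.len q (A.rev.N q))) by
    rcases (hf q).eq_or_lt with h0 | h0
    · rw [← h0]; simp
    rw [← mul_add]
    exact mul_le_mul_of_nonneg_left (h.payoff_ge hx0 hx (hD q h0) (hU q h0) (hU' q h0)) h0.le)
  have h3 := h.L_pos
  linarith

end Good

end TrackSystem

end DirectedCut

/-! ### Strategies as nearly capacity-respecting flows, and the winning distribution on demands -/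

namespace DirectedCut

namespace TrackSystem

variable {V Q J : Type*} (A : TrackSystem V Q J) [Fintype V] [DecidableEq V] [Fintype Q]

/-- The flow of a random track through the step from `a` to `b`. -/
noncomputable def fl (f : Q → ℝ) (a b : V) : ℝ :=
  ∑ q, f q * ∑ i ∈ Finset.range (A.N q), if A.vt q i = a ∧ A.vt q (i + 1) = b then 1 else 0

/-- The factor by which flow has to be scaled down to respect the capacities `c / m`. -/
noncomputable def scale (c : V × V → ℝ) (m : ℝ) (f : Q → ℝ) (a b : V) : ℝ :=
  if m * A.fl f a b ≤ c (a, b) then 1 else c (a, b) / (m * A.fl f a b)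

/-- A random demand track for `j` inside `E` that exceeds the capacities `c / m` only a little. -/
structure Strategy (D : J → Q → Prop) (c : V × V → ℝ) (m : ℝ) (E : Finset (V × V)) (j : J)
    (f : Q → ℝ) : Prop where
  nonneg : ∀ q, 0 ≤ f q
  sum_eq : ∑ q, f q = 1
  supp : ∀ q, 0 < f q → D j q ∧ A.On E q
  excess : ∑ a, ∑ b, A.w a b * max (A.fl f a b - c (a, b) / m) 0 ≤ A.L / 64

variable {A} in
theorem Strategy.mono {D : J → Q → Prop} {c : V × V → ℝ} {m : ℝ}
    {E E' : Finset (V × V)} {j : J} {f : Q → ℝ} (hE : E ⊆ E') (h : A.Strategy D c m E j f) :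
    A.Strategy D c m E' j f where
  nonneg := h.nonneg
  sum_eq := h.sum_eq
  supp q hq := ⟨(h.supp q hq).1, (h.supp q hq).2.mono hE⟩
  excess := h.excess

/-- Linearity of expectation: the expected sum of `g` along a random track is the sum of `g` against
its flow. -/
theorem sum_steps (f : Q → ℝ) (g : V → V → ℝ) :
    ∑ q, f q * ∑ i ∈ Finset.range (A.N q), g (A.vt q i) (A.vt q (i + 1)) =
      ∑ a, ∑ b, g a b * A.fl f a b := by
  have h1 : ∀ q i, g (A.vt q i) (A.vt q (i + 1)) =
      ∑ a, ∑ b, g a b * if A.vt q i = a ∧ A.vt q (i + 1) = b then 1 else 0 := by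
    intro q i
    simp only [mul_ite, mul_one, mul_zero, ite_and]
    simp
  simp only [fl, Finset.mul_sum]
  rw [Finset.sum_comm' (s := Finset.univ (α := V)) (t := fun _ => Finset.univ (α := V))
    (t' := Finset.univ) (s' := fun _ => Finset.univ) (by simp)]
  simp only [h1, Finset.mul_sum]
  rw [Finset.sum_congr rfl fun q _ => Finset.sum_comm]
  rw [Finset.sum_comm]
  rw [Finset.sum_comm (s := Finset.univ (α := V)) (t := Finset.univ (α := V))]
  refine Finset.sum_congr rfl fun a _ => ?_
  rw [Finset.sum_congr rfl fun q _ => Finset.sum_comm]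
  rw [Finset.sum_comm]
  refine Finset.sum_congr rfl fun b _ => Finset.sum_congr rfl fun q _ =>
    Finset.sum_congr rfl fun i _ => by ring

variable {A}

theorem fl_nonneg {f : Q → ℝ} (hf : ∀ q, 0 ≤ f q) (a b : V) : 0 ≤ A.fl f a b :=
  Finset.sum_nonneg fun q _ => mul_nonneg (hf q) (Finset.sum_nonneg fun i _ => by
    split_ifs <;> norm_num)

theorem scale_nonneg {c : V × V → ℝ} (hc : ∀ e, 0 ≤ c e) {m : ℝ} (hm : 0 < m) {f : Q → ℝ}
    (hf : ∀ q, 0 ≤ f q) (a b : V) : 0 ≤ A.scale c m f a b := by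
  unfold scale
  split_ifs
  · norm_num
  · exact div_nonneg (hc _) (mul_nonneg hm.le (fl_nonneg hf a b))

theorem scale_le_one {c : V × V → ℝ} (hc : ∀ e, 0 ≤ c e) {m : ℝ} {f : Q → ℝ} (a b : V) :
    A.scale c m f a b ≤ 1 := by
  unfold scale
  split_ifs with h
  · exact le_rfl
  · exact div_le_one_of_le₀ (not_le.1 h).le ((hc _).trans (not_le.1 h).le)

theorem fl_mul_scale_le {c : V × V → ℝ} (hc : ∀ e, 0 ≤ c e) {m : ℝ} {f : Q → ℝ} (a b : V) :
    m * (A.fl f a b * A.scale c m f a b) ≤ c (a, b) := by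
  unfold scale
  split_ifs with h
  · rwa [mul_one]
  · rw [← mul_assoc, mul_div_cancel₀]
    exact ((hc (a, b)).trans_lt (not_le.1 h)).ne'

theorem fl_mul_one_sub_scale {c : V × V → ℝ} (hc : ∀ e, 0 ≤ c e) {m : ℝ} (hm : 0 < m)
    {f : Q → ℝ} (a b : V) :
    A.fl f a b * (1 - A.scale c m f a b) = max (A.fl f a b - c (a, b) / m) 0 := by
  unfold scale
  split_ifs with h
  · rw [sub_self, mul_zero, max_eq_right]
    rw [sub_nonpos, le_div_iff₀ hm]
    linarith
  · have h1 : 0 < m * A.fl f a b := (hc (a, b)).trans_lt (not_le.1 h)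
    have h2 : 0 < A.fl f a b := pos_of_mul_pos_right h1 hm.le
    rw [max_eq_left]
    · field_simp
    · rw [sub_nonneg, div_le_iff₀ hm]
      linarith

namespace Good

variable {T : Q → Prop} {D : J → Q → Prop} {w₀ Φ : ℝ} {Φin Φout : V → ℝ}

/-- Scaling removes exactly the flow above capacity, so the expected loss is the excess of the
strategy. -/
theorem strategy_loss {c : V × V → ℝ} (hc : ∀ e, 0 ≤ c e) {m : ℝ} (hm : 0 < m)
    {E : Finset (V × V)} {j : J} {f : Q → ℝ} (hs : A.Strategy D c m E j f) :
    ∑ q, f q * A.loss (A.scale c m f) q ≤ A.L / 64 := by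
  refine le_trans (le_of_eq ?_) hs.excess
  have := A.sum_steps f (fun a b => A.w a b * (1 - A.scale c m f a b))
  refine Eq.trans this ?_
  refine Finset.sum_congr rfl fun a _ => Finset.sum_congr rfl fun b _ => ?_
  rw [← fl_mul_one_sub_scale hc hm]
  ring

/-- The scaled flow of each strategy is at most `c / m` on every edge, so `m` times its weight
through a vertex is at most the volume of that vertex. -/
theorem mixture (h : A.Good T D w₀ Φ Φin Φout) {c : V × V → ℝ} (hc : ∀ e, 0 ≤ c e) {m : ℝ}
    (hm : 0 < m) (hin : ∀ a, ∑ b, c (b, a) * A.w b a ≤ Φin a)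
    (hout : ∀ a, ∑ b, c (a, b) * A.w a b ≤ Φout a)
    {S : Type*} [Fintype S] {js : S → J} {σ : S → ℝ} {f : S → Q → ℝ} {E : Finset (V × V)}
    (hσ : ∀ s, 0 ≤ σ s) (hσ1 : ∑ s, σ s = 1) (hs : ∀ s, A.Strategy D c m E (js s) (f s)) :
    Mixture A D Φin Φout m js σ f (fun s => A.scale c m (f s)) where
  σ_nonneg := hσ
  sum_σ := hσ1
  f_nonneg s := (hs s).nonneg
  supp s q hq := ((hs s).supp q hq).1
  x_nonneg s := scale_nonneg hc hm (hs s).nonneg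
  x_le s := scale_le_one hc
  flow_in s a := by
    refine le_trans ?_ (hin a)
    have := A.sum_steps (f s) (fun b a' => if a' = a then A.w b a' * A.scale c m (f s) b a' else 0)
    refine (le_of_eq (congrArg (m * ·) (Eq.trans ?_ this))).trans ?_
    · exact Finset.sum_congr rfl fun q _ => congrArg _ (Finset.sum_congr rfl fun i _ => rfl)
    rw [Finset.mul_sum]
    refine Finset.sum_le_sum fun b _ => ?_
    simp only [ite_mul, zero_mul, Finset.sum_ite_eq', Finset.mem_univ, if_true]
    have h1 := mul_le_mul_of_nonneg_left (fl_mul_scale_le (A := A) hc (m := m) (f := f s) b a)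
      (h.w_nonneg b a)
    linarith
  flow_out s a := by
    refine le_trans ?_ (hout a)
    have := A.sum_steps (f s) (fun a' b => if a' = a then A.w a' b * A.scale c m (f s) a' b else 0)
    refine (le_of_eq (congrArg (m * ·) (Eq.trans ?_ this))).trans ?_
    · exact Finset.sum_congr rfl fun q _ => congrArg _ (Finset.sum_congr rfl fun i _ => rfl)
    rw [Finset.sum_comm]
    rw [Finset.mul_sum]
    refine Finset.sum_le_sum fun b _ => ?_
    simp only [ite_mul, zero_mul, Finset.sum_ite_eq', Finset.mem_univ, if_true]
    have h1 := mul_le_mul_of_nonneg_left (fl_mul_scale_le (A := A) hc (m := m) (f := f s) a b)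
      (h.w_nonneg a b)
    linarith

end Good

theorem On.rev_reach {E : Finset (V × V)} {q : Q} (hq : A.On E q) {i k : ℕ} (hik : i ≤ k)
    (hk : k ≤ A.N q) :
    Relation.ReflTransGen (fun a b => (a, b) ∈ E) (A.rev.vt q k) (A.rev.vt q i) :=
  hq.reach (by omega : A.N q - k ≤ A.N q - i) (Nat.sub_le _ _)

variable (A) in
/-- The weight with which the pair `(a, b)` enters the payoff of a strategy. -/
noncomputable def coef₂ (c : V × V → ℝ) (m : ℝ) (U U' : Finset V) (j : J) (f : Q → ℝ) (a b : V) :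
    ℝ :=
  A.coef (A.scale c m f) j f U a b + A.rev.coef (fun a b => A.scale c m f b a) j f U' b a

variable (A) in
-- Truncation at 1 keeps the payoff concave in `F` and stops a few pairs of huge climb from
-- dominating it.
noncomputable def payoff [Fintype J] (c : V × V → ℝ) (m cap : ℝ) (U U' : Finset V) (F : J → ℝ)
    (j : J) (f : Q → ℝ) : ℝ :=
  ∑ a, ∑ b, A.coef₂ c m U U' j f a b * min 1 (A.avg id F a b / cap)

namespace Good

variable {T : Q → Prop} {D : J → Q → Prop} {w₀ Φ : ℝ} {Φin Φout : V → ℝ}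

theorem coef₂_nonneg (h : A.Good T D w₀ Φ Φin Φout) {c : V × V → ℝ} (hc : ∀ e, 0 ≤ c e) {m : ℝ}
    (hm : 0 < m) {U U' : Finset V} {E : Finset (V × V)} {j : J} {f : Q → ℝ}
    (hs : A.Strategy D c m E j f) (a b : V) : 0 ≤ A.coef₂ c m U U' j f a b :=
  add_nonneg (h.coef_nonneg (scale_nonneg hc hm hs.nonneg) _ hs.nonneg _ _ _)
    (h.reverse.coef_nonneg (fun a b => scale_nonneg hc hm hs.nonneg b a) _ hs.nonneg _ _ _)

theorem sum_coef₂_le (h : A.Good T D w₀ Φ Φin Φout) {c : V × V → ℝ} (hc : ∀ e, 0 ≤ c e) {m : ℝ}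
    (hm : 0 < m) {U U' : Finset V} {E : Finset (V × V)} {j : J} {f : Q → ℝ}
    (hs : A.Strategy D c m E j f) : ∑ a, ∑ b, A.coef₂ c m U U' j f a b ≤ A.L / 2 := by
  have h1 := h.sum_coef_le (scale_nonneg (A := A) hc hm hs.nonneg) (scale_le_one hc) hs.nonneg hs.sum_eq
    (fun q hq => (hs.supp q hq).1) U
  have h2 := h.reverse.sum_coef_le (fun a b => scale_nonneg (A := A) hc hm hs.nonneg b a)
    (fun a b => scale_le_one hc b a) hs.nonneg hs.sum_eq (fun q hq => (hs.supp q hq).1) U'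
  change _ ≤ A.L / 4 at h2
  simp only [coef₂, Finset.sum_add_distrib]
  rw [Finset.sum_comm] at h2
  linarith

/-- If one distribution on the demands has large payoff against all strategies then all
strategies can be destroyed at once. -/
theorem exists_hit [Fintype J] (h : A.Good T D w₀ Φ Φin Φout) (hL2 : A.L ≤ 1 / 2)
    {c : V × V → ℝ} (hc : ∀ e, 0 ≤ c e) {m ρ γ Λ : ℝ} (hm : 0 < m) (hρ : 0 < ρ) (hγ : 0 < γ)
    (hΛ : 1 + 2 * Real.log (Fintype.card V) ≤ Λ) {E : Finset (V × V)}
    (hlev : ∀ j, ∑ e ∈ E, c e * max (A.lev j e.2 - A.lev j e.1) 0 ≤ A.L * (ρ * m))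
    {U U' : Finset V} {F : J → ℝ} (hF : F ∈ stdSimplex ℝ J)
    (hpay : ∀ j f, A.Strategy D c m E j f → A.L / 64 ≤ A.payoff c m (m / γ ^ 3) U U' F j f) :
    ∃ X ⊆ E, ∑ e ∈ X, c e ≤ 64 * ρ * γ ^ 3 * Λ ∧ ∀ j f, ¬ A.Strategy D c m (E \ X) j f := by
  have hL := h.L_pos
  have hcb : ∑ e ∈ E, c e * ∑ j, F j * max (A.lev j e.2 - A.lev j e.1) 0 ≤ A.L * (ρ * m) := by
    have h1 : ∑ e ∈ E, c e * ∑ j, F j * max (A.lev j e.2 - A.lev j e.1) 0 =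
        ∑ j, F j * ∑ e ∈ E, c e * max (A.lev j e.2 - A.lev j e.1) 0 := by
      simp only [Finset.mul_sum]
      rw [Finset.sum_comm]
      exact Finset.sum_congr rfl fun j _ => Finset.sum_congr rfl fun e _ => by ring
    rw [h1]
    calc _ ≤ ∑ j, F j * (A.L * (ρ * m)) :=
          Finset.sum_le_sum fun j _ => mul_le_mul_of_nonneg_left (hlev j) (hF.1 j)
      _ = _ := by rw [← Finset.sum_mul, hF.2, one_mul]
  -- With `θ = m / γ ^ 3 * (L / 32)` the factors `m` and `L` cancel from the price, leaving `64 * ρ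
  -- * γ ^ 3` times the logarithm.
  obtain ⟨X, hXE, hcost, hX⟩ := exists_separating_edges c hc A.lev F hF.1
    (by positivity : 0 < A.L * (ρ * m)) (by positivity : 0 < m / γ ^ 3 * (A.L / 32)) E hcb
  refine ⟨X, hXE, hcost.trans ?_, fun j f hs => ?_⟩
  · have e : 2 * (A.L * (ρ * m)) / (m / γ ^ 3 * (A.L / 32)) = 64 * ρ * γ ^ 3 := by
      field_simp; norm_num
    rw [e]
    exact mul_le_mul_of_nonneg_left hΛ (by positivity)
  have hp := hpay j f (hs.mono Finset.sdiff_subset)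
  have hx0 := scale_nonneg (A := A) hc hm hs.nonneg
  have hle : A.payoff c m (m / γ ^ 3) U U' F j f ≤
      ∑ a, ∑ b, A.coef₂ c m U U' j f a b * (A.L / 32) := by
    refine Finset.sum_le_sum fun a _ => Finset.sum_le_sum fun b _ => ?_
    have hnn := h.coef₂_nonneg hc hm (U := U) (U' := U') hs a b
    rcases hnn.eq_or_lt with h0 | h0
    · rw [← h0, zero_mul, zero_mul]
    refine mul_le_mul_of_nonneg_left ?_ hnn
    have hreach : Relation.ReflTransGen (fun a b => (a, b) ∈ E \ X) a b := by
      by_cases h1 : A.coef (A.scale c m f) j f U a b = 0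
      · have h2 : A.rev.coef (fun a b => A.scale c m f b a) j f U' b a ≠ 0 := by
          intro h2
          rw [coef₂, h1, h2, add_zero] at h0
          exact lt_irrefl _ h0
        obtain ⟨q, hq, i, k, hik, hk, rfl, rfl⟩ := h.reverse.exists_of_coef_ne_zero
          (fun a b => hx0 b a) hs.nonneg (fun q hq => (hs.supp q hq).1) h2
        exact (hs.supp q hq).2.rev_reach hik hk
      · obtain ⟨q, hq, i, k, hik, hk, rfl, rfl⟩ := h.exists_of_coef_ne_zero
          hx0 hs.nonneg (fun q hq => (hs.supp q hq).1) h1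
        exact (hs.supp q hq).2.reach hik hk
    have h3 : A.avg id F a b < m / γ ^ 3 * (A.L / 32) := by
      by_contra hcon
      exact hX a b (not_lt.1 hcon) hreach
    refine (min_le_right _ _).trans ?_
    rw [div_le_iff₀ (by positivity), mul_comm]
    exact h3.le
  -- A surviving strategy would have payoff at most `(L / 2) * (L / 32) = L ^ 2 / 64`, which is
  -- below `L / 64` because `L ≤ 1 / 2`.
  have h4 := h.sum_coef₂_le hc hm (U := U) (U' := U') hs
  simp only [← Finset.sum_mul] at hle
  nlinarith

end Good

end TrackSystem

end DirectedCut

/-! ### The minimax dichotomy and the destruction of all strategies -/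

namespace DirectedCut

namespace TrackSystem

variable {V Q J : Type*} {A : TrackSystem V Q J} [Fintype V] [DecidableEq V] [Fintype Q]

namespace Good

variable {T : Q → Prop} {D : J → Q → Prop} {w₀ Φ : ℝ} {Φin Φout : V → ℝ}

open Classical in
theorem sum_coef_unsat (x : V → V → ℝ) (j : J) (f : Q → ℝ) (U : Finset V) (Lf : V → V → ℝ)
    (cap : ℝ) : ∑ a, ∑ b, A.coef x j f U a b * (if Lf a b < cap then 1 else 0) =
      ∑ q, ∑ a, ∑ b, f q * A.early x j q a * (A.late x j q b / A.len q (A.N q)) *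
        unsat Lf cap U a b := by
  rw [Finset.sum_comm (s := Finset.univ (α := Q))]
  refine Finset.sum_congr rfl fun a _ => ?_
  rw [Finset.sum_comm (s := Finset.univ (α := Q))]
  refine Finset.sum_congr rfl fun b _ => ?_
  unfold coef unsat
  by_cases ha : a ∈ U
  · simp [ha]
  · rw [if_neg ha, Finset.sum_mul]
    refine Finset.sum_congr rfl fun q _ => ?_
    simp only [ha, not_false_eq_true, true_and]
    ring

theorem sum_avg_le {S : Type*} [Fintype S] {js : S → J} {σ : S → ℝ} (hσ : ∀ s, 0 ≤ σ s)
    (hσ1 : ∑ s, σ s = 1) {c : V × V → ℝ} {B : ℝ} {E : Finset (V × V)}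
    (hlev : ∀ j, ∑ e ∈ E, c e * max (A.lev j e.2 - A.lev j e.1) 0 ≤ B) :
    ∑ e ∈ E, c e * ∑ s, σ s * max (A.lev (js s) e.2 - A.lev (js s) e.1) 0 ≤ B := by
  have h1 : ∑ e ∈ E, c e * ∑ s, σ s * max (A.lev (js s) e.2 - A.lev (js s) e.1) 0 =
      ∑ s, σ s * ∑ e ∈ E, c e * max (A.lev (js s) e.2 - A.lev (js s) e.1) 0 := by
    simp only [Finset.mul_sum]
    rw [Finset.sum_comm]
    exact Finset.sum_congr rfl fun j _ => Finset.sum_congr rfl fun e _ => by ring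
  rw [h1]
  calc _ ≤ ∑ s, σ s * B := Finset.sum_le_sum fun s _ => mul_le_mul_of_nonneg_left (hlev _) (hσ s)
    _ = _ := by rw [← Finset.sum_mul, hσ1, one_mul]

/-- The separation of all pairs with a large average climb. -/
theorem exists_climb_cut (h : A.Good T D w₀ Φ Φin Φout) {S : Type*} [Fintype S] {js : S → J}
    {σ : S → ℝ} (hσ : ∀ s, 0 ≤ σ s) (hσ1 : ∑ s, σ s = 1) {c : V × V → ℝ} (hc : ∀ e, 0 ≤ c e)
    {m ρ γ Λ κ P : ℝ} (hm : 0 < m) (hρ : 0 < ρ) (hγ : 0 < γ) (hΛ1 : 1 ≤ Λ) (hκ : 0 < κ)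
    (hΛ : 1 + 2 * Real.log (Fintype.card V) ≤ Λ) {E : Finset (V × V)}
    (hlev : ∀ j, ∑ e ∈ E, c e * max (A.lev j e.2 - A.lev j e.1) 0 ≤ A.L * (ρ * m))
    (hP : m * (A.L / 128 / (2 * Λ)) ≤ 2 * κ * P) :
    ∃ X ⊆ E, ∑ e ∈ X, c e ≤ 2 ^ 39 * ρ * Λ ^ 4 * γ / A.L ^ 4 * P ∧ ∀ a b,
      Relation.ReflTransGen (fun a b => (a, b) ∈ E \ X) a b → A.avg js σ a b <
        κ * A.L * ((A.L / 16) ^ 2 * (A.L / 128 / (2 * Λ)) / γ) / (5120 * Λ) := by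
  have hL := h.L_pos
  have hΛ0 : 0 < Λ := by linarith
  have hθ : 0 < κ * A.L * ((A.L / 16) ^ 2 * (A.L / 128 / (2 * Λ)) / γ) / (5120 * Λ) := by
    positivity
  obtain ⟨X, hXE, hcost, hX⟩ := exists_separating_edges c hc (fun s => A.lev (js s)) σ hσ
    (by positivity : 0 < A.L * (ρ * m)) hθ E (sum_avg_le hσ hσ1 hlev)
  refine ⟨X, hXE, hcost.trans ?_, fun a b hab => ?_⟩
  -- The price is `ρ * m * γ / κ` up to powers of `Λ` and `L`, and `hP` replaces `m / κ` by the
  -- volume `P` of the used set.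
  · have e : 2 * (A.L * (ρ * m)) /
        (κ * A.L * ((A.L / 16) ^ 2 * (A.L / 128 / (2 * Λ)) / γ) / (5120 * Λ)) =
        671088640 * ρ * m * Λ ^ 2 * γ / (κ * A.L ^ 3) := by
      field_simp; norm_num
    have hP' : m * A.L / (512 * Λ * κ) ≤ P := by
      rw [div_le_iff₀ (by positivity)]
      have : m * (A.L / 128 / (2 * Λ)) = m * A.L / (256 * Λ) := by field_simp; norm_num
      rw [this, div_le_iff₀ (by positivity)] at hP
      linarith
    rw [e]
    calc _ ≤ 671088640 * ρ * m * Λ ^ 2 * γ / (κ * A.L ^ 3) * Λ :=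
          mul_le_mul_of_nonneg_left hΛ (by positivity)
      _ = 671088640 * 512 * ρ * Λ ^ 4 * γ / A.L ^ 4 * (m * A.L / (512 * Λ * κ)) := by
          field_simp
      _ ≤ 671088640 * 512 * ρ * Λ ^ 4 * γ / A.L ^ 4 * P :=
          mul_le_mul_of_nonneg_left hP' (by positivity)
      _ ≤ _ := by
          refine mul_le_mul_of_nonneg_right ?_ ((by positivity : 0 ≤ m * A.L / (512 * Λ * κ)).trans
            hP')
          gcongr
          norm_num
  · by_contra hcon
    exact hX a b (not_lt.1 hcon) hab

/-- The numerical side conditions. -/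
structure Params (A : TrackSystem V Q J) (w₀ Φ m γ Λ : ℝ) (K : ℕ) : Prop where
  m_pos : 0 < m
  γ_pos : 0 < γ
  Φ_eq : Φ = γ ^ 2
  one_le : 1 ≤ Λ
  log_card : 1 + 2 * Real.log (Fintype.card V) ≤ Λ
  log_w₀ : 1 + Real.log (1 / w₀) ≤ Λ
  pow_lt : (1 / 2 : ℝ) ^ K < A.L / 128 * m / (2 * Φ)
  K_le : K ≤ Λ
  w₀_le : w₀ ≤ (A.L / 16) ^ 2 * (A.L / 128 / (2 * Λ)) / γ / 120
  L_le : A.L ≤ 1 / 2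

open Classical in
-- The mixture is tested against its own distribution of demands. Its untruncated payoff is at least
-- `L / 32` but the truncated one is below `L / 64`, so weight `L / 64` sits on unsaturated pairs,
-- and one of the two directions carries `L / 128`. That direction feeds `exists_used_set`, whose
-- conclusion about surviving tracks becomes effective after `exists_climb_cut`.
theorem exists_gain [Fintype J] (h : A.Good T D w₀ Φ Φin Φout) {c : V × V → ℝ}
    (hc : ∀ e, 0 ≤ c e) (hin : ∀ a, ∑ b, c (b, a) * A.w b a ≤ Φin a)
    (hout : ∀ a, ∑ b, c (a, b) * A.w a b ≤ Φout a)
    {m ρ γ Λ : ℝ} {K : ℕ} (hp : Params A w₀ Φ m γ Λ K) (hρ : 0 < ρ) {E : Finset (V × V)}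
    (hlev : ∀ j, ∑ e ∈ E, c e * max (A.lev j e.2 - A.lev j e.1) 0 ≤ A.L * (ρ * m))
    {S : Type*} [Fintype S] {js : S → J}
    {σ : S → ℝ} (hσ : ∀ s, 0 ≤ σ s) (hσ1 : ∑ s, σ s = 1) {f : S → Q → ℝ}
    (hs : ∀ s, A.Strategy D c m E (js s) (f s)) {U U' : Finset V}
    (hU : ∀ j q, D j q → A.On E q → A.mass j q U ≤ A.L / 16)
    (hU' : ∀ j q, D j q → A.On E q → A.rev.mass j q U' ≤ A.L / 16)
    (hpay : ∀ F ∈ stdSimplex ℝ J,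
      ∑ s, σ s * A.payoff c m (m / γ ^ 3) U U' F (js s) (f s) < A.L / 64) :
    ∃ X ⊆ E,
      (∃ Y : Finset V, Y.Nonempty ∧ Disjoint Y U ∧
        ∑ e ∈ X, c e ≤ 2 ^ 39 * ρ * Λ ^ 4 * γ / A.L ^ 4 * ∑ y ∈ Y, Φin y ∧
        ∀ j q, D j q → A.On (E \ X) q → A.mass j q Y ≤ A.L / 16 * ((∑ y ∈ Y, Φin y) / Φ)) ∨
      (∃ Y : Finset V, Y.Nonempty ∧ Disjoint Y U' ∧
        ∑ e ∈ X, c e ≤ 2 ^ 39 * ρ * Λ ^ 4 * γ / A.L ^ 4 * ∑ y ∈ Y, Φout y ∧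
        ∀ j q, D j q → A.On (E \ X) q →
          A.rev.mass j q Y ≤ A.L / 16 * ((∑ y ∈ Y, Φout y) / Φ)) := by
  have hL := h.L_pos
  have hm := hp.m_pos
  have hγ := hp.γ_pos
  have hΛ0 : 0 < Λ := by linarith [hp.one_le]
  set cap := m / γ ^ 3 with hcap
  have hcap0 : 0 < cap := by positivity
  -- The law of the demand under `σ`, so that averaging levels over `F` and over the mixture is the
  -- same.
  let F : J → ℝ := fun j => ∑ s, if js s = j then σ s else 0
  have hFsum : ∀ g : J → ℝ, ∑ j, F j * g j = ∑ s, σ s * g (js s) := by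
    intro g
    simp only [F, Finset.sum_mul]
    rw [Finset.sum_comm]
    refine Finset.sum_congr rfl fun s _ => ?_
    simp
  have hF : F ∈ stdSimplex ℝ J := by
    refine ⟨fun j => Finset.sum_nonneg fun s _ => ?_, ?_⟩
    · split_ifs
      exacts [hσ s, le_rfl]
    · have := hFsum fun _ => 1
      simpa [hσ1] using this
  have havg : ∀ a b, A.avg id F a b = A.avg js σ a b := fun a b =>
    hFsum fun j => max (A.lev j b - A.lev j a) 0
  let ind : V → V → ℝ := fun a b => if A.avg js σ a b < cap then 1 else 0
  have hone : ∀ a b, 1 ≤ min 1 (A.avg id F a b / cap) + ind a b := by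
    intro a b
    simp only [ind]
    rw [havg]
    split_ifs with h1
    · have : 0 ≤ A.avg js σ a b := Finset.sum_nonneg fun s _ =>
        mul_nonneg (hσ s) (le_max_right _ _)
      have : 0 ≤ min 1 (A.avg js σ a b / cap) := le_min (by norm_num) (by positivity)
      linarith
    · rw [min_eq_left]
      · norm_num
      · rw [le_div_iff₀ hcap0]; linarith
  have hx0 : ∀ s a b, 0 ≤ A.scale c m (f s) a b := fun s => scale_nonneg hc hm (hs s).nonneg
  have hx1 : ∀ s a b, A.scale c m (f s) a b ≤ 1 := fun s => scale_le_one hc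
  have htot : ∀ s, A.L / 32 ≤ A.payoff c m cap U U' F (js s) (f s) +
      ∑ a, ∑ b, A.coef₂ c m U U' (js s) (f s) a b * ind a b := by
    intro s
    have h1 := h.payoff_total_ge (hx0 s) (hx1 s) (hs s).nonneg (hs s).sum_eq
      (fun q hq => ((hs s).supp q hq).1)
      (fun q hq => hU _ q ((hs s).supp q hq).1 ((hs s).supp q hq).2)
      (fun q hq => hU' _ q ((hs s).supp q hq).1 ((hs s).supp q hq).2)
      (strategy_loss hc hm (hs s))
    rw [Finset.sum_comm (f := fun a b => A.rev.coef _ _ _ _ a b), ← Finset.sum_add_distrib] at h1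
    simp only [← Finset.sum_add_distrib] at h1
    refine h1.trans ?_
    rw [payoff, ← Finset.sum_add_distrib]
    refine Finset.sum_le_sum fun a _ => ?_
    rw [← Finset.sum_add_distrib]
    refine Finset.sum_le_sum fun b _ => ?_
    rw [← mul_add]
    exact le_mul_of_one_le_right (h.coef₂_nonneg hc hm (hs s) a b) (hone a b)
  have hunsat : A.L / 64 ≤ ∑ s, σ s * ∑ a, ∑ b, A.coef₂ c m U U' (js s) (f s) a b * ind a b := by
    have h1 := hpay F hF
    have h2 : A.L / 32 ≤ ∑ s, σ s * (A.payoff c m cap U U' F (js s) (f s) +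
      ∑ a, ∑ b, A.coef₂ c m U U' (js s) (f s) a b * ind a b) := by
      calc A.L / 32 = ∑ s, σ s * (A.L / 32) := by rw [← Finset.sum_mul, hσ1, one_mul]
        _ ≤ _ := Finset.sum_le_sum fun s _ => mul_le_mul_of_nonneg_left (htot s) (hσ s)
    simp only [mul_add, Finset.sum_add_distrib] at h2
    linarith
  have hsplit : ∑ s, σ s * ∑ a, ∑ b, A.coef₂ c m U U' (js s) (f s) a b * ind a b =
      ∑ s, σ s * ∑ a, ∑ b, A.coef (A.scale c m (f s)) (js s) (f s) U a b * ind a b +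
      ∑ s, σ s * ∑ a, ∑ b, A.rev.coef (fun a b => A.scale c m (f s) b a) (js s) (f s) U' a b *
        ind b a := by
    rw [← Finset.sum_add_distrib]
    refine Finset.sum_congr rfl fun s _ => ?_
    rw [← mul_add, Finset.sum_comm (f := fun a b => A.rev.coef _ _ _ _ a b * ind b a),
      ← Finset.sum_add_distrib]
    congr 1
    refine Finset.sum_congr rfl fun a _ => ?_
    rw [← Finset.sum_add_distrib]
    exact Finset.sum_congr rfl fun b _ => by rw [← add_mul]; rfl
  rw [hsplit] at hunsat
  have hmix := h.mixture hc hm hin hout hσ hσ1 hs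
  have hmixr : Mixture A.rev D Φout Φin m js σ f (fun s a b => A.scale c m (f s) b a) := by
    refine ⟨hσ, hσ1, fun s => (hs s).nonneg, fun s q hq => ((hs s).supp q hq).1,
      fun s a b => hx0 s b a, fun s a b => hx1 s b a, fun s a => ?_, fun s a => ?_⟩
    · refine le_trans (le_of_eq ?_) (hmix.flow_out s a)
      congr 1
      refine Finset.sum_congr rfl fun q _ => ?_
      congr 1
      rw [← Finset.sum_range_reflect]
      refine Finset.sum_congr rfl fun i hi => ?_
      have hi' : i < A.N q := Finset.mem_range.1 hi
      have hN : A.rev.N q = A.N q := rfl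
      rw [hN, A.ew_rev (by omega), show A.N q - 1 - (A.N q - 1 - i) = i by omega]
      have hv1 : A.rev.vt q (A.N q - 1 - i) = A.vt q (i + 1) :=
        congrArg (A.vt q) (by omega : A.N q - (A.N q - 1 - i) = i + 1)
      have hv2 : A.rev.vt q (A.N q - 1 - i + 1) = A.vt q i :=
        congrArg (A.vt q) (by omega : A.N q - (A.N q - 1 - i + 1) = i)
      rw [hv1, hv2]
    · refine le_trans (le_of_eq ?_) (hmix.flow_in s a)
      congr 1
      refine Finset.sum_congr rfl fun q _ => ?_
      congr 1
      rw [← Finset.sum_range_reflect]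
      refine Finset.sum_congr rfl fun i hi => ?_
      have hi' : i < A.N q := Finset.mem_range.1 hi
      have hN : A.rev.N q = A.N q := rfl
      rw [hN, A.ew_rev (by omega), show A.N q - 1 - (A.N q - 1 - i) = i by omega]
      have hv1 : A.rev.vt q (A.N q - 1 - i) = A.vt q (i + 1) :=
        congrArg (A.vt q) (by omega : A.N q - (A.N q - 1 - i) = i + 1)
      have hv2 : A.rev.vt q (A.N q - 1 - i + 1) = A.vt q i :=
        congrArg (A.vt q) (by omega : A.N q - (A.N q - 1 - i + 1) = i)
      rw [hv1, hv2]
  have hnonempty : ∀ {κ : ℝ} {Y : Finset V} {P : V → ℝ},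
      m * (A.L / 128 / (2 * Λ)) ≤ 2 * κ * ∑ y ∈ Y, P y → Y.Nonempty := by
    intro κ Y P hY
    by_contra hne
    rw [Finset.not_nonempty_iff_eq_empty] at hne
    rw [hne, Finset.sum_empty, mul_zero] at hY
    have : 0 < m * (A.L / 128 / (2 * Λ)) := by positivity
    linarith
  rcases le_total (A.L / 128) (∑ s, σ s * ∑ a, ∑ b,
    A.coef (A.scale c m (f s)) (js s) (f s) U a b * ind a b) with hcase | hcase
  · have hbig : A.L / 128 ≤ ∑ s, ∑ q, ∑ a, ∑ b, σ s * f s q *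
        A.early (A.scale c m (f s)) (js s) q a *
        (A.late (A.scale c m (f s)) (js s) q b / A.len q (A.N q)) *
        unsat (A.avg js σ) (m / γ ^ 3) U a b := by
      refine hcase.trans (le_of_eq ?_)
      refine Finset.sum_congr rfl fun s _ => ?_
      rw [sum_coef_unsat]
      simp only [Finset.mul_sum]
      exact Finset.sum_congr rfl fun q _ => Finset.sum_congr rfl fun a _ =>
        Finset.sum_congr rfl fun b _ => by ring
    obtain ⟨κ, hκ, Y, hYU, hY, hYm⟩ := h.exists_used_set hm hmix U hγ hp.Φ_eq (by positivity)
      hp.one_le hbig hp.pow_lt hp.K_le hp.log_w₀ hp.w₀_le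
    obtain ⟨X, hXE, hXc, hX⟩ := h.exists_climb_cut (js := js) hσ hσ1 hc hm hρ hγ hp.one_le hκ
      hp.log_card hlev hY
    exact ⟨X, hXE, Or.inl ⟨Y, hnonempty hY, hYU, hXc, fun j q hq hon => hYm j q hq
      fun i i' hii hi' => (hX _ _ (hon.reach hii.le hi')).le⟩⟩
  · have hcase' : A.L / 128 ≤ ∑ s, σ s * ∑ a, ∑ b,
        A.rev.coef (fun a b => A.scale c m (f s) b a) (js s) (f s) U' a b * ind b a := by linarith
    have hbig : A.L / 128 ≤ ∑ s, ∑ q, ∑ a, ∑ b, σ s * f s q *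
        A.rev.early (fun a b => A.scale c m (f s) b a) (js s) q a *
        (A.rev.late (fun a b => A.scale c m (f s) b a) (js s) q b / A.rev.len q (A.rev.N q)) *
        unsat (A.rev.avg js σ) (m / γ ^ 3) U' a b := by
      refine hcase'.trans (le_of_eq ?_)
      refine Finset.sum_congr rfl fun s _ => ?_
      have hind : ∀ a b, ind b a = if A.rev.avg js σ a b < cap then 1 else 0 := by
        intro a b
        simp only [ind, A.avg_rev]
      simp only [hind]
      rw [sum_coef_unsat]
      simp only [Finset.mul_sum]
      exact Finset.sum_congr rfl fun q _ => Finset.sum_congr rfl fun a _ =>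
        Finset.sum_congr rfl fun b _ => by ring
    obtain ⟨κ, hκ, Y, hYU, hY, hYm⟩ := h.reverse.exists_used_set hm hmixr U' hγ hp.Φ_eq
      (by positivity) hp.one_le hbig hp.pow_lt hp.K_le hp.log_w₀ hp.w₀_le
    obtain ⟨X, hXE, hXc, hX⟩ := h.exists_climb_cut (js := js) hσ hσ1 hc hm hρ hγ hp.one_le hκ
      hp.log_card hlev hY
    refine ⟨X, hXE, Or.inr ⟨Y, hnonempty hY, hYU, hXc, fun j q hq hon => hYm j q hq
      fun i i' hii hi' => ?_⟩⟩
    rw [A.avg_rev]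
    exact (hX _ _ (hon.rev_reach hii.le hi')).le

theorem mass_union (j : J) (q : Q) {U Y : Finset V} (hd : Disjoint Y U) :
    A.mass j q (Y ∪ U) = A.mass j q Y + A.mass j q U := by
  unfold mass
  rw [← Finset.sum_add_distrib]
  refine Finset.sum_congr rfl fun i _ => ?_
  by_cases h1 : A.vt q (i + 1) ∈ Y
  · have h2 : A.vt q (i + 1) ∉ U := Finset.disjoint_left.1 hd h1
    simp [h1, h2]
  · simp [h1]

/-- The averaged climb is linear in `F`, truncation by `min 1` is concave, and the coefficients do
not depend on `F` and are nonnegative. -/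
theorem concaveOn_payoff [Fintype J] (h : A.Good T D w₀ Φ Φin Φout) {c : V × V → ℝ}
    (hc : ∀ e, 0 ≤ c e) {m cap : ℝ} (hm : 0 < m) {U U' : Finset V}
    {E : Finset (V × V)} {j : J} {f : Q → ℝ} (hs : A.Strategy D c m E j f) {K : Set (J → ℝ)}
    (hK : Convex ℝ K) : ConcaveOn ℝ K fun F => A.payoff c m cap U U' F j f := by
  refine ⟨hK, fun F₁ _ F₂ _ p q hp hq hpq => ?_⟩
  simp only [payoff, smul_eq_mul, Finset.mul_sum]
  rw [← Finset.sum_add_distrib]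
  refine Finset.sum_le_sum fun a _ => ?_
  rw [← Finset.sum_add_distrib]
  refine Finset.sum_le_sum fun b _ => ?_
  have e : A.avg id (p • F₁ + q • F₂) a b = p * A.avg id F₁ a b + q * A.avg id F₂ a b := by
    simp only [avg, Pi.add_apply, Pi.smul_apply, smul_eq_mul, add_mul, Finset.sum_add_distrib,
      Finset.mul_sum, mul_assoc]
  rw [e]
  have h1 := h.coef₂_nonneg hc hm (U := U) (U' := U') hs a b
  have h2 : p * min 1 (A.avg id F₁ a b / cap) + q * min 1 (A.avg id F₂ a b / cap) ≤
      min 1 ((p * A.avg id F₁ a b + q * A.avg id F₂ a b) / cap) := by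
    refine le_min ?_ ?_
    · have := mul_le_mul_of_nonneg_left (min_le_left 1 (A.avg id F₁ a b / cap)) hp
      have := mul_le_mul_of_nonneg_left (min_le_left 1 (A.avg id F₂ a b / cap)) hq
      linarith
    · have := mul_le_mul_of_nonneg_left (min_le_right 1 (A.avg id F₁ a b / cap)) hp
      have := mul_le_mul_of_nonneg_left (min_le_right 1 (A.avg id F₂ a b / cap)) hq
      rw [add_div, mul_div_assoc, mul_div_assoc]
      linarith
  have h3 := mul_le_mul_of_nonneg_left h2 h1
  linarith

theorem continuous_payoff [Fintype J] {c : V × V → ℝ} {m cap : ℝ} {U U' : Finset V} {j : J}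
    {f : Q → ℝ} : Continuous fun F => A.payoff c m cap U U' F j f := by
  unfold payoff avg
  fun_prop

/-- All strategies can be destroyed by a cheap set of edges. -/
theorem exists_no_strategy [Fintype J] [Nonempty J] (h : A.Good T D w₀ Φ Φin Φout)
    {c : V × V → ℝ} (hc : ∀ e, 0 ≤ c e) (hin : ∀ a, ∑ b, c (b, a) * A.w b a ≤ Φin a)
    (hout : ∀ a, ∑ b, c (a, b) * A.w a b ≤ Φout a)
    {m ρ γ Λ : ℝ} {K : ℕ} (hp : Params A w₀ Φ m γ Λ K) (hρ : 0 < ρ) (n : ℕ) :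
    ∀ (E : Finset (V × V)) (U U' : Finset V), Uᶜ.card + U'ᶜ.card = n →
    (∀ j, ∑ e ∈ E, c e * max (A.lev j e.2 - A.lev j e.1) 0 ≤ A.L * (ρ * m)) →
    (∀ j q, D j q → A.On E q → A.mass j q U ≤ A.L / 16 * ((∑ y ∈ U, Φin y) / Φ)) →
    (∀ j q, D j q → A.On E q → A.rev.mass j q U' ≤ A.L / 16 * ((∑ y ∈ U', Φout y) / Φ)) →
    ∃ X ⊆ E, ∑ e ∈ X, c e ≤ 64 * ρ * γ ^ 3 * Λ + 2 ^ 39 * ρ * Λ ^ 4 * γ / A.L ^ 4 *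
      (∑ y ∈ Uᶜ, Φin y + ∑ y ∈ U'ᶜ, Φout y) ∧ ∀ j f, ¬ A.Strategy D c m (E \ X) j f := by
  have hL := h.L_pos
  have hm := hp.m_pos
  have hγ := hp.γ_pos
  have hΛ0 : 0 < Λ := by linarith [hp.one_le]
  have hΦ0 : 0 < Φ := by rw [hp.Φ_eq]; positivity
  have hB : 0 ≤ 2 ^ 39 * ρ * Λ ^ 4 * γ / A.L ^ 4 := by positivity
  have hfrac : ∀ (P : V → ℝ), (∀ v, 0 ≤ P v) → ∑ v, P v ≤ Φ → ∀ W : Finset V,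
      A.L / 16 * ((∑ y ∈ W, P y) / Φ) ≤ A.L / 16 := fun P hP hPs W =>
    mul_le_of_le_one_right (by positivity) (div_le_one_of_le₀
      ((Finset.sum_le_univ_sum_of_nonneg hP).trans hPs) hΦ0.le)
  have hun : ∀ P Q : Finset (V × V), ∑ e ∈ P ∪ Q, c e ≤ ∑ e ∈ P, c e + ∑ e ∈ Q, c e := by
    intro P Q
    rw [← Finset.sum_union_inter]
    exact le_add_of_nonneg_right (Finset.sum_nonneg fun e _ => hc e)
  have hcompl : ∀ (P : V → ℝ) {Y U : Finset V}, Disjoint Y U →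
      ∑ y ∈ Uᶜ, P y = ∑ y ∈ Y, P y + ∑ y ∈ (Y ∪ U)ᶜ, P y := by
    intro P Y U hd
    have e1 := Finset.sum_add_sum_compl U P
    have e2 := Finset.sum_add_sum_compl (Y ∪ U) P
    rw [Finset.sum_union hd] at e2
    linarith
  have hcard : ∀ {Y U : Finset V}, Y.Nonempty → Disjoint Y U → (Y ∪ U)ᶜ.card < Uᶜ.card := by
    intro Y U hY hd
    obtain ⟨y, hy⟩ := hY
    refine Finset.card_lt_card ((Finset.ssubset_iff_of_subset
      (Finset.compl_subset_compl.2 Finset.subset_union_right)).2 ⟨y, ?_, ?_⟩)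
    · exact Finset.mem_compl.2 (Finset.disjoint_left.1 hd hy)
    · simp [hy]
  -- Each gain marks a nonempty set `Y` of unused vertices as used, so the number of unused vertices
  -- drops. The cut is charged to the volume of `Y`. The record mass at used vertices stays
  -- proportional to their volume share, so it never exceeds the `L / 16` that the payoff bound
  -- tolerates.
  induction n using Nat.strong_induction_on with
  | _ n ih =>
  intro E U U' hn hlev hU hU'
  have hU1 : ∀ j q, D j q → A.On E q → A.mass j q U ≤ A.L / 16 := fun j q h1 h2 =>
    (hU j q h1 h2).trans (hfrac _ h.in_nonneg h.sum_in U)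
  have hU1' : ∀ j q, D j q → A.On E q → A.rev.mass j q U' ≤ A.L / 16 := fun j q h1 h2 =>
    (hU' j q h1 h2).trans (hfrac _ h.out_nonneg h.sum_out U')
  have hlev_sub : ∀ X : Finset (V × V), ∀ j,
      ∑ e ∈ E \ X, c e * max (A.lev j e.2 - A.lev j e.1) 0 ≤ A.L * (ρ * m) := fun X j =>
    (Finset.sum_le_sum_of_subset_of_nonneg Finset.sdiff_subset fun e _ _ =>
      mul_nonneg (hc e) (le_max_right _ _)).trans (hlev j)
  let St := {s : J × (Q → ℝ) // A.Strategy D c m E s.1 s.2}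
  rcases minimax_alternative (S := St) (K := stdSimplex ℝ J)
    (by classical exact ⟨_, single_mem_stdSimplex ℝ (Classical.arbitrary J)⟩)
    (isCompact_stdSimplex ℝ J) (convex_stdSimplex ℝ J)
    (fun s F => A.payoff c m (m / γ ^ 3) U U' F s.1.1 s.1.2)
    (fun s => h.concaveOn_payoff hc hm s.2 (convex_stdSimplex ℝ J))
    (fun s => continuous_payoff) (A.L / 64) with ⟨F, hF, hpay⟩ | ⟨Tm, σ, hσ, hσ1, hpay⟩
  · obtain ⟨X, hXE, hXc, hX⟩ := h.exists_hit hp.L_le hc hm hρ hγ hp.log_card hlev hF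
      (fun j f hs => hpay ⟨(j, f), hs⟩)
    refine ⟨X, hXE, hXc.trans (le_add_of_nonneg_right (mul_nonneg hB (add_nonneg ?_ ?_))), hX⟩
    · exact Finset.sum_nonneg fun y _ => h.in_nonneg y
    · exact Finset.sum_nonneg fun y _ => h.out_nonneg y
  · obtain ⟨X, hXE, hgain⟩ := h.exists_gain hc hin hout hp hρ hlev (S := Tm)
      (js := fun s => s.1.1.1) (f := fun s => s.1.1.2) hσ hσ1 (fun s => s.1.2) hU1 hU1' hpay
    have hmonoE : ∀ {q}, A.On (E \ X) q → A.On E q := fun hq => hq.mono Finset.sdiff_subset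
    rcases hgain with ⟨Y, hYne, hYU, hXc, hY⟩ | ⟨Y, hYne, hYU, hXc, hY⟩
    · obtain ⟨X', hX', hX'c, hX'n⟩ := ih ((Y ∪ U)ᶜ.card + U'ᶜ.card)
        (by have := hcard hYne hYU; omega) (E \ X) (Y ∪ U) U' rfl (hlev_sub X)
        (fun j q h1 h2 => by
          rw [mass_union j q hYU, Finset.sum_union hYU, add_div, mul_add]
          exact add_le_add (hY j q h1 h2) (hU j q h1 (hmonoE h2)))
        (fun j q h1 h2 => hU' j q h1 (hmonoE h2))
      refine ⟨X ∪ X', Finset.union_subset hXE (hX'.trans Finset.sdiff_subset), ?_, ?_⟩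
      · rw [hcompl Φin hYU]
        refine (hun _ _).trans ?_
        linarith
      · exact fun j f hs => hX'n j f (by rw [sdiff_sdiff_left]; exact hs)
    · obtain ⟨X', hX', hX'c, hX'n⟩ := ih (Uᶜ.card + (Y ∪ U')ᶜ.card)
        (by have := hcard hYne hYU; omega) (E \ X) U (Y ∪ U') rfl (hlev_sub X)
        (fun j q h1 h2 => hU j q h1 (hmonoE h2))
        (fun j q h1 h2 => by
          rw [mass_union j q hYU, Finset.sum_union hYU, add_div, mul_add]
          exact add_le_add (hY j q h1 h2) (hU' j q h1 (hmonoE h2)))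
      refine ⟨X ∪ X', Finset.union_subset hXE (hX'.trans Finset.sdiff_subset), ?_, ?_⟩
      · rw [hcompl Φout hYU]
        refine (hun _ _).trans ?_
        linarith
      · exact fun j f hs => hX'n j f (by rw [sdiff_sdiff_left]; exact hs)

end Good

end TrackSystem

end DirectedCut

/-! ### Paths, potentials, and the duality between flows and potentials -/

namespace DirectedCut

section Paths

variable {V : Type*}

/-- The directed graph with the given edges. -/
def ofEdges (E : Finset (V × V)) : Digraph V := ⟨fun a b => (a, b) ∈ E⟩

theorem pathEdges_cons_cons (a b : V) (l : List V) :
    pathEdges (a :: b :: l) = (a, b) :: pathEdges (b :: l) := rfl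

theorem pathEdges_append_singleton (p : List V) (a b : V) :
    pathEdges (p ++ [a, b]) = pathEdges (p ++ [a]) ++ [(a, b)] := by
  induction p with
  | nil => rfl
  | cons x p ih =>
    cases p with
    | nil => rfl
    | cons y p =>
      simp only [List.cons_append, pathEdges_cons_cons] at ih ⊢
      rw [ih]

theorem pathEdges_append_cons (p r : List V) (a : V) :
    pathEdges (p ++ a :: r) = pathEdges (p ++ [a]) ++ pathEdges (a :: r) := by
  induction p with
  | nil => rfl
  | cons x p ih =>
    cases p with
    | nil => rfl
    | cons y p =>
      simp only [List.cons_append, pathEdges_cons_cons] at ih ⊢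
      rw [ih]

theorem pathEdges_eq_map (d : V) (p : List V) : pathEdges p =
    (List.range (p.length - 1)).map fun i => (p.getD i d, p.getD (i + 1) d) := by
  apply List.ext_getElem
  · simp [pathEdges]
  · intro i h1 h2
    simp only [pathEdges, List.length_zip, List.length_tail, lt_min_iff] at h1
    simp [pathEdges, List.getElem_zip, List.getD_eq_getElem?_getD, h1.1,
      show i + 1 < p.length by omega]

theorem sum_pathEdges (d : V) (z : V × V → ℝ) (p : List V) : ((pathEdges p).map z).sum =
    ∑ i ∈ Finset.range (p.length - 1), z (p.getD i d, p.getD (i + 1) d) := by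
  rw [pathEdges_eq_map d, List.map_map, Finset.sum_range]
  rw [← List.sum_ofFn]
  congr 1
  apply List.ext_getElem <;> simp

theorem sum_pathEdges_nonneg {z : V × V → ℝ} (hz : ∀ e, 0 ≤ z e) (p : List V) :
    0 ≤ ((pathEdges p).map z).sum :=
  List.sum_nonneg (by simp only [List.mem_map]; rintro _ ⟨e, _, rfl⟩; exact hz e)

theorem isChain_iff_pathEdges {G : Digraph V} {p : List V} :
    p.IsChain G.Adj ↔ ∀ e ∈ pathEdges p, G.Adj e.1 e.2 := by
  induction p with
  | nil => simp [pathEdges]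
  | cons a p ih =>
    cases p with
    | nil => simp [pathEdges]
    | cons b p => rw [List.isChain_cons_cons, pathEdges_cons_cons, ih]; simp

theorem IsPath.append_singleton {G : Digraph V} {s t y : V} {p : List V} (hp : IsPath G s t p)
    (hy : G.Adj t y) (hyp : y ∉ p) : IsPath G s y (p ++ [y]) := by
  obtain ⟨h1, h2, h3, h4⟩ := hp
  refine ⟨?_, ?_, ?_, by simp⟩
  · refine h1.append (List.isChain_singleton _) ?_
    intro x hx z hz
    rw [h4] at hx
    simp only [Option.mem_def, Option.some.injEq, List.head?_cons] at hx hz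
    rwa [← hx, ← hz]
  · exact List.nodup_append.2 ⟨h2, List.nodup_singleton _, by
      intro a ha b hb; rw [List.mem_singleton] at hb; rintro rfl; exact hyp (hb ▸ ha)⟩
  · rw [List.head?_append, h3]; rfl

theorem IsPath.prefix {G : Digraph V} {s t y : V} {p r : List V} (hp : IsPath G s t (p ++ y :: r)) :
    IsPath G s y (p ++ [y]) := by
  obtain ⟨h1, h2, h3, -⟩ := hp
  have hpre : p ++ [y] <+: p ++ y :: r := ⟨r, by simp⟩
  refine ⟨h1.prefix hpre, h2.sublist hpre.sublist, ?_, by simp⟩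
  rw [← h3]
  cases p <;> rfl

/-- Path lengths that are at least `L` give a potential of height `L`. -/
theorem exists_potential {E : Finset (V × V)} {z : V × V → ℝ} (hz : ∀ e, 0 ≤ z e) {L : ℝ}
    (hL : 0 ≤ L) {u v : V}
    (h : ∀ p, IsPath (ofEdges E) u v p → L ≤ ((pathEdges p).map z).sum) :
    ∃ l : V → ℝ, l u = 0 ∧ l v = L ∧ ∀ e ∈ E, l e.2 - l e.1 ≤ z e := by
  -- Inserting `L` truncates the distance at `L` and keeps the set nonempty for unreachable
  -- vertices.
  let S : V → Set ℝ := fun x =>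
    insert L {r | ∃ p, IsPath (ofEdges E) u x p ∧ ((pathEdges p).map z).sum = r}
  have hne : ∀ x, (S x).Nonempty := fun x => ⟨L, Set.mem_insert _ _⟩
  have h0 : ∀ x, ∀ r ∈ S x, 0 ≤ r := by
    rintro x r (rfl | ⟨p, -, rfl⟩)
    · exact hL
    · exact sum_pathEdges_nonneg hz p
  have hbdd : ∀ x, BddBelow (S x) := fun x => ⟨0, fun r hr => h0 x r hr⟩
  refine ⟨fun x => sInf (S x), ?_, ?_, ?_⟩
  · refine le_antisymm (csInf_le (hbdd u) (Or.inr ⟨[u], ?_, ?_⟩)) (le_csInf (hne u) (h0 u))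
    · exact ⟨List.isChain_singleton _, List.nodup_singleton _, rfl, rfl⟩
    · simp [pathEdges]
  · refine le_antisymm (csInf_le (hbdd v) (Set.mem_insert _ _)) (le_csInf (hne v) ?_)
    rintro r (rfl | ⟨p, hp, rfl⟩)
    · exact le_rfl
    · exact h p hp
  · rintro ⟨x, y⟩ he
    change sInf (S y) - sInf (S x) ≤ z (x, y)
    rw [sub_le_comm]
    refine le_csInf (hne x) ?_
    rintro r (rfl | ⟨p, hp, rfl⟩)
    · linarith [csInf_le (hbdd y) (Set.mem_insert r _), hz (x, y)]
    · rw [sub_le_iff_le_add]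
      -- Paths are simple, so if `y` already lies on `p` the path to `x` is shortened to its prefix
      -- ending at `y` instead of being extended.
      by_cases hy : y ∈ p
      · obtain ⟨p₁, p₂, rfl⟩ := List.append_of_mem hy
        refine (csInf_le (hbdd y) (Or.inr ⟨_, hp.prefix, rfl⟩)).trans ?_
        rw [pathEdges_append_cons p₁ p₂, List.map_append, List.sum_append]
        linarith [sum_pathEdges_nonneg hz (y :: p₂), hz (x, y)]
      · refine (csInf_le (hbdd y) (Or.inr ⟨_, hp.append_singleton he hy, rfl⟩)).trans (le_of_eq ?_)
        obtain ⟨p', rfl⟩ : ∃ p', p = p' ++ [x] := by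
          have := hp.2.2.2
          rw [List.getLast?_eq_some_iff] at this
          exact this
        rw [List.append_assoc, List.singleton_append, pathEdges_append_singleton]
        simp

end Paths

/-- The pair `(u, v)` has a potential of height `L` on the edges `E` that respects the lengths `w`
and has total cost at most `B`. -/
def HasLevel {V : Type*} (c w : V × V → ℝ) (E : Finset (V × V)) (L B : ℝ) (u v : V) : Prop :=
  ∃ l : V → ℝ, l u = 0 ∧ l v = L ∧ (∀ e ∈ E, l e.2 - l e.1 ≤ w e) ∧
    ∑ e ∈ E, c e * max (l e.2 - l e.1) 0 ≤ B

/-- The track system of all simple vertex sequences. -/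
def pathSystem {V J : Type*} (d : V) (w : V × V → ℝ) (lev : J → V → ℝ) (L : ℝ) :
    TrackSystem V {l : List V // l.Nodup} J where
  N q := q.1.length - 1
  vt q i := q.1.getD i d
  w a b := w (a, b)
  lev := lev
  L := L

section PathSystem

variable {V J : Type*} {d : V} {w : V × V → ℝ} {lev : J → V → ℝ} {L : ℝ}

theorem pathSystem_len (q : {l : List V // l.Nodup}) : (pathSystem d w lev L).len q
    ((pathSystem d w lev L).N q) = ((pathEdges q.1).map w).sum :=
  (sum_pathEdges d w q.1).symm

theorem pathSystem_on {E : Finset (V × V)} {q : {l : List V // l.Nodup}} :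
    (pathSystem d w lev L).On E q ↔ ∀ e ∈ pathEdges q.1, e ∈ E := by
  rw [pathEdges_eq_map d]
  simp [TrackSystem.On, pathSystem]

theorem pathSystem_isPath {E : Finset (V × V)} {s t : V} {q : {l : List V // l.Nodup}}
    (hq : IsPath (ofEdges E) s t q.1) : (pathSystem d w lev L).On E q ∧
      (pathSystem d w lev L).vt q 0 = s ∧
      (pathSystem d w lev L).vt q ((pathSystem d w lev L).N q) = t := by
  obtain ⟨h1, -, h3, h4⟩ := hq
  refine ⟨pathSystem_on.2 (isChain_iff_pathEdges.1 h1), ?_, ?_⟩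
  · simp only [pathSystem, List.getD_eq_getElem?_getD, ← List.head?_eq_getElem?, h3, Option.getD_some]
  · simp only [pathSystem, List.getD_eq_getElem?_getD, ← List.getLast?_eq_getElem?, h4,
      Option.getD_some]

theorem pathSystem_inj {q : {l : List V // l.Nodup}} (hq : q.1 ≠ []) {i i' : ℕ}
    (hi : i ≤ (pathSystem d w lev L).N q) (hi' : i' ≤ (pathSystem d w lev L).N q)
    (h : (pathSystem d w lev L).vt q i = (pathSystem d w lev L).vt q i') : i = i' := by
  have h0 := List.length_pos_of_ne_nil hq
  simp only [pathSystem] at hi hi' h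
  rw [List.getD_eq_getElem _ _ (by omega), List.getD_eq_getElem _ _ (by omega)] at h
  exact (q.2.getElem_inj_iff).1 h

/-- Duality between low-excess path distributions and cheap potentials. -/
theorem strategy_or_hasLevel [Fintype V] [DecidableEq V] {c : V × V → ℝ} (hc : ∀ e, 0 ≤ c e) (hw : ∀ e, 0 ≤ w e)
    {m : ℝ} (hm : 0 < m) (hL : 0 < L) {E : Finset (V × V)} {u v : V} {j : J}
    {D : J → {l : List V // l.Nodup} → Prop} (hD : ∀ q, IsPath (ofEdges E) u v q.1 → D j q) :
    (∃ f, (pathSystem d w lev L).Strategy D c m E j f) ∨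
      HasLevel c w E (L / 64) (L / 64 * m) u v := by
  classical
  set A := pathSystem d w lev L with hA
  let Q := {l : List V // l.Nodup}
  let S := {q : Q // IsPath (ofEdges E) u v q.1}
  have hlin : ∀ q : Q, ∃ T : (V × V → ℝ) →L[ℝ] ℝ, ∀ z, T z =
      ∑ i ∈ Finset.range (A.N q), z (A.vt q i, A.vt q (i + 1)) - (∑ e, c e * z e) / m := by
    intro q
    refine ⟨∑ i ∈ Finset.range (A.N q), ContinuousLinearMap.proj (A.vt q i, A.vt q (i + 1)) -
      (1 / m) • ∑ e, c e • ContinuousLinearMap.proj e, fun z => ?_⟩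
    simp
    ring
  choose φ hφ using hlin
  -- Lengths `z` between 0 and `w` play against paths, with payoff the `z`-length of the path minus
  -- `⟨c, z⟩ / m`. Good lengths give a potential; a mixture of paths that beats all lengths is a
  -- strategy.
  rcases minimax_alternative (S := S) (K := Set.Icc (0 : V × V → ℝ) w) ⟨0, le_rfl, hw⟩
    isCompact_Icc (convex_Icc 0 w) (fun s z => φ s.1 z)
    (fun s => (φ s.1).toLinearMap.concaveOn (convex_Icc 0 w)) (fun s => (φ s.1).continuous) (L / 64)
    with ⟨z, hz, hzs⟩ | ⟨T, σ, hσ, hσ1, hT⟩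
  · right
    set κ := (∑ e, c e * z e) / m with hκ
    have hsum : 0 ≤ ∑ e, c e * z e := Finset.sum_nonneg fun e _ => mul_nonneg (hc e) (hz.1 e)
    have hκ0 : 0 ≤ κ := div_nonneg hsum hm.le
    -- All paths have `z`-length at least `L / 64 + κ`; this factor brings the bound down to `L /
    -- 64` and at the same time the cost `κ * m` to at most `L / 64 * m`.
    set r := (L / 64) / (L / 64 + κ) with hr
    have hr0 : 0 ≤ r := by positivity
    have hr1 : r ≤ 1 := div_le_one_of_le₀ (by linarith) (by positivity)
    have hz' : ∀ e, 0 ≤ r * z e := fun e => mul_nonneg hr0 (hz.1 e)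
    obtain ⟨l, hl0, hl1, hl⟩ := exists_potential (E := E) (u := u) (v := v)
      (z := fun e => r * z e) hz' (by positivity : 0 ≤ L / 64) (fun p hp => by
        have h1 := hzs ⟨⟨p, hp.2.1⟩, hp⟩
        rw [hφ] at h1
        have h2 : L / 64 + κ ≤ ((pathEdges p).map z).sum := by
          rw [sum_pathEdges d z p]
          change L / 64 ≤ ∑ i ∈ Finset.range (p.length - 1), z (p.getD i d, p.getD (i + 1) d) - κ at h1
          linarith
        rw [List.sum_map_mul_left]
        calc L / 64 = r * (L / 64 + κ) := by rw [hr]; field_simp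
          _ ≤ _ := mul_le_mul_of_nonneg_left h2 hr0)
    refine ⟨l, hl0, hl1, fun e he => (hl e he).trans ?_, ?_⟩
    · exact (mul_le_of_le_one_left (hz.1 e) hr1).trans (hz.2 e)
    · calc ∑ e ∈ E, c e * max (l e.2 - l e.1) 0 ≤ ∑ e ∈ E, c e * (r * z e) :=
            Finset.sum_le_sum fun e he => mul_le_mul_of_nonneg_left (max_le (hl e he) (hz' e)) (hc e)
        _ ≤ ∑ e, c e * (r * z e) := Finset.sum_le_sum_of_subset_of_nonneg (Finset.subset_univ _)
            fun e _ _ => mul_nonneg (hc e) (hz' e)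
        _ = r * ∑ e, c e * z e := by
            rw [Finset.mul_sum]; exact Finset.sum_congr rfl fun e _ => by ring
        _ = r * (κ * m) := by rw [hκ, div_mul_cancel₀ _ hm.ne']
        _ ≤ L / 64 * m := by
            rw [← mul_assoc]
            refine mul_le_mul_of_nonneg_right ?_ hm.le
            rw [hr, div_mul_eq_mul_div, div_le_iff₀ (by positivity)]
            nlinarith
  · left
    let f : Q → ℝ := fun q => ∑ s, if s.1.1 = q then σ s else 0
    have hf : ∀ g : Q → ℝ, ∑ q, f q * g q = ∑ s, σ s * g s.1.1 := by
      intro g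
      simp only [f, Finset.sum_mul]
      rw [Finset.sum_comm]
      exact Finset.sum_congr rfl fun s _ => (Finset.sum_eq_single s.1.1
        (fun q _ hq => by rw [if_neg (Ne.symm hq), zero_mul])
        (fun h => absurd (Finset.mem_univ _) h)).trans (by rw [if_pos rfl])
    refine ⟨f, ?_, ?_, ?_, ?_⟩
    · exact fun q => Finset.sum_nonneg fun s _ => by split_ifs <;> simp [hσ]
    · have := hf fun _ => 1
      simp only [mul_one] at this
      exact this.trans hσ1
    · intro q hq
      obtain ⟨s, -, hs⟩ := Finset.exists_ne_zero_of_sum_ne_zero hq.ne'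
      have hsq : s.1.1 = q := by
        by_contra h
        exact hs (if_neg h)
      subst hsq
      exact ⟨hD _ s.1.2, (pathSystem_isPath s.1.2).1⟩
    -- The best response to `f`: full length exactly on the edges whose flow exceeds the capacity.
    -- Its payoff is the excess of `f`.
    · let z : V × V → ℝ := fun e => if c e / m < A.fl f e.1 e.2 then w e else 0
      have h1 := hT z ⟨fun e => by simp only [z]; split_ifs <;> simp [hw], fun e => by
        simp only [z]; split_ifs <;> simp [hw]⟩
      simp only [hφ, mul_sub, Finset.sum_sub_distrib, ← Finset.sum_mul, hσ1, one_mul] at h1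
      have h2 := A.sum_steps f (fun a b => z (a, b))
      rw [hf] at h2
      rw [h2] at h1
      have h3 : ∑ a, ∑ b, A.w a b * max (A.fl f a b - c (a, b) / m) 0 =
          ∑ a, ∑ b, z (a, b) * A.fl f a b - (∑ e, c e * z e) / m := by
        rw [Fintype.sum_prod_type, Finset.sum_div, ← Finset.sum_sub_distrib]
        refine Finset.sum_congr rfl fun a _ => ?_
        rw [Finset.sum_div, ← Finset.sum_sub_distrib]
        refine Finset.sum_congr rfl fun b _ => ?_
        change w (a, b) * _ = _
        simp only [z]
        split_ifs with h
        · rw [max_eq_left (by linarith)]; ring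
        · rw [max_eq_right (by linarith)]; ring
      rw [h3]
      exact h1.le

end PathSystem

end DirectedCut

/-! ### One round: cheaper potentials for all demands -/

namespace DirectedCut

section Step

variable {V : Type*}

theorem IsPath.mono {E E' : Finset (V × V)} (h : E ⊆ E') {s t : V} {p : List V}
    (hp : IsPath (ofEdges E) s t p) : IsPath (ofEdges E') s t p :=
  ⟨hp.1.imp fun _ _ h' => h h', hp.2⟩

variable [Fintype V] [DecidableEq V]

/-- The low diameter decomposition at scale `w₀`. -/
theorem exists_acyclic_cut [Nonempty V] {c w : V × V → ℝ} (hc : ∀ e, 0 ≤ c e) (hw : ∀ e, 0 ≤ w e)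
    {γ Λ w₀ : ℝ} {K : ℕ} (hγ : 0 < γ) (hΦ : ∑ e, c e * w e = γ ^ 2) (hw₀ : 0 < w₀)
    (hK : 3 * (Fintype.card V : ℝ) < 2 ^ K) (hKΛ : K ≤ Λ)
    (hlog : Real.log (3 * Fintype.card V) ≤ Λ) (E : Finset (V × V)) :
    ∃ X ⊆ E, ∑ e ∈ X, c e ≤ 72 * Λ ^ 2 * γ ^ 2 / w₀ ∧
      ∀ l : V → ℝ, (∀ e ∈ E \ X, l e.2 - l e.1 ≤ w e) → ∀ y y',
        Relation.ReflTransGen (fun a b => (a, b) ∈ E \ X) y y' →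
        Relation.ReflTransGen (fun a b => (a, b) ∈ E \ X) y' y → l y' - l y ≤ w₀ := by
  set n : ℝ := (Fintype.card V : ℝ) with hn
  have hn1 : 1 ≤ n := by rw [hn]; exact_mod_cast Fintype.card_pos
  have hn0 : 0 < n := by linarith
  have hcw : ∀ e, 0 ≤ c e * w e := fun e => mul_nonneg (hc e) (hw e)
  have hv₀ : 0 < γ ^ 2 / n := by positivity
  -- The last summand gives each vertex volume at least `γ ^ 2 / n`, so the ratio of total to least
  -- volume, and with it the logarithm, is controlled by `3 * n`.
  let μ : V → ℝ := fun v => ∑ b, c (v, b) * w (v, b) + ∑ a, c (a, v) * w (a, v) + γ ^ 2 / n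
  have hμ : ∑ v, μ v = 3 * γ ^ 2 := by
    simp only [μ, Finset.sum_add_distrib, Finset.sum_const, Finset.card_univ, nsmul_eq_mul]
    have h1 : ∑ a, ∑ b, c (a, b) * w (a, b) = γ ^ 2 := by rw [← hΦ, Fintype.sum_prod_type]
    have h2 : ∑ b, ∑ a, c (a, b) * w (a, b) = γ ^ 2 := by rw [← h1, Finset.sum_comm]
    rw [h1, h2, ← hn, mul_div_cancel₀ _ hn0.ne']
    ring
  have hout0 : ∀ a, 0 ≤ ∑ b, c (a, b) * w (a, b) := fun a => Finset.sum_nonneg fun b _ => hcw _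
  have hin0 : ∀ b, 0 ≤ ∑ a, c (a, b) * w (a, b) := fun b => Finset.sum_nonneg fun a _ => hcw _
  obtain ⟨X, hXE, hcost, hX⟩ := exists_lowDiameter_cut c w hc hw μ hv₀
    (fun v => by simp only [μ]; linarith [hout0 v, hin0 v])
    (fun a => by simp only [μ]; linarith [hin0 a])
    (fun a => by simp only [μ]; linarith [hout0 a]) E hw₀ (K := K) (by
      rw [hμ, mul_div_assoc', lt_div_iff₀ hn0]
      nlinarith [sq_pos_of_pos hγ])
  refine ⟨X, hXE, hcost.trans ?_, hX⟩
  have e1 : 3 * γ ^ 2 / (γ ^ 2 / n) = 3 * n := by field_simp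
  rw [hμ, e1]
  have hl2 : 1 / 2 ≤ Real.log 2 := by linarith [Real.log_two_gt_d9]
  have hlog0 : 0 ≤ Real.log (3 * n) := Real.log_nonneg (by linarith)
  have hΛ0 : 0 ≤ Λ := hlog0.trans hlog
  calc 12 * K / w₀ / Real.log 2 * (3 * γ ^ 2 * Real.log (3 * n))
      ≤ 12 * Λ / w₀ / (1 / 2) * (3 * γ ^ 2 * Λ) := by gcongr
    _ = 72 * Λ ^ 2 * γ ^ 2 / w₀ := by ring

/-- Given cheap potentials for all demands, deleting few edges allows cheaper ones. -/
theorem exists_cheaper_levels [Nonempty V] {c w : V × V → ℝ} (hc : ∀ e, 0 ≤ c e)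
    (hw : ∀ e, 0 ≤ w e) {P : Set (V × V)} {L m ρ γ Λ w₀ : ℝ} {K K' : ℕ} (hL : 0 < L)
    (hL2 : L ≤ 1 / 2) (hm : 0 < m) (hρ : 0 < ρ) (hγ : 0 < γ) (hΦ : ∑ e, c e * w e = γ ^ 2)
    (hw₀ : 0 < w₀) (hΛ1 : 1 ≤ Λ) (hlogc : 1 + 2 * Real.log (Fintype.card V) ≤ Λ)
    (hlogw : 1 + Real.log (1 / w₀) ≤ Λ) (hlog3 : Real.log (3 * Fintype.card V) ≤ Λ)
    (hK : (1 / 2 : ℝ) ^ K < L / 128 * m / (2 * γ ^ 2)) (hKΛ : K ≤ Λ)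
    (hK' : 3 * (Fintype.card V : ℝ) < 2 ^ K') (hKΛ' : K' ≤ Λ) (hwL : 16 * w₀ ≤ L)
    (hwγ : w₀ ≤ (L / 16) ^ 2 * (L / 128 / (2 * Λ)) / γ / 120) {E : Finset (V × V)}
    (hwE : ∀ e ∈ E, w e ≤ w₀) (hin : ∀ e ∈ E, w e ≤ ∑ a, c (a, e.2) * w (a, e.2))
    (hout : ∀ e ∈ E, w e ≤ ∑ b, c (e.1, b) * w (e.1, b))
    (hlen : ∀ s t, (s, t) ∈ P → ∀ p, IsPath (ofEdges E) s t p → 1 ≤ ((pathEdges p).map w).sum)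
    (hlev : ∀ s t, (s, t) ∈ P → HasLevel c w E L (L * (ρ * m)) s t) :
    ∃ X ⊆ E, ∑ e ∈ X, c e ≤ 72 * Λ ^ 2 * γ ^ 2 / w₀ + (64 * ρ * γ ^ 3 * Λ +
        2 ^ 40 * ρ * Λ ^ 4 * γ ^ 3 / L ^ 4) ∧
      ∀ s t, (s, t) ∈ P → HasLevel c w (E \ X) (L / 64) (L / 64 * m) s t := by
  classical
  obtain ⟨X₁, hX₁, hcost₁, hacyc⟩ := exists_acyclic_cut hc hw hγ hΦ hw₀ hK' hKΛ' hlog3 E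
  have hcw : ∀ e, 0 ≤ c e * w e := fun e => mul_nonneg (hc e) (hw e)
  -- Levels are indexed by all pairs; pairs outside `P` receive the zero potential.
  have hex : ∀ j : V × V, ∃ l : V → ℝ, (∀ e ∈ E, l e.2 - l e.1 ≤ w e) ∧
      ∑ e ∈ E, c e * max (l e.2 - l e.1) 0 ≤ L * (ρ * m) ∧ (j ∈ P → l j.1 = 0 ∧ l j.2 = L) := by
    intro j
    by_cases hj : j ∈ P
    · obtain ⟨l, h1, h2, h3, h4⟩ := hlev j.1 j.2 hj
      exact ⟨l, h3, h4, fun _ => ⟨h1, h2⟩⟩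
    · exact ⟨0, fun e _ => by simpa using hw e, by simpa using by positivity, fun h => absurd h hj⟩
  choose lev hlip hlevc hends using hex
  let d : V := Classical.arbitrary V
  let A := pathSystem d w lev L
  let T : {l : List V // l.Nodup} → Prop := fun q => q.1 ≠ [] ∧ A.On (E \ X₁) q
  let D : V × V → {l : List V // l.Nodup} → Prop := fun j q =>
    j ∈ P ∧ IsPath (ofEdges (E \ X₁)) j.1 j.2 q.1
  have hsub : E \ X₁ ⊆ E := Finset.sdiff_subset
  have h1 : ∑ a, ∑ b, c (a, b) * w (a, b) = γ ^ 2 := by rw [← hΦ, Fintype.sum_prod_type]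
  have h2 : ∑ b, ∑ a, c (a, b) * w (a, b) = γ ^ 2 := by rw [← h1, Finset.sum_comm]
  have hgood : A.Good T D w₀ (γ ^ 2) (fun v => ∑ a, c (a, v) * w (a, v))
      (fun v => ∑ b, c (v, b) * w (v, b)) :=
    { L_pos := hL
      L_le := hL2.trans (by norm_num)
      w₀_pos := hw₀
      w₀_le := hwL
      D_T := fun j q hq => ⟨fun h => by have := hq.2.2.2.1; simp [h] at this,
        (pathSystem_isPath hq.2).1⟩
      D_start := fun j q hq => by
        rw [(pathSystem_isPath hq.2).2.1]; exact (hends j hq.1).1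
      D_end := fun j q hq => by
        rw [(pathSystem_isPath hq.2).2.2]; exact (hends j hq.1).2
      D_len := fun j q hq => by
        rw [pathSystem_len]; exact hlen _ _ hq.1 _ (hq.2.mono hsub)
      inj := fun q hq i i' hi hi' h => pathSystem_inj hq.1 hi hi' h
      w_nonneg := fun a b => hw _
      lip := fun q hq j i hi => hlip j _ (hsub (hq.2 i hi))
      w_le := fun q hq i hi => hwE _ (hsub (hq.2 i hi))
      w_le_in := fun q hq i hi => hin _ (hsub (hq.2 i hi))
      w_le_out := fun q hq i hi => hout _ (hsub (hq.2 i hi))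
      order := fun p q hp hq i i' k k' hi hi' hk hk' e1 e2 j => by
        refine hacyc (lev j) (fun e he => hlip j e (hsub he)) _ _ (hp.2.reach hi.le hi') ?_
        have := hq.2.reach hk.le hk'
        rwa [← e1, ← e2] at this
      in_nonneg := fun v => Finset.sum_nonneg fun a _ => hcw _
      out_nonneg := fun v => Finset.sum_nonneg fun a _ => hcw _
      sum_in := h2.le
      sum_out := h1.le }
  have hp : TrackSystem.Good.Params A w₀ (γ ^ 2) m γ Λ K :=
    ⟨hm, hγ, rfl, hΛ1, hlogc, hlogw, hK, hKΛ, hwγ, hL2⟩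
  -- No vertex is used at the start. The in- and out-volumes add up to `2 * γ ^ 2`, which turns the
  -- constant `2 ^ 39` into `2 ^ 40`.
  obtain ⟨X₂, hX₂, hcost₂, hno⟩ := hgood.exists_no_strategy hc (fun a => le_rfl) (fun a => le_rfl)
    hp hρ _ (E \ X₁) ∅ ∅ rfl
    (fun j => (Finset.sum_le_sum_of_subset_of_nonneg hsub fun e _ _ =>
      mul_nonneg (hc e) (le_max_right _ _)).trans (hlevc j))
    (fun j q _ _ => by simp [TrackSystem.mass]) (fun j q _ _ => by simp [TrackSystem.mass])
  have hun : ∑ e ∈ X₁ ∪ X₂, c e ≤ ∑ e ∈ X₁, c e + ∑ e ∈ X₂, c e := by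
    rw [← Finset.sum_union_inter]
    exact le_add_of_nonneg_right (Finset.sum_nonneg fun e _ => hc e)
  refine ⟨X₁ ∪ X₂, Finset.union_subset hX₁ (hX₂.trans hsub), ?_, fun s t hst => ?_⟩
  · refine hun.trans (add_le_add hcost₁ (hcost₂.trans (le_of_eq ?_)))
    simp only [Finset.compl_empty, h1, h2, show A.L = L from rfl]
    ring
  · have hE : E \ (X₁ ∪ X₂) = (E \ X₁) \ X₂ := by rw [sdiff_sdiff_left]; rfl
    rw [hE]
    refine (strategy_or_hasLevel (d := d) (lev := lev) (j := (s, t)) (D := D) hc hw hm hL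
      fun q hq => ⟨hst, hq.mono Finset.sdiff_subset⟩).resolve_left ?_
    rintro ⟨f, hf⟩
    exact hno _ _ hf

end Step

end DirectedCut

/-! ### Iterating the rounds until no path survives -/

namespace DirectedCut

section Chain

variable {V : Type*}

theorem pathEdges_nodup {p : List V} (hp : p.Nodup) : (pathEdges p).Nodup := by
  induction p with
  | nil => simp [pathEdges]
  | cons a p ih =>
    cases p with
    | nil => simp [pathEdges]
    | cons b p =>
      rw [pathEdges_cons_cons, List.nodup_cons]
      refine ⟨fun h => ?_, ih hp.of_cons⟩
      exact (List.nodup_cons.1 hp).1 (List.of_mem_zip h).1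

/-- A cheap potential rules out paths of expensive edges. -/
theorem HasLevel.not_isPath {c w : V × V → ℝ} {E : Finset (V × V)} {L m : ℝ}
    {u v : V} (h : HasLevel c w E L (L * m) u v) (hL : 0 < L) {c₀ : ℝ} (hc₀ : m < c₀)
    (hcE : ∀ e ∈ E, c₀ ≤ c e) (hc0 : 0 < c₀) (p : List V) : ¬ IsPath (ofEdges E) u v p := by
  classical
  intro hp
  obtain ⟨l, hu, hv, -, hcost⟩ := h
  have hE := isChain_iff_pathEdges.1 hp.1
  -- The potential rises by `L` along the path. As every edge costs at least `c₀`, the positive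
  -- increments cost at least `c₀ * L`, more than the allowed `L * m`.
  have htel : ((pathEdges p).map fun e => l e.2 - l e.1).sum = L := by
    have h1 := pathSystem_isPath (d := u) (w := fun _ => 0) (lev := fun _ : Unit => l) (L := L)
      (q := ⟨p, hp.2.1⟩) hp
    simp only [pathSystem] at h1
    rw [sum_pathEdges u, Finset.sum_range_sub (fun i => l (p.getD i u)), h1.2.1, h1.2.2, hu, hv,
      sub_zero]
  have h2 : L ≤ ((pathEdges p).map fun e => max (l e.2 - l e.1) 0).sum := by
    rw [← htel]
    exact List.sum_le_sum fun e _ => le_max_left _ _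
  rw [← List.sum_toFinset _ (pathEdges_nodup hp.2.1)] at h2
  have h3 : c₀ * L ≤ L * m := by
    refine le_trans ?_ hcost
    calc c₀ * L ≤ c₀ * ∑ e ∈ (pathEdges p).toFinset, max (l e.2 - l e.1) 0 :=
          mul_le_mul_of_nonneg_left h2 hc0.le
      _ ≤ c₀ * ∑ e ∈ E, max (l e.2 - l e.1) 0 := by
          refine mul_le_mul_of_nonneg_left (Finset.sum_le_sum_of_subset_of_nonneg ?_
            fun e _ _ => le_max_right _ _) hc0.le
          exact fun e he => hE e (List.mem_toFinset.1 he)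
      _ ≤ _ := by
          rw [Finset.mul_sum]
          exact Finset.sum_le_sum fun e he =>
            mul_le_mul_of_nonneg_right (hcE e he) (le_max_right _ _)
  nlinarith

variable [Fintype V] [DecidableEq V]

/-- Iterating `exists_cheaper_levels`. -/
theorem exists_chain_cut [Nonempty V] {c w : V × V → ℝ} (hc : ∀ e, 0 ≤ c e)
    (hw : ∀ e, 0 ≤ w e) {P : Set (V × V)} {L m ρ γ Λ w₀ : ℝ} {K K' : ℕ} (hL : 0 < L)
    (hm : 0 < m) (hρ : 1 ≤ ρ) (hγ : 0 < γ) (hΦ : ∑ e, c e * w e = γ ^ 2)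
    (hw₀ : 0 < w₀) (hΛ1 : 1 ≤ Λ) (hlogc : 1 + 2 * Real.log (Fintype.card V) ≤ Λ)
    (hlogw : 1 + Real.log (1 / w₀) ≤ Λ) (hlog3 : Real.log (3 * Fintype.card V) ≤ Λ)
    (hK : (1 / 2 : ℝ) ^ K < L / 128 * m / (2 * γ ^ 2)) (hKΛ : K ≤ Λ)
    (hK' : 3 * (Fintype.card V : ℝ) < 2 ^ K') (hKΛ' : K' ≤ Λ) (hwL : 16 * w₀ ≤ L)
    (hwγ : w₀ ≤ (L / 16) ^ 2 * (L / 128 / (2 * Λ)) / γ / 120) (k : ℕ) :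
    ∀ {E : Finset (V × V)}, 64 ^ k * L ≤ 1 / 2 → (∀ e ∈ E, w e ≤ w₀) →
    (∀ e ∈ E, w e ≤ ∑ a, c (a, e.2) * w (a, e.2)) →
    (∀ e ∈ E, w e ≤ ∑ b, c (e.1, b) * w (e.1, b)) →
    (∀ s t, (s, t) ∈ P → ∀ p, IsPath (ofEdges E) s t p → 1 ≤ ((pathEdges p).map w).sum) →
    (∀ s t, (s, t) ∈ P → HasLevel c w E (64 ^ k * L) (64 ^ k * L * (ρ ^ k * m)) s t) →
    ∃ X ⊆ E, ∑ e ∈ X, c e ≤ k * (72 * Λ ^ 2 * γ ^ 2 / w₀ + (64 * ρ * γ ^ 3 * Λ +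
        2 ^ 40 * ρ * Λ ^ 4 * γ ^ 3 / L ^ 4)) ∧
      ∀ s t, (s, t) ∈ P → HasLevel c w (E \ X) L (L * m) s t := by
  induction k with
  | zero =>
    intro E _ _ _ _ _ h
    refine ⟨∅, Finset.empty_subset _, by simp, fun s t hst => ?_⟩
    simpa using h s t hst
  | succ k ih =>
    intro E hk hwE hin hout hlen hlev
    have hρ0 : 0 < ρ := by linarith
    have h64 : (1 : ℝ) ≤ 64 ^ (k + 1) := one_le_pow₀ (by norm_num)
    have hρk : 1 ≤ ρ ^ k := one_le_pow₀ hρ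
    have hLk : L ≤ 64 ^ (k + 1) * L := le_mul_of_one_le_left hL.le h64
    have hmk : m ≤ ρ ^ k * m := le_mul_of_one_le_left hm.le hρk
    -- One round divides the height by 64 and the cost per unit height by `ρ`. Its side conditions
    -- are weakest at large height and cost, so those at the final `L` and `m` suffice for every
    -- round.
    obtain ⟨X, hXE, hcost, hX⟩ := exists_cheaper_levels (L := 64 ^ (k + 1) * L) (m := ρ ^ k * m)
      (ρ := ρ) (P := P) (E := E) hc hw (by positivity) hk (by positivity) hρ0 hγ hΦ hw₀ hΛ1 hlogc
      hlogw hlog3 (hK.trans_le (by gcongr)) hKΛ hK' hKΛ' (hwL.trans hLk)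
      (hwγ.trans (by gcongr)) hwE hin hout hlen (fun s t hst => by
        have := hlev s t hst
        rwa [pow_succ' ρ, mul_assoc ρ] at this)
    have hsub : E \ X ⊆ E := Finset.sdiff_subset
    obtain ⟨X', hX', hcost', hlev'⟩ := ih (E := E \ X)
      (le_trans (by gcongr <;> norm_num) hk)
      (fun e he => hwE e (hsub he)) (fun e he => hin e (hsub he)) (fun e he => hout e (hsub he))
      (fun s t hst p hp => hlen s t hst p (hp.mono hsub)) (fun s t hst => by
        have := hX s t hst
        rwa [show (64 : ℝ) ^ (k + 1) * L / 64 = 64 ^ k * L by ring] at this)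
    refine ⟨X ∪ X', Finset.union_subset hXE (hX'.trans hsub), ?_, fun s t hst => ?_⟩
    · have hun : ∑ e ∈ X ∪ X', c e ≤ ∑ e ∈ X, c e + ∑ e ∈ X', c e := by
        rw [← Finset.sum_union_inter]
        exact le_add_of_nonneg_right (Finset.sum_nonneg fun e _ => hc e)
      have h5 : 2 ^ 40 * ρ * Λ ^ 4 * γ ^ 3 / (64 ^ (k + 1) * L) ^ 4 ≤
          2 ^ 40 * ρ * Λ ^ 4 * γ ^ 3 / L ^ 4 := by gcongr
      push_cast
      linarith
    · rw [show E \ (X ∪ X') = (E \ X) \ X' by rw [sdiff_sdiff_left]; rfl]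
      exact hlev' s t hst

/-- Markov's inequality; when `φ = 0` all terms `c i * w i` vanish, so the selected costs are zero.
Applied to the edges at one vertex, with `φ` its volume, it prices the removal of edges longer than
that volume. -/
theorem sum_cost_le_one {ι : Type*} (s : Finset ι) {c w : ι → ℝ} (hc : ∀ i, 0 ≤ c i)
    (hw : ∀ i, 0 ≤ w i) {φ : ℝ} (hφ : ∑ i ∈ s, c i * w i ≤ φ) :
    ∑ i ∈ s with φ < w i, c i ≤ 1 := by
  have hφ0 : 0 ≤ φ := (Finset.sum_nonneg fun i _ => mul_nonneg (hc i) (hw i)).trans hφ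
  rcases hφ0.eq_or_lt with h0 | h0
  · refine (Finset.sum_eq_zero fun i hi => ?_).le.trans zero_le_one
    obtain ⟨his, hi⟩ := Finset.mem_filter.1 hi
    have h1 : c i * w i ≤ 0 := (Finset.single_le_sum (f := fun i => c i * w i)
      (fun i _ => mul_nonneg (hc i) (hw i)) his).trans (hφ.trans h0.ge)
    nlinarith [hc i]
  · have h1 : (∑ i ∈ s with φ < w i, c i) * φ ≤ φ := by
      refine le_trans ?_ hφ
      rw [Finset.sum_mul]
      refine (Finset.sum_le_sum fun i hi => mul_le_mul_of_nonneg_left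
        (Finset.mem_filter.1 hi).2.le (hc i)).trans ?_
      exact Finset.sum_le_sum_of_subset_of_nonneg (Finset.filter_subset _ _)
        fun i _ _ => mul_nonneg (hc i) (hw i)
    nlinarith

/-- Edges that are cheap, long, or long compared to the volume at an endpoint can be deleted. -/
theorem exists_regular_cut [Nonempty V] {c w : V × V → ℝ} (hc : ∀ e, 0 ≤ c e)
    (hw : ∀ e, 0 ≤ w e) {w₀ : ℝ} (hw₀ : 0 < w₀) (E : Finset (V × V)) :
    ∃ X ⊆ E, ∑ e ∈ X, c e ≤ 3 * Fintype.card V + (∑ e, c e * w e) / w₀ ∧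
      ∀ e ∈ E \ X, 1 / (Fintype.card V : ℝ) ≤ c e ∧ w e ≤ w₀ ∧
        w e ≤ ∑ a, c (a, e.2) * w (a, e.2) ∧ w e ≤ ∑ b, c (e.1, b) * w (e.1, b) := by
  classical
  set n : ℝ := (Fintype.card V : ℝ) with hn
  have hn1 : 1 ≤ n := by rw [hn]; exact_mod_cast Fintype.card_pos
  have hn0 : 0 < n := by linarith
  -- `X₁` has at most `n ^ 2` edges of cost below `1 / n`, while `X₃` and `X₄` cost at most 1 per
  -- vertex, which gives `3 * n` in all.
  let X₁ : Finset (V × V) := {e | c e < 1 / n}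
  let X₂ : Finset (V × V) := {e | w₀ < w e}
  let X₃ : Finset (V × V) := {e | ∑ a, c (a, e.2) * w (a, e.2) < w e}
  let X₄ : Finset (V × V) := {e | ∑ b, c (e.1, b) * w (e.1, b) < w e}
  have hun : ∀ P Q : Finset (V × V), ∑ e ∈ P ∪ Q, c e ≤ ∑ e ∈ P, c e + ∑ e ∈ Q, c e := by
    intro P Q
    rw [← Finset.sum_union_inter]
    exact le_add_of_nonneg_right (Finset.sum_nonneg fun e _ => hc e)
  have h1 : ∑ e ∈ X₁, c e ≤ n := by
    calc ∑ e ∈ X₁, c e ≤ ∑ e ∈ X₁, 1 / n :=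
          Finset.sum_le_sum fun e he => (Finset.mem_filter.1 he).2.le
      _ ≤ ∑ e : V × V, 1 / n := Finset.sum_le_sum_of_subset_of_nonneg (Finset.subset_univ _)
          fun e _ _ => by positivity
      _ = n := by
          rw [Finset.sum_const, Finset.card_univ, Fintype.card_prod, nsmul_eq_mul]
          push_cast
          rw [← hn]
          field_simp
  have h2 : ∑ e ∈ X₂, c e ≤ (∑ e, c e * w e) / w₀ := by
    rw [le_div_iff₀ hw₀, Finset.sum_mul]
    refine (Finset.sum_le_sum fun e he => mul_le_mul_of_nonneg_left
      (Finset.mem_filter.1 he).2.le (hc e)).trans ?_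
    exact Finset.sum_le_sum_of_subset_of_nonneg (Finset.filter_subset _ _)
      fun e _ _ => mul_nonneg (hc e) (hw e)
  have h3 : ∑ e ∈ X₃, c e ≤ n := by
    simp only [X₃, Finset.sum_filter, Fintype.sum_prod_type]
    rw [Finset.sum_comm]
    refine (Finset.sum_le_sum (g := fun _ => (1 : ℝ)) fun b _ => ?_).trans (by simp [hn])
    rw [← Finset.sum_filter]
    exact sum_cost_le_one Finset.univ (c := fun a => c (a, b)) (w := fun a => w (a, b))
      (fun a => hc _) (fun a => hw _) le_rfl
  have h4 : ∑ e ∈ X₄, c e ≤ n := by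
    simp only [X₄, Finset.sum_filter, Fintype.sum_prod_type]
    refine (Finset.sum_le_sum (g := fun _ => (1 : ℝ)) fun a _ => ?_).trans (by simp [hn])
    rw [← Finset.sum_filter]
    exact sum_cost_le_one Finset.univ (c := fun b => c (a, b)) (w := fun b => w (a, b))
      (fun a => hc _) (fun a => hw _) le_rfl
  refine ⟨E ∩ (X₁ ∪ X₂ ∪ X₃ ∪ X₄), Finset.inter_subset_left, ?_, fun e he => ?_⟩
  · have h5 := Finset.sum_le_sum_of_subset_of_nonneg (f := c)
      (Finset.inter_subset_right (s₁ := E) (s₂ := X₁ ∪ X₂ ∪ X₃ ∪ X₄)) fun e _ _ => hc e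
    linarith [hun (X₁ ∪ X₂ ∪ X₃) X₄, hun (X₁ ∪ X₂) X₃, hun X₁ X₂]
  · rw [Finset.mem_sdiff, Finset.mem_inter] at he
    have he' : ¬ e ∈ X₁ ∪ X₂ ∪ X₃ ∪ X₄ := fun h => he.2 ⟨he.1, h⟩
    simp only [X₁, X₂, X₃, X₄, Finset.mem_union, Finset.mem_filter, Finset.mem_univ, true_and,
      not_or, not_lt] at he'
    exact ⟨he'.1.1.1, he'.1.1.2, he'.1.2, he'.2⟩

/-- The existence of an integral multicut, for normalised costs and with explicit parameters. -/
theorem exists_multicut_of_params [Nonempty V] {c w : V × V → ℝ} (hc : ∀ e, 0 ≤ c e)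
    (hw : ∀ e, 0 ≤ w e) {P : Set (V × V)} {L ρ γ Λ : ℝ} {K k : ℕ} (hL : 64 ^ k * L = 1 / 2)
    (hρ : 1 ≤ ρ) (hγ : 1 ≤ γ) (hγ3 : γ ^ 3 = Fintype.card V) (hΦ : ∑ e, c e * w e = γ ^ 2)
    (hΛ1 : 1 ≤ Λ) (hlogc : 1 + 2 * Real.log (Fintype.card V) ≤ Λ)
    (hlogw : 1 + Real.log (2 ^ 23 * Λ * γ / L ^ 3) ≤ Λ)
    (hlog3 : Real.log (3 * Fintype.card V) ≤ Λ)
    (hK : 512 * (Fintype.card V : ℝ) ^ 2 / L < 2 ^ K) (hKΛ : K ≤ Λ)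
    (hρk : 4 * (Fintype.card V : ℝ) ^ 2 ≤ ρ ^ k) {E : Finset (V × V)}
    (hlen : ∀ s t, (s, t) ∈ P → ∀ p, IsPath (ofEdges E) s t p → 1 ≤ ((pathEdges p).map w).sum) :
    ∃ X ⊆ E, ∑ e ∈ X, c e ≤ γ ^ 3 * (3 + 2 ^ 23 * Λ / L ^ 3 +
        k * (72 * 2 ^ 23 * Λ ^ 3 / L ^ 3 + 64 * ρ * Λ + 2 ^ 40 * ρ * Λ ^ 4 / L ^ 4)) ∧
      ∀ s t, (s, t) ∈ P → ∀ p, ¬ IsPath (ofEdges (E \ X)) s t p := by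
  set n : ℝ := (Fintype.card V : ℝ) with hn
  have hn1 : 1 ≤ n := by rw [hn]; exact_mod_cast Fintype.card_pos
  have hn0 : 0 < n := by linarith
  have h64 : (1 : ℝ) ≤ 64 ^ k := one_le_pow₀ (by norm_num)
  have hL0 : 0 < L := by
    by_contra h
    nlinarith
  have hL1 : L ≤ 1 / 2 := hL ▸ le_mul_of_one_le_left hL0.le h64
  have hγ0 : 0 < γ := by linarith
  have hΛ0 : 0 < Λ := by linarith
  have hγn : γ ^ 2 ≤ n := by rw [← hγ3]; exact pow_le_pow_right₀ hγ (by norm_num)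
  -- Of order `1 / γ`: small enough for the crossing argument, and the price `γ ^ 2 / w₀` of the
  -- long edges and of the decomposition is still of order `γ ^ 3`.
  set w₀ := L ^ 3 / (2 ^ 23 * Λ * γ) with hw₀
  have hw₀0 : 0 < w₀ := by positivity
  have hw₀1 : 1 / w₀ = 2 ^ 23 * Λ * γ / L ^ 3 := by rw [hw₀, one_div_div]
  have hwL : 16 * w₀ ≤ L := by
    rw [hw₀, mul_div_assoc', div_le_iff₀ (by positivity)]
    have h1 : L ^ 3 ≤ L := by nlinarith [mul_pos hL0 hL0]
    have h2 : 1 ≤ Λ * γ := one_le_mul_of_one_le_of_one_le hΛ1 hγ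
    nlinarith [mul_le_mul_of_nonneg_left h2 hL0.le]
  obtain ⟨X, hXE, hcost, hX⟩ := exists_regular_cut hc hw hw₀0 E
  have hsub : E \ X ⊆ E := Finset.sdiff_subset
  have hlen' : ∀ s t, (s, t) ∈ P → ∀ p, IsPath (ofEdges (E \ X)) s t p →
      1 ≤ ((pathEdges p).map w).sum := fun s t hst p hp => hlen s t hst p (hp.mono hsub)
  -- The final `m = 1 / (2 * n)` is strictly below the least surviving edge cost `1 / n`. The
  -- initial potential of height `1 / 2` costs at most `γ ^ 2 ≤ n`, which fits because `ρ ^ k * m ≥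
  -- 4 * n ^ 2 / (2 * n) = 2 * n`.
  obtain ⟨X', hX', hcost', hlev⟩ := exists_chain_cut (P := P) (L := L) (m := 1 / (2 * n)) (ρ := ρ)
    (K := K) (K' := K) hc hw hL0 (by positivity) hρ hγ0 hΦ hw₀0 hΛ1 hlogc (hw₀1 ▸ hlogw) hlog3 (by
      rw [one_div_pow, one_div_lt (by positivity) (by positivity)]
      refine lt_of_le_of_lt ?_ hK
      have : 1 / (L / 128 * (1 / (2 * n)) / (2 * γ ^ 2)) = 512 * (n * γ ^ 2) / L := by
        field_simp; norm_num
      rw [this]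
      gcongr
      nlinarith) hKΛ (lt_of_le_of_lt (by
        rw [le_div_iff₀ hL0]
        nlinarith) hK) hKΛ hwL (by
      rw [show (L / 16) ^ 2 * (L / 128 / (2 * Λ)) / γ / 120 = L ^ 3 / (7864320 * Λ * γ) by
        field_simp; norm_num, hw₀]
      gcongr
      norm_num) k (E := E \ X) hL.le (fun e he => (hX e he).2.1) (fun e he => (hX e he).2.2.1)
    (fun e he => (hX e he).2.2.2) hlen' (fun s t hst => by
      rw [hL]
      obtain ⟨l, h1, h2, h3⟩ := exists_potential (E := E \ X) hw (by norm_num : (0 : ℝ) ≤ 1 / 2)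
        (fun p hp => le_trans (by norm_num) (hlen' s t hst p hp))
      refine ⟨l, h1, h2, h3, ?_⟩
      calc ∑ e ∈ E \ X, c e * max (l e.2 - l e.1) 0 ≤ ∑ e ∈ E \ X, c e * w e :=
            Finset.sum_le_sum fun e he => mul_le_mul_of_nonneg_left (max_le (h3 e he) (hw e)) (hc e)
        _ ≤ ∑ e, c e * w e := Finset.sum_le_sum_of_subset_of_nonneg (Finset.subset_univ _)
            fun e _ _ => mul_nonneg (hc e) (hw e)
        _ ≤ n := hΦ.le.trans hγn
        _ = 1 / 2 * (4 * n ^ 2 * (1 / (2 * n))) := by field_simp; norm_num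
        _ ≤ _ := by gcongr)
  refine ⟨X ∪ X', Finset.union_subset hXE (hX'.trans hsub), ?_, fun s t hst => ?_⟩
  · have hun : ∑ e ∈ X ∪ X', c e ≤ ∑ e ∈ X, c e + ∑ e ∈ X', c e := by
      rw [← Finset.sum_union_inter]
      exact le_add_of_nonneg_right (Finset.sum_nonneg fun e _ => hc e)
    have e1 : (∑ e, c e * w e) / w₀ = γ ^ 3 * (2 ^ 23 * Λ / L ^ 3) := by
      rw [hΦ, hw₀]; field_simp
    have e2 : 72 * Λ ^ 2 * γ ^ 2 / w₀ = γ ^ 3 * (72 * 2 ^ 23 * Λ ^ 3 / L ^ 3) := by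
      rw [hw₀]; field_simp
    rw [e1, ← hn, ← hγ3] at hcost
    rw [e2] at hcost'
    have e3 : 64 * ρ * γ ^ 3 * Λ + 2 ^ 40 * ρ * Λ ^ 4 * γ ^ 3 / L ^ 4 =
        γ ^ 3 * (64 * ρ * Λ + 2 ^ 40 * ρ * Λ ^ 4 / L ^ 4) := by ring
    rw [e3] at hcost'
    linarith
  · rw [show E \ (X ∪ X') = (E \ X) \ X' by rw [sdiff_sdiff_left]; rfl]
    refine (hlev s t hst).not_isPath hL0 (c₀ := 1 / n) ?_ (fun e he => (hX e ?_).1) (by positivity)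
    · exact one_div_lt_one_div_of_lt hn0 (by linarith)
    · exact Finset.sdiff_subset he

end Chain

end DirectedCut

/-! ### Choice of parameters for edge costs -/

namespace DirectedCut

section EdgeGap

theorem log_le_half {x : ℝ} (hx : 0 < x) : Real.log x ≤ x / 2 := by
  have h1 := Real.log_le_sub_one_of_pos (half_pos hx)
  rw [Real.log_div hx.ne' (by norm_num)] at h1
  have h2 : Real.log 2 ≤ 1 := by linarith [Real.log_two_lt_d9]
  linarith

theorem exists_pow_gt {x Λ : ℝ} (hx : 1 ≤ x) (h : 1 + 2 * Real.log x ≤ Λ) :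
    ∃ K : ℕ, x < 2 ^ K ∧ (K : ℝ) ≤ Λ := by
  have hl2 : 1 / 2 ≤ Real.log 2 := by linarith [Real.log_two_gt_d9]
  have hl0 : 0 ≤ Real.log x := Real.log_nonneg hx
  refine ⟨⌊Real.log x / Real.log 2⌋₊ + 1, ?_, ?_⟩
  · have h1 := Nat.lt_floor_add_one (Real.log x / Real.log 2)
    rw [div_lt_iff₀ (by linarith)] at h1
    rw [← Real.log_lt_log_iff (by linarith) (by positivity), Real.log_pow]
    push_cast
    exact h1
  · push_cast
    have h1 := Nat.floor_le (by positivity : 0 ≤ Real.log x / Real.log 2)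
    have h2 : Real.log x / Real.log 2 ≤ 2 * Real.log x := by
      rw [div_le_iff₀ (by linarith)]
      nlinarith
    linarith

/-- The flow-cut gap for edge costs, up to a constant for each exponent above `1 / 3`. -/
theorem exists_edge_multicut {δ : ℝ} (hδ : 0 < δ) : ∃ C : ℝ, 0 < C ∧
    ∀ (V : Type u) [Fintype V] [Nonempty V] (c w : V × V → ℝ) (P : Set (V × V))
      (E : Finset (V × V)), (∀ e, 0 ≤ c e) → (∀ e, 0 ≤ w e) →
      (∀ s t, (s, t) ∈ P → ∀ p, IsPath (ofEdges E) s t p → 1 ≤ ((pathEdges p).map w).sum) →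
      ∃ X ⊆ E, ∑ e ∈ X, c e ≤
          (∑ e ∈ E, c e * w e) * (C * (Fintype.card V : ℝ) ^ ((1 : ℝ) / 3 + δ)) ∧
        ∀ s t, (s, t) ∈ P → ∀ p, IsPath (ofEdges E) s t p → ∃ e ∈ pathEdges p, e ∈ X := by
  classical
  -- The final bound contains at most five factors `n ^ η`: four from `Λ ^ 4` and one from `ρ`.
  set η := δ / 5 with hη
  have hη0 : 0 < η := by positivity
  -- With `ρ = 4 * n ^ η`, this many rounds give `ρ ^ k ≥ 4 * n ^ 2`; the number depends on `δ`
  -- only.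
  set k := ⌈2 / η⌉₊ with hk
  have hkη : 2 ≤ k * η := by
    rw [← div_le_iff₀ hη0]; exact Nat.le_ceil _
  have hk1 : 1 ≤ k := Nat.one_le_iff_ne_zero.2 (Nat.ceil_pos.2 (by positivity)).ne'
  set L : ℝ := 1 / 2 / 64 ^ k with hL
  have h64 : (1 : ℝ) ≤ 64 ^ k := one_le_pow₀ (by norm_num)
  have hL0 : 0 < L := by positivity
  have hL1 : L ≤ 1 := by
    rw [hL, div_le_one (by positivity)]; linarith
  set M := Real.log (2 ^ 23 / L ^ 3) with hM
  have hML : Real.log (512 / L) ≤ M := by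
    refine Real.log_le_log (by positivity) ?_
    rw [div_le_div_iff₀ hL0 (by positivity)]
    have : L ^ 3 ≤ L := by nlinarith [mul_pos hL0 hL0]
    linarith
  have hM0 : 0 ≤ M := (Real.log_nonneg (by rw [le_div_iff₀ hL0]; linarith)).trans hML
  set B := 4 + 2 * M + 4 / η with hB
  have hB0 : 0 < B := by positivity
  refine ⟨3 + 2 ^ 23 * B / L ^ 3 + k * (72 * 2 ^ 23 * B ^ 3 / L ^ 3 + 256 * B +
    2 ^ 42 * B ^ 4 / L ^ 4), by positivity, ?_⟩
  intro V _ _ c w P E hc hw hlen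
  have hcut : ∀ X ⊆ E, (∀ s t, (s, t) ∈ P → ∀ p, ¬ IsPath (ofEdges (E \ X)) s t p) →
      ∀ s t, (s, t) ∈ P → ∀ p, IsPath (ofEdges E) s t p → ∃ e ∈ pathEdges p, e ∈ X := by
    intro X _ h s t hst p hp
    by_contra hcon
    push Not at hcon
    refine h s t hst p ⟨isChain_iff_pathEdges.2 fun e he => ?_, hp.2⟩
    exact Finset.mem_sdiff.2 ⟨isChain_iff_pathEdges.1 hp.1 e he, hcon e he⟩
  set n : ℝ := (Fintype.card V : ℝ) with hn
  have hn1 : 1 ≤ n := by rw [hn]; exact_mod_cast Fintype.card_pos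
  have hn0 : 0 < n := by linarith
  have hterm : ∀ e, 0 ≤ c e * w e := fun e => mul_nonneg (hc e) (hw e)
  rcases (Finset.sum_nonneg fun e (_ : e ∈ E) => hterm e).eq_or_lt with hS | hS
  -- If the fractional cost is zero it cannot be normalised, but then all edges of positive weight
  -- are free and every demand path contains one.
  · refine ⟨E.filter fun e => 0 < w e, Finset.filter_subset _ _, ?_,
      hcut _ (Finset.filter_subset _ _) ?_⟩
    · rw [← hS, zero_mul]
      refine (Finset.sum_eq_zero fun e he => ?_).le
      obtain ⟨h1, h2⟩ := Finset.mem_filter.1 he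
      exact (mul_eq_zero.1 ((Finset.sum_eq_zero_iff_of_nonneg fun e _ => hterm e).1 hS.symm e h1)
        ).resolve_right h2.ne'
    · intro s t hst p hp
      have h1 := hlen s t hst p (hp.mono Finset.sdiff_subset)
      have h2 : ((pathEdges p).map w).sum = 0 := by
        refine List.sum_eq_zero fun x hx => ?_
        obtain ⟨e, he, rfl⟩ := List.mem_map.1 hx
        obtain ⟨h3, h4⟩ := Finset.mem_sdiff.1 (isChain_iff_pathEdges.1 hp.1 e he)
        by_contra h5
        exact h4 (Finset.mem_filter.2 ⟨h3, (hw e).lt_of_ne (Ne.symm h5)⟩)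
      linarith
  set S := ∑ e ∈ E, c e * w e with hSdef
  set N := n ^ η with hN
  have hN1 : 1 ≤ N := Real.one_le_rpow hn1 hη0.le
  set γ := n ^ ((1 : ℝ) / 3) with hγ
  have hγ1 : 1 ≤ γ := Real.one_le_rpow hn1 (by norm_num)
  have hγ3 : γ ^ 3 = n := by
    rw [hγ, ← Real.rpow_natCast, ← Real.rpow_mul hn0.le]; norm_num
  have hγ0 : 0 < γ := by linarith
  set Λ := B * N with hΛ
  have hℓ0 : 0 ≤ Real.log n := Real.log_nonneg hn1
  have hℓ : Real.log n ≤ N / η := Real.log_le_rpow_div hn0.le hη0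
  -- `log n ≤ n ^ η / η`, so a constant multiple of `n ^ η` dominates all logarithmic requirements
  -- on `Λ`.
  have hΛℓ : 4 + 2 * M + 4 * Real.log n ≤ Λ := by
    have : 4 + 2 * M ≤ (4 + 2 * M) * N := le_mul_of_one_le_right (by linarith) hN1
    have e : Λ = (4 + 2 * M) * N + 4 * (N / η) := by rw [hΛ, hB]; ring
    linarith
  have hΛ0 : 0 < Λ := by positivity
  obtain ⟨K, hK, hKΛ⟩ := exists_pow_gt (x := 512 * n ^ 2 / L) (Λ := Λ)
    (by rw [le_div_iff₀ hL0]; nlinarith) (by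
      rw [show 512 * n ^ 2 / L = 512 / L * n ^ 2 by ring,
        Real.log_mul (by positivity) (by positivity), Real.log_pow]
      push_cast
      linarith)
  have hscale : 0 < γ ^ 2 / S := by positivity
  -- Weights vanish outside `E`, so that the total over all pairs is the fractional cost of `E`,
  -- normalised to `γ ^ 2` by the factor on `c`.
  let w' : V × V → ℝ := fun e => if e ∈ E then w e else 0
  obtain ⟨X, hXE, hcost, hX⟩ := exists_multicut_of_params (P := P) (E := E)
    (c := fun e => γ ^ 2 / S * c e) (w := w') (L := L) (ρ := 4 * N) (γ := γ) (Λ := Λ) (K := K)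
    (k := k) (fun e => mul_nonneg hscale.le (hc e))
    (fun e => by simp only [w']; split_ifs <;> simp [hw])
    (by rw [hL]; field_simp) (by linarith) hγ1 hγ3
    (by
      simp only [w', mul_ite, mul_zero, Finset.sum_ite_mem, Finset.univ_inter, mul_assoc]
      rw [← Finset.mul_sum, ← hSdef, div_mul_cancel₀ _ hS.ne'])
    (by linarith) (by linarith)
    (by
      rw [show 2 ^ 23 * Λ * γ / L ^ 3 = 2 ^ 23 / L ^ 3 * Λ * γ by ring,
        Real.log_mul (by positivity) hγ0.ne', Real.log_mul (by positivity) hΛ0.ne', ← hM, hγ,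
        Real.log_rpow hn0]
      linarith [log_le_half hΛ0])
    (by
      rw [← hn, Real.log_mul (by norm_num) hn0.ne']
      have : Real.log 3 ≤ 3 - 1 := Real.log_le_sub_one_of_pos (by norm_num)
      linarith)
    hK hKΛ
    (by
      rw [mul_pow]
      refine mul_le_mul (le_self_pow₀ (by norm_num) (by omega)) ?_ (by positivity) (by positivity)
      rw [hN, ← Real.rpow_natCast, ← Real.rpow_natCast, ← Real.rpow_mul hn0.le]
      refine Real.rpow_le_rpow_of_exponent_le hn1 ?_
      push_cast
      linarith)
    (fun s t hst p hp => by
      have : (pathEdges p).map w' = (pathEdges p).map w :=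
        List.map_congr_left fun e he => if_pos (isChain_iff_pathEdges.1 hp.1 e he)
      rw [this]
      exact hlen s t hst p hp)
  refine ⟨X, hXE, ?_, hcut X hXE hX⟩
  rw [← Finset.mul_sum, div_mul_eq_mul_div, div_le_iff₀ hS] at hcost
  have hN5 : N ^ 5 = n ^ δ := by
    rw [hN, ← Real.rpow_natCast, ← Real.rpow_mul hn0.le]; congr 1; push_cast; rw [hη]; ring
  have hpow : ∀ i ≤ 5, N ^ i ≤ N ^ 5 := fun i hi => pow_le_pow_right₀ hN1 hi
  have hbr : 3 + 2 ^ 23 * Λ / L ^ 3 + k * (72 * 2 ^ 23 * Λ ^ 3 / L ^ 3 + 64 * (4 * N) * Λ +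
      2 ^ 40 * (4 * N) * Λ ^ 4 / L ^ 4) ≤ (3 + 2 ^ 23 * B / L ^ 3 +
      k * (72 * 2 ^ 23 * B ^ 3 / L ^ 3 + 256 * B + 2 ^ 42 * B ^ 4 / L ^ 4)) * N ^ 5 := by
    calc _ = 3 * N ^ 0 + 2 ^ 23 * B / L ^ 3 * N ^ 1 + k * (72 * 2 ^ 23 * B ^ 3 / L ^ 3 * N ^ 3 +
          256 * B * N ^ 2 + 2 ^ 42 * B ^ 4 / L ^ 4 * N ^ 5) := by rw [hΛ]; ring
      _ ≤ 3 * N ^ 5 + 2 ^ 23 * B / L ^ 3 * N ^ 5 + k * (72 * 2 ^ 23 * B ^ 3 / L ^ 3 * N ^ 5 +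
          256 * B * N ^ 5 + 2 ^ 42 * B ^ 4 / L ^ 4 * N ^ 5) := by
          gcongr <;> norm_num
      _ = _ := by ring
  have h1 := hcost.trans (mul_le_mul_of_nonneg_right (mul_le_mul_of_nonneg_left hbr
    (by positivity : 0 ≤ γ ^ 3)) hS.le)
  rw [Real.rpow_add hn0, ← hγ, ← hN5]
  refine le_of_mul_le_mul_left (h1.trans (le_of_eq ?_)) (by positivity : 0 < γ ^ 2)
  ring

end EdgeGap

end DirectedCut

/-! ### Reduction of vertex costs to edge costs by splitting vertices -/

namespace DirectedCut

section VertexSplitting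

variable {V : Type*}

/-- `q` is the path of the split graph that corresponds to the path `p`. -/
inductive SplitPath : List V → List (V × Bool) → Prop
  | base (a b : V) : SplitPath [a, b] [(a, true), (b, false)]
  | step (a b c : V) (p : List V) (q : List (V × Bool)) :
      SplitPath (b :: c :: p) ((b, true) :: q) →
      SplitPath (a :: b :: c :: p) ((a, true) :: (b, false) :: (b, true) :: q)

theorem SplitPath.exists_split (p : List V) : ∀ a b, ∃ q, SplitPath (a :: b :: p) ((a, true) :: q) := by
  induction p with
  | nil => exact fun a b => ⟨_, .base a b⟩
  | cons c p ih =>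
    intro a b
    obtain ⟨q, hq⟩ := ih b c
    exact ⟨_, .step a b c p q hq⟩

theorem SplitPath.getLast? {p : List V} {q : List (V × Bool)} (h : SplitPath p q) :
    q.getLast? = p.getLast?.map (·, false) := by
  induction h with
  | base => rfl
  | step a b c p q _ ih =>
    simpa only [List.getLast?_cons_cons] using ih

theorem SplitPath.head? {p : List V} {q : List (V × Bool)} (h : SplitPath p q) :
    q.head? = p.head?.map (·, true) := by
  cases h <;> rfl

theorem SplitPath.mem_tail {p : List V} {q : List (V × Bool)} (h : SplitPath p q) {x : V} :
    (x, false) ∈ q ↔ x ∈ p.tail := by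
  induction h with
  | base => simp
  | step a b c p q _ ih => simp at ih ⊢; rw [ih]

theorem SplitPath.fst_mem {p : List V} {q : List (V × Bool)} (h : SplitPath p q) {x : V × Bool}
    (hx : x ∈ q) : x.1 ∈ p := by
  induction h with
  | base => simp at hx; rcases hx with rfl | rfl <;> simp
  | step a b c p q _ ih =>
    rw [List.mem_cons, List.mem_cons] at hx
    rcases hx with rfl | rfl | hx
    · simp
    · simp
    · exact List.mem_cons_of_mem _ (ih hx)

theorem SplitPath.mem_tail_true {p : List V} {q : List (V × Bool)} (h : SplitPath p q) {x : V}
    (hx : x ∈ p.tail) : p.getLast? = some x ∨ (x, true) ∈ q.tail := by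
  induction h with
  | base => simp at hx; simp [hx]
  | step a b c p q _ ih =>
    rw [List.tail_cons, List.mem_cons] at hx
    rcases hx with rfl | hx
    · simp
    · rw [List.getLast?_cons_cons]
      exact (ih hx).imp_right fun h' => by
        simp only [List.tail_cons] at h' ⊢; simp [h']

theorem SplitPath.nodup {p : List V} {q : List (V × Bool)} (h : SplitPath p q) (hp : p.Nodup) :
    q.Nodup := by
  induction h with
  | base => simp
  | step a b c p q hpq ih =>
    obtain ⟨h1, h2⟩ := List.nodup_cons.1 hp
    refine List.nodup_cons.2 ⟨fun hmem => ?_, List.nodup_cons.2 ⟨fun hmem => ?_, ih h2⟩⟩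
    · rcases List.mem_cons.1 hmem with h3 | h3
      · simp at h3
      · exact h1 (hpq.fst_mem h3)
    · exact (List.nodup_cons.1 h2).1 (hpq.mem_tail.1 hmem)

theorem SplitPath.nodup_tail {p : List V} {q : List (V × Bool)} (h : SplitPath p q)
    (hq : q.Nodup) : p.tail.Nodup := by
  induction h with
  | base => simp
  | step a b c p q hpq ih =>
    obtain ⟨h1, h2⟩ := List.nodup_cons.1 (List.nodup_cons.1 hq).2
    exact List.nodup_cons.2 ⟨fun hmem => h1 (hpq.mem_tail.2 hmem), ih h2⟩

/-- A split path begins at the exit of its first vertex and ends at the entry of its last one. A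
repeated first vertex would show its exit twice unless the repetition is the last vertex, which the
hypothesis excludes. -/
theorem SplitPath.nodup_of_nodup {p : List V} {q : List (V × Bool)} (h : SplitPath p q)
    (hq : q.Nodup) (hne : p.head? ≠ p.getLast?) : p.Nodup := by
  have h1 := h.nodup_tail hq
  have h2 := @SplitPath.mem_tail_true _ p q h
  cases h with
  | base a b => simpa using hne
  | step a b c p q hpq =>
    refine List.nodup_cons.2 ⟨fun hmem => ?_, h1⟩
    rcases h2 hmem with h3 | h3
    · exact hne h3.symm
    · exact (List.nodup_cons.1 hq).1 h3

theorem SplitPath.sum_pathEdges {p : List V} {q : List (V × Bool)} (h : SplitPath p q)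
    (w : V → ℝ) : ((pathEdges q).map fun e => if e.1.2 then 0 else w e.1.1).sum =
      ((pathInterior p).map w).sum := by
  induction h with
  | base => simp [pathEdges, pathInterior]
  | step a b c p q _ ih =>
    rw [pathEdges_cons_cons, pathEdges_cons_cons, List.map_cons, List.map_cons, List.sum_cons,
      List.sum_cons, ih]
    simp [pathInterior]

theorem SplitPath.mem_pathInterior {p : List V} {q : List (V × Bool)} (h : SplitPath p q)
    {e : (V × Bool) × (V × Bool)} (he : e ∈ pathEdges q) (he' : e.1.2 = false) :
    e.1.1 ∈ pathInterior p := by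
  induction h with
  | base => simp [pathEdges] at he; simp [he] at he'
  | step a b c p q _ ih =>
    rw [pathEdges_cons_cons, pathEdges_cons_cons, List.mem_cons, List.mem_cons] at he
    rcases he with rfl | rfl | he
    · simp at he'
    · simp [pathInterior]
    · have := ih he
      simp only [pathInterior, List.tail_cons] at this ⊢
      rw [List.dropLast_cons_cons]
      exact List.mem_cons_of_mem _ this

variable [Fintype V]

open Classical in
/-- The edges of the graph in which every vertex is split into an entry and an exit. -/
noncomputable def splitEdges (G : Digraph V) : Finset ((V × Bool) × (V × Bool)) :=
  {e | (e.1.2 = false ∧ e.2 = (e.1.1, true)) ∨ (e.1.2 = true ∧ e.2.2 = false ∧ G.Adj e.1.1 e.2.1)}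

theorem mem_splitEdges {G : Digraph V} {e : (V × Bool) × (V × Bool)} : e ∈ splitEdges G ↔
    (e.1.2 = false ∧ e.2 = (e.1.1, true)) ∨
      (e.1.2 = true ∧ e.2.2 = false ∧ G.Adj e.1.1 e.2.1) := by
  simp [splitEdges]

theorem SplitPath.isChain_iff {G : Digraph V} {p : List V} {q : List (V × Bool)}
    (h : SplitPath p q) : q.IsChain (ofEdges (splitEdges G)).Adj ↔ p.IsChain G.Adj := by
  have hAdj : ∀ x y, (ofEdges (splitEdges G)).Adj x y ↔ (x, y) ∈ splitEdges G := fun _ _ => Iff.rfl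
  induction h with
  | base => simp [hAdj, mem_splitEdges]
  | step a b c p q _ ih =>
    rw [List.isChain_cons_cons, List.isChain_cons_cons]
    refine (and_congr Iff.rfl (and_congr Iff.rfl ih)).trans ?_
    simp [hAdj, mem_splitEdges]

/-- Edges of the split graph alternate between exit-to-entry and entry-to-exit of one vertex, so the
chain is determined two vertices at a time; hence the induction on a bound for the length. -/
theorem exists_splitPath {G : Digraph V} {t : V} : ∀ (N : ℕ) (a : V) (q : List (V × Bool)),
    q.length ≤ N → ((a, true) :: q).IsChain (ofEdges (splitEdges G)).Adj →
    ((a, true) :: q).getLast? = some (t, false) → ∃ p, SplitPath (a :: p) ((a, true) :: q) := by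
  have hAdj : ∀ x y, (ofEdges (splitEdges G)).Adj x y ↔ (x, y) ∈ splitEdges G := fun _ _ => Iff.rfl
  intro N
  induction N with
  | zero =>
    intro a q hq _ hl
    rw [List.length_eq_zero_iff.1 (Nat.le_zero.1 hq)] at hl
    simp at hl
  | succ N ih =>
    intro a q hq hch hl
    match q, hq, hch, hl with
    | [], _, _, hl => simp at hl
    | [(b, i)], _, hch, hl =>
      simp at hl
      obtain ⟨rfl, rfl⟩ := hl
      exact ⟨_, .base a b⟩
    | (b, i) :: (b', i') :: q, hq, hch, hl =>
      rw [List.isChain_cons_cons, List.isChain_cons_cons, hAdj, hAdj, mem_splitEdges,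
        mem_splitEdges] at hch
      simp only [Bool.true_eq_false, false_and, true_and, false_or] at hch
      obtain ⟨⟨rfl, -⟩, h2, h3⟩ := hch
      simp only [Prod.mk.injEq, true_and, Bool.false_eq_true, false_and, or_false] at h2
      obtain ⟨rfl, rfl⟩ := h2
      rw [List.getLast?_cons_cons, List.getLast?_cons_cons] at hl
      obtain ⟨p, hp⟩ := ih b' q (by simp at hq; omega) h3 hl
      cases p with
      | nil => cases hp
      | cons c p => exact ⟨_, .step a b' c p q hp⟩

/-- The flow-cut gap for vertex costs, up to a constant for each exponent above `1 / 3`. -/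
theorem exists_vertex_multicut {δ : ℝ} (hδ : 0 < δ) : ∃ C : ℝ, 0 < C ∧
    ∀ (V : Type u) [Fintype V] [Nonempty V] (c w : V → ℝ) (P : Set (V × V))
      (G : Digraph V), (∀ v, 0 ≤ c v) → (∀ v, 0 ≤ w v) →
      (∀ s t, (s, t) ∈ P → ∀ p, IsPath G s t p → 1 ≤ ((pathInterior p).map w).sum) →
      ∃ X : Finset V, ∑ v ∈ X, c v ≤
          (∑ v, c v * w v) * (C * (Fintype.card V : ℝ) ^ ((1 : ℝ) / 3 + δ)) ∧
        ∀ s t, (s, t) ∈ P → ∀ p, IsPath G s t p → ∃ v ∈ pathInterior p, v ∈ X := by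
  classical
  obtain ⟨C, hC, H⟩ := exists_edge_multicut.{u} hδ
  -- The split graph has `2 * n` vertices.
  refine ⟨C * 2 ^ ((1 : ℝ) / 3 + δ), by positivity, ?_⟩
  intro V _ _ c w P G hc hw hlen
  -- The one-vertex path has empty interior, so no demand joins a vertex to itself.
  have hns : ∀ s t, (s, t) ∈ P → s ≠ t := by
    rintro s _ hst rfl
    have := hlen s s hst [s] ⟨List.isChain_singleton _, List.nodup_singleton _, rfl, rfl⟩
    simp [pathInterior] at this
    linarith
  set bound := (∑ v, c v * w v) * (C * (Fintype.card (V × Bool) : ℝ) ^ ((1 : ℝ) / 3 + δ)) with hbd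
  have hb0 : 0 ≤ bound := mul_nonneg (Finset.sum_nonneg fun v _ => mul_nonneg (hc v) (hw v))
    (by positivity)
  -- Original edges have weight zero and a cost above the guaranteed bound, so the cut consists of
  -- vertex edges only.
  let c' : (V × Bool) × (V × Bool) → ℝ := fun e => if e.1.2 then bound + 1 else c e.1.1
  let w' : (V × Bool) × (V × Bool) → ℝ := fun e => if e.1.2 then 0 else w e.1.1
  let P' : Set ((V × Bool) × (V × Bool)) :=
    {e | e.1.2 = true ∧ e.2.2 = false ∧ (e.1.1, e.2.1) ∈ P}
  have hc' : ∀ e, 0 ≤ c' e := fun e => by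
    simp only [c']; split_ifs
    · linarith
    · exact hc _
  have hw' : ∀ e, 0 ≤ w' e := fun e => by
    simp only [w']; split_ifs
    · exact le_rfl
    · exact hw _
  obtain ⟨X, hXE, hcost, hX⟩ := H (V × Bool) c' w' P' (splitEdges G) hc' hw' (by
    rintro ⟨s, i⟩ ⟨t, i'⟩ ⟨rfl, rfl, hst⟩ q hq
    have hst' : (s, t) ∈ P := hst
    obtain ⟨h1, h2, h3, h4⟩ := hq
    cases q with
    | nil => simp at h3
    | cons x q =>
      simp only [List.head?_cons, Option.some.injEq] at h3
      subst h3
      obtain ⟨p, hp⟩ := exists_splitPath _ s q le_rfl h1 h4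
      have hl : (s :: p).getLast? = some t := by
        have := hp.getLast?
        rw [h4] at this
        cases hh : (s :: p).getLast? with
        | none => simp [hh] at this
        | some y => simp [hh] at this; rw [this]
      have hpath : IsPath G s t (s :: p) :=
        ⟨hp.isChain_iff.1 h1, hp.nodup_of_nodup h2 (by rw [hl]; simpa using hns s t hst'), rfl, hl⟩
      exact (hlen s t hst' _ hpath).trans (hp.sum_pathEdges w).ge)
  let ι : V ↪ (V × Bool) × (V × Bool) := ⟨fun v => ((v, false), (v, true)), fun a b h => by
    simpa using h⟩
  have hsum : ∑ e ∈ splitEdges G, c' e * w' e = ∑ v, c v * w v := by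
    have h1 : Finset.univ.map ι ⊆ splitEdges G := fun e he => by
      obtain ⟨v, -, rfl⟩ := Finset.mem_map.1 he
      exact mem_splitEdges.2 (Or.inl ⟨rfl, rfl⟩)
    rw [← Finset.sum_subset h1, Finset.sum_map]
    · exact Finset.sum_congr rfl fun v _ => rfl
    · intro e he hne
      rcases mem_splitEdges.1 he with ⟨h2, h3⟩ | ⟨h2, -⟩
      · exact absurd (Finset.mem_map.2 ⟨e.1.1, Finset.mem_univ _, by
          exact Prod.ext (Prod.ext rfl h2.symm) h3.symm⟩) hne
      · simp [w', h2]
  rw [hsum, ← hbd] at hcost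
  have hXf : ∀ e ∈ X, e.1.2 = false := by
    intro e he
    by_contra h
    have h1 := Finset.single_le_sum (f := c') (fun e _ => hc' e) he
    simp only [c', if_pos (Bool.eq_true_of_not_eq_false h)] at h1
    change bound + 1 ≤ ∑ e ∈ X, c' e at h1
    linarith
  refine ⟨Finset.univ.filter fun v => ι v ∈ X, ?_, ?_⟩
  · have h1 : ∑ v with ι v ∈ X, c v ≤ ∑ e ∈ X, c' e := by
      calc ∑ v with ι v ∈ X, c v = ∑ e ∈ (Finset.univ.filter fun v => ι v ∈ X).map ι, c' e := by
            rw [Finset.sum_map]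
            exact Finset.sum_congr rfl fun v _ => rfl
        _ ≤ _ := Finset.sum_le_sum_of_subset_of_nonneg (fun e he => by
            obtain ⟨v, hv, rfl⟩ := Finset.mem_map.1 he
            exact (Finset.mem_filter.1 hv).2) fun e _ _ => hc' e
    refine (h1.trans hcost).trans (le_of_eq ?_)
    rw [hbd, Fintype.card_prod, Fintype.card_bool]
    push_cast
    rw [mul_comm (Fintype.card V : ℝ) 2, Real.mul_rpow (by norm_num) (by positivity)]
    ring
  · intro s t hst p hp
    have hne := hns s t hst
    match p, hp with
    | [], hp => simp [IsPath] at hp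
    | [a], hp =>
      have h3 := hp.2.2.1
      have h4 := hp.2.2.2
      simp only [List.head?_cons, List.getLast?_singleton, Option.some.injEq] at h3 h4
      exact absurd (h3.symm.trans h4) hne
    | a :: b :: p, hp =>
      obtain ⟨q, hq⟩ := SplitPath.exists_split p a b
      obtain ⟨h1, h2, h3, h4⟩ := hp
      obtain ⟨e, heq, heX⟩ := hX (s, true) (t, false) ⟨rfl, rfl, hst⟩ _
        ⟨hq.isChain_iff.2 h1, hq.nodup h2, by rw [hq.head?, h3]; rfl, by rw [hq.getLast?, h4]; rfl⟩
      refine ⟨e.1.1, hq.mem_pathInterior heq (hXf e heX), Finset.mem_filter.2 ⟨Finset.mem_univ _, ?_⟩⟩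
      rcases mem_splitEdges.1 (hXE heX) with ⟨h5, h6⟩ | ⟨h5, -⟩
      · have : ι e.1.1 = e := Prod.ext (Prod.ext rfl h5.symm) h6.symm
        rwa [this]
      · rw [hXf e heX] at h5
        exact absurd h5 (by simp)

end VertexSplitting

end DirectedCut

/-! ### Transfer to the stated definitions and the exponent `1/3 + o(1)` -/

namespace DirectedCut

theorem ofEdges_edges {V : Type*} [Fintype V] (G : Digraph V) : ofEdges (edges G) = G := by
  ext a b
  simp [ofEdges, edges]

theorem coe_sum_map {α : Type*} (l : List α) (w : α → ℝ≥0) :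
    (((l.map w).sum : ℝ≥0) : ℝ) = (l.map fun x => (w x : ℝ)).sum := by
  rw [NNReal.coe_list_sum, List.map_map]; rfl

theorem IsFractionalEdgeMulticut.one_le_sum {V : Type*} {G : Digraph V} {P : Set (V × V)}
    {w : V × V → ℝ≥0} (h : IsFractionalEdgeMulticut G P w) {s t : V} (hst : (s, t) ∈ P)
    {p : List V} (hp : IsPath G s t p) : 1 ≤ ((pathEdges p).map fun e => (w e : ℝ)).sum := by
  have h1 : (1 : ℝ≥0∞) ≤ (((pathEdges p).map w).sum : ℝ≥0) := (h s t hst).trans (iInf₂_le p hp)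
  rw [← coe_sum_map]
  exact_mod_cast h1

theorem IsFractionalVertexMulticut.one_le_sum {V : Type*} {G : Digraph V} {P : Set (V × V)}
    {w : V → ℝ≥0} (h : IsFractionalVertexMulticut G P w) {s t : V} (hst : (s, t) ∈ P)
    {p : List V} (hp : IsPath G s t p) : 1 ≤ ((pathInterior p).map fun v => (w v : ℝ)).sum := by
  have h1 : (1 : ℝ≥0∞) ≤ (((pathInterior p).map w).sum : ℝ≥0) := (h s t hst).trans (iInf₂_le p hp)
  rw [← coe_sum_map]
  exact_mod_cast h1

theorem EdgeFlowCutGapLE.mono {n : ℕ} {γ γ' : ℝ} (h : γ ≤ γ') (hγ : EdgeFlowCutGapLE.{u} n γ) :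
    EdgeFlowCutGapLE.{u} n γ' := fun V _ hV G cost w P hw =>
  (hγ V hV G cost w P hw).imp fun _ hX =>
    ⟨hX.1, hX.2.trans (mul_le_mul_of_nonneg_left h (NNReal.coe_nonneg _))⟩

theorem VertexFlowCutGapLE.mono {n : ℕ} {γ γ' : ℝ} (h : γ ≤ γ')
    (hγ : VertexFlowCutGapLE.{u} n γ) : VertexFlowCutGapLE.{u} n γ' := fun V _ hV G cost w P hw =>
  (hγ V hV G cost w P hw).imp fun _ hX =>
    ⟨hX.1, hX.2.trans (mul_le_mul_of_nonneg_left h (NNReal.coe_nonneg _))⟩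

/-- A demand would join a vertex to itself, and the one-vertex path has weight zero; so there are no
demands and the empty cut works. -/
theorem flowCutGapLE_of_le_one {n : ℕ} (hn : n ≤ 1) {γ : ℝ} (hγ : 0 ≤ γ) :
    EdgeFlowCutGapLE.{u} n γ ∧ VertexFlowCutGapLE.{u} n γ := by
  have hself : ∀ {V : Type u} (G : Digraph V) (s : V), IsPath G s s [s] := fun G s =>
    ⟨List.isChain_singleton _, List.nodup_singleton _, rfl, rfl⟩
  constructor
  · intro V _ hV G cost w P hw
    have : Subsingleton V := Fintype.card_le_one_iff_subsingleton.1 (hV.trans_le hn)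
    refine ⟨∅, ⟨Finset.empty_subset _, fun s t hst => ?_⟩, ?_⟩
    · obtain rfl := Subsingleton.elim s t
      have := hw.one_le_sum hst (hself G s)
      simp [pathEdges] at this
      linarith
    · rw [Finset.sum_empty, NNReal.coe_zero]
      exact mul_nonneg (NNReal.coe_nonneg _) hγ
  · intro V _ hV G cost w P hw
    have : Subsingleton V := Fintype.card_le_one_iff_subsingleton.1 (hV.trans_le hn)
    refine ⟨∅, fun s t hst => ?_, ?_⟩
    · obtain rfl := Subsingleton.elim s t
      have := hw.one_le_sum hst (hself G s)
      simp [pathInterior] at this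
      linarith
    · rw [Finset.sum_empty, NNReal.coe_zero]
      exact mul_nonneg (NNReal.coe_nonneg _) hγ

theorem exists_flowCutGapLE {δ : ℝ} (hδ : 0 < δ) : ∃ C : ℝ, 0 < C ∧ ∀ n : ℕ, 1 ≤ n →
    EdgeFlowCutGapLE.{u} n (C * (n : ℝ) ^ ((1 : ℝ) / 3 + δ)) ∧
      VertexFlowCutGapLE.{u} n (C * (n : ℝ) ^ ((1 : ℝ) / 3 + δ)) := by
  obtain ⟨C₁, hC₁, H₁⟩ := exists_edge_multicut.{u} hδ
  obtain ⟨C₂, hC₂, H₂⟩ := exists_vertex_multicut.{u} hδ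
  refine ⟨max C₁ C₂, lt_max_of_lt_left hC₁, fun n hn => ⟨?_, ?_⟩⟩
  · refine EdgeFlowCutGapLE.mono (mul_le_mul_of_nonneg_right (le_max_left C₁ C₂) (by positivity)) ?_
    intro V _ hV G cost w P hw
    have : Nonempty V := Fintype.card_pos_iff.1 (by omega)
    obtain ⟨X, hXE, hcost, hX⟩ := H₁ V (fun e => cost e) (fun e => w e) P (edges G)
      (fun e => NNReal.coe_nonneg _) (fun e => NNReal.coe_nonneg _) (fun s t hst p hp => by
        rw [ofEdges_edges] at hp
        exact hw.one_le_sum hst hp)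
    rw [ofEdges_edges] at hX
    refine ⟨X, ⟨hXE, hX⟩, ?_⟩
    push_cast
    rwa [hV] at hcost
  · refine VertexFlowCutGapLE.mono
      (mul_le_mul_of_nonneg_right (le_max_right C₁ C₂) (by positivity)) ?_
    intro V _ hV G cost w P hw
    have : Nonempty V := Fintype.card_pos_iff.1 (by omega)
    obtain ⟨X, hcost, hX⟩ := H₂ V (fun v => cost v) (fun v => w v) P G
      (fun v => NNReal.coe_nonneg _) (fun v => NNReal.coe_nonneg _)
      (fun s t hst p hp => hw.one_le_sum hst hp)
    refine ⟨X, hX, ?_⟩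
    push_cast
    rwa [hV] at hcost

/-- Bounds `C * n ^ (β + δ)` for every `δ > 0` combine into a bound `n ^ (β + o(1))`. -/
theorem exists_exponent {p : ℕ → ℝ → Prop} (hmono : ∀ n x y, x ≤ y → p n x → p n y)
    (h1 : ∀ n ≤ 1, ∀ x, 0 ≤ x → p n x) {β : ℝ}
    (h : ∀ δ, 0 < δ → ∃ C : ℝ, 0 < C ∧ ∀ n : ℕ, 1 ≤ n → p n (C * (n : ℝ) ^ (β + δ))) :
    ∃ ε : ℕ → ℝ, Tendsto ε atTop (𝓝 0) ∧ ∀ n : ℕ, p n ((n : ℝ) ^ (β + ε n)) := by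
  -- The admissible errors in the exponent at `n`. A constant `C` is at most `n ^ x` for large `n`,
  -- so for each `δ` eventually `x + δ` is admissible with `x` as small as desired.
  let S : ℕ → Set ℝ := fun n => {x | 0 ≤ x ∧ p n ((n : ℝ) ^ (β + x))}
  have hmem : ∀ {n : ℕ} {C δ x : ℝ}, 2 ≤ n → 0 ≤ x → 0 < δ → C ≤ (n : ℝ) ^ x →
      p n (C * (n : ℝ) ^ (β + δ)) → x + δ ∈ S n := by
    intro n C δ x hn hx hδ hC hp
    have hn0 : (0 : ℝ) < n := by exact_mod_cast (by omega : 0 < n)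
    refine ⟨by linarith, hmono _ _ _ ?_ hp⟩
    rw [show β + (x + δ) = x + (β + δ) by ring, Real.rpow_add hn0 x]
    exact mul_le_mul_of_nonneg_right hC (by positivity)
  have hbdd : ∀ n, BddBelow (S n) := fun n => ⟨0, fun x hx => hx.1⟩
  have hne : ∀ n, 2 ≤ n → (S n).Nonempty := by
    intro n hn
    obtain ⟨C, hC, H⟩ := h 1 one_pos
    have hn1 : (1 : ℝ) < n := by exact_mod_cast hn
    obtain ⟨k, hk⟩ := pow_unbounded_of_one_lt C hn1
    exact ⟨_, hmem (x := k) hn k.cast_nonneg one_pos (by rw [Real.rpow_natCast]; exact hk.le)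
      (H n (by omega))⟩
  -- The infimum need not be admissible; a vanishing positive amount is added to lie above some
  -- admissible error.
  refine ⟨fun n => sInf (S n) + 1 / ((n : ℝ) + 1), ?_, fun n => ?_⟩
  · have h0 : Tendsto (fun n : ℕ => 1 / ((n : ℝ) + 1)) atTop (𝓝 0) :=
      tendsto_one_div_add_atTop_nhds_zero_nat
    have h2 : Tendsto (fun n => sInf (S n)) atTop (𝓝 0) := by
      rw [Metric.tendsto_atTop]
      intro r hr
      obtain ⟨C, hC, H⟩ := h (r / 3) (by positivity)
      have h3 : Tendsto (fun n : ℕ => (n : ℝ) ^ (r / 3)) atTop atTop :=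
        (tendsto_rpow_atTop (by positivity)).comp tendsto_natCast_atTop_atTop
      obtain ⟨M, hM⟩ := eventually_atTop.1 (h3.eventually_ge_atTop C)
      refine ⟨max M 2, fun n hn => ?_⟩
      have h4 := hmem (x := r / 3) (le_trans (le_max_right _ _) hn) (by positivity)
        (by positivity : 0 < r / 3) (hM n (le_trans (le_max_left _ _) hn))
        (H n (by have := le_trans (le_max_right M 2) hn; omega))
      rw [Real.dist_eq, sub_zero, abs_of_nonneg (Real.sInf_nonneg fun x hx => hx.1)]
      linarith [csInf_le (hbdd n) h4]
    simpa using h2.add h0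
  · rcases Nat.lt_or_ge n 2 with hn | hn
    · exact h1 n (by omega) _ (by positivity)
    · have hpos : (0 : ℝ) < 1 / ((n : ℝ) + 1) := by positivity
      obtain ⟨x, hx, hlt⟩ := exists_lt_of_csInf_lt (hne n hn) (lt_add_of_pos_right (sInf (S n)) hpos)
      refine hmono _ _ _ (Real.rpow_le_rpow_of_exponent_le ?_ (by linarith)) hx.2
      exact_mod_cast (by omega : 1 ≤ n)

end DirectedCut

theorem theorem1 :
    ∃ ε : ℕ → ℝ, Tendsto ε atTop (𝓝 0) ∧
      ∀ n : ℕ,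
        DirectedCut.EdgeFlowCutGapLE.{u} n ((n : ℝ) ^ ((1 : ℝ) / 3 + ε n)) ∧
        DirectedCut.VertexFlowCutGapLE.{u} n ((n : ℝ) ^ ((1 : ℝ) / 3 + ε n)) :=
  DirectedCut.exists_exponent
    (p := fun n x => DirectedCut.EdgeFlowCutGapLE.{u} n x ∧ DirectedCut.VertexFlowCutGapLE.{u} n x)
    (fun _ _ _ h hp => ⟨hp.1.mono h, hp.2.mono h⟩)
    (fun _ hn _ hx => DirectedCut.flowCutGapLE_of_le_one hn hx)
    fun _ hδ => DirectedCut.exists_flowCutGapLE hδ
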